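/- Let $d,k\ge 1$, let $p=2$ ($k$-means) or $p=1$ ($k$-medians), and let $\lambda>0$. All norms are Euclidean. A hypothesis is a nonempty finite set $h\subset\mathbb R^d$ of at most $k$ centroids, with loss $\ell(x,h)=\min_{c\in h}\|x-c\|^p$ and risk $\mathcal R(\pi,h)=\mathbb E_{X\sim\pi}\,\ell(X,h)$. For $s,R>0$ let $\mathcal H_{k,s,R}$ be the set of all hypotheses $h$ with $\|c-c'\|\ge s$ for all distinct $c,c'\in h$ and $\|c\|\le R$ for all $c\in h$. For a class $\mathcal H$ of hypotheses let $\mathfrak S_{\mathcal H}$ be the set of all mixtures $\sum_{c\in h}\alpha_c\delta_c$ with $h\in\mathcal H$, $\alpha_c\ge0$, $\sum_{c\in h}\alpha_c=1$, and let $\|\pi-\pi'\|_{\mathcal L(\mathcal H)}=\sup_{h\in\mathcal H}|\mathcal R(\pi,h)-\mathcal R(\pi',h)|$. Let $w(\omega)=1+\|\omega\|^2/(\lambda^2d)$, $C_\Lambda=(4+2/d)^{1/2}$, and $\phi_\omega(x)=C_\Lambda e^{\mathrm i\omega^Tx}/w(\omega)$ for $\omega\in\mathbb R^d$. Let $\Lambda$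 be the probability law on $\mathbb R^d$ with density proportional to $w^2(\omega)e^{-\|\omega\|^2/(2\lambda^2)}$. Draw $\omega_1,\dots,\omega_m$ independently from $\Lambda$, put $\Phi(x)=m^{-1/2}(\phi_{\omega_j}(x))_{j=1}^m\in\mathbb C^m$ and $\mathcal A(\pi)=\mathbb E_{X\sim\pi}\Phi(X)$, extended linearly to differences of probability distributions. Let $\kappa(x,x')=\mathbb E_{\omega\sim\Lambda}\phi_\omega(x)\overline{\phi_\omega(x')}$, $\kappa(\pi,\pi')=\mathbb E_{X\sim\pi}\mathbb E_{X'\sim\pi'}\kappa(X,X')$, $\|\pi-\pi'\|_\kappa=(\kappa(\pi,\pi)-2\kappa(\pi,\pi')+\kappa(\pi',\pi'))^{1/2}$, and let $$C_\kappa(\mathcal H)=\sup\Big\{\tfrac{\|\pi-\pi'\|_{\mathcal L(\mathcal H)}}{\|\pi-\pi'\|_\kappa}:\ \pi,\pi'\in\mathfrak S_{\mathcal H},\ \|\pi-\pi'\|_\kappa>0\Big\}$$ be the compatibility constant (with $\sup\emptyset=0$). For $C_{\mathcal A}\ge0$ let $$D_{C_{\mathcal A}}(\pi_0,\mathfrak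 S_{\mathcal H})=\inf_{\sigma\in\mathfrak S_{\mathcal H}}\big\{\|\pi_0-\sigma\|_{\mathcal L(\mathcal H)}+2C_{\mathcal A}\|\mathcal A(\pi_0-\sigma)\|\big\}.$$ Let $\sigma_k=(2.4(\log(2k-1)+10))^{-1/2}$, $\varepsilon=1/(\lambda\sigma_k)$, and let $R>\varepsilon$ be such that $\mathcal H_{k,2\varepsilon,R}$ is nonempty. There is a universal constant $C>0$ (independent of $p,d,k,\lambda,R$ and of everything below) such that for all $\zeta,\delta\in(0,1)$ and every $$m\ \ge\ C\,\delta^{-2}\,k\log(ek)\,\min(\log(ek),d)\Big[kd\Big(1+\log(kd)+\log\tfrac R\varepsilon+\log\tfrac1\delta\Big)+\log\tfrac1\zeta\Big]$$ the following holds. For every $\mathcal H\subset\mathcal H_{k,2\varepsilon,R}$ we have $C_\kappa(\mathcal H)\le 8\sqrt6\,\sqrt k\,R^p$. Moreover, with probability at least $1-\zeta$ on the draw of $(\omega_j)_{j=1}^m$, simultaneously for every $\mathcal H\subset\mathcal H_{k,2\varepsilon,R}$, every probability distribution $\pi_0$ on $\mathbb R^d$ such that $\ell(\cdot,h)$ is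 $\pi_0$-integrable for all $h\in\mathcal H$, every $n\ge1$ and all $x_1,\dots,x_n\in\mathbb R^d$ with empirical distribution $\hat\pi_n=\frac1n\sum_{i=1}^n\delta_{x_i}$ and sketch $\mathbf y=\mathcal A(\hat\pi_n)$, every $$\hat h\in\arg\min_{h\in\mathcal H}\ \min_{\alpha_c\ge0,\ \sum_{c\in h}\alpha_c=1}\Big\|\sum_{c\in h}\alpha_c\Phi(c)-\mathbf y\Big\|^2$$ and every $h^\star\in\arg\min_{h\in\mathcal H}\mathcal R(\pi_0,h)$ satisfy: (a) with $C_{\mathcal A}=C_\kappa(\mathcal H)/\sqrt{1-\delta}$, $$\mathcal R(\pi_0,\hat h)-\mathcal R(\pi_0,h^\star)\ \le\ 2D_{C_{\mathcal A}}(\pi_0,\mathfrak S_{\mathcal H})+4C_{\mathcal A}\,\|\mathcal A(\pi_0-\hat\pi_n)\|;$$ (b) with $C_{\mathcal A}=8\sqrt6\,\sqrt k\,R^p/\sqrt{1-\delta}$, $$\mathcal R(\pi_0,\hat h)-\mathcal R(\pi_0,h^\star)\ \le\ 2D_{C_{\mathcal A}}(\pi_0,\mathfrak S_{\mathcal H})+C_{\mathcal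 A}\,\|\mathcal A(\pi_0-\hat\pi_n)\|.$$ -/

import Mathlib

open MeasureTheory
open scoped ENNReal

noncomputable section

namespace CompressiveClustering

/-! ### Clustering: losses, risks, separated hypotheses, mixtures of Diracs -/

/-- The sample space `ℝ^d` with its Euclidean norm. -/
abbrev Space (d : ℕ) : Type := EuclideanSpace ℝ (Fin d)

/-- The loss `min_{c ∈ h} ‖x - c‖^p` (`k`-means: `p = 2`, `k`-medians: `p = 1`) of a set of
centroids `h`. (Only used for nonempty `h`.) -/
def loss {d : ℕ} (p : ℕ) (x : Space d) (h : Finset (Space d)) : ℝ :=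
  ⨅ c : h, ‖x - (c : Space d)‖ ^ p

/-- The clustering risk `𝔼_{X ∼ P} loss(X, h)`. -/
def risk {d : ℕ} (p : ℕ) (P : Measure (Space d)) (h : Finset (Space d)) : ℝ :=
  ∫ x, loss p x h ∂P

/-- Nonempty sets of at most `k` centroids, pairwise at distance at least `s`, all of them in the
ball of radius `R`. -/
def separated (d k : ℕ) (s R : ℝ) : Set (Finset (Space d)) :=
  {h | h.Nonempty ∧ h.card ≤ k ∧ (∀ c ∈ h, ∀ c' ∈ h, c ≠ c' → s ≤ ‖c - c'‖) ∧ ∀ c ∈ h, ‖c‖ ≤ R}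

/-- The mixture `∑_{c ∈ h} α_c δ_c`. -/
def mixture {d : ℕ} (h : Finset (Space d)) (α : h → ℝ) : Measure (Space d) :=
  ∑ c : h, ENNReal.ofReal (α c) • Measure.dirac (c : Space d)

/-- The model set: all mixtures of Diracs located at the centroids of some `h ∈ H`. -/
def model {d : ℕ} (H : Set (Finset (Space d))) : Set (Measure (Space d)) :=
  {P | ∃ h ∈ H, ∃ α ∈ stdSimplex ℝ h, P = mixture h α}

/-- The (semi-)norm `‖P - Q‖_{L(H)} = sup_{h ∈ H} |risk(P, h) - risk(Q, h)|`. -/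
def riskDist {d : ℕ} (p : ℕ) (H : Set (Finset (Space d))) (P Q : Measure (Space d)) : ℝ≥0∞ :=
  ⨆ h ∈ H, ENNReal.ofReal |risk p P h - risk p Q h|

/-- The empirical distribution of `x_1, …, x_n`. -/
def empirical {d n : ℕ} (x : Fin n → Space d) : Measure (Space d) :=
  (n : ℝ≥0∞)⁻¹ • ∑ i, Measure.dirac (x i)

/-! ### Weighted random Fourier features -/

/-- The weight `w(ω) = 1 + ‖ω‖² / (λ² d)`. -/
def weight {d : ℕ} (lam : ℝ) (ω : Space d) : ℝ := 1 + ‖ω‖ ^ 2 / (lam ^ 2 * d)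

/-- The unnormalized density `w(ω)² exp(-‖ω‖² / (2 λ²))`. -/
def freqDensity {d : ℕ} (lam : ℝ) (ω : Space d) : ℝ≥0∞ :=
  ENNReal.ofReal (weight lam ω ^ 2 * Real.exp (-‖ω‖ ^ 2 / (2 * lam ^ 2)))

/-- The law `Λ` of one frequency: the probability distribution on `ℝ^d` with density proportional
to `freqDensity`. -/
def freqLaw (d : ℕ) (lam : ℝ) : Measure (Space d) :=
  (∫⁻ ω : Space d, freqDensity lam ω)⁻¹ • volume.withDensity (freqDensity lam)

/-- The constant `C_Λ`; its square is the mean of `w²` under the Gaussian law `N(0, λ² I_d)`. -/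
def CΛ (d : ℕ) : ℝ := √(4 + 2 / d)

/-- One weighted Fourier feature `φ_ω(x) = C_Λ exp(i ⟨ω, x⟩) / w(ω)`. -/
def feature {d : ℕ} (lam : ℝ) (ω x : Space d) : ℂ :=
  CΛ d * Complex.exp (Complex.I * (inner ℝ ω x : ℝ)) / (weight lam ω : ℂ)

/-- The feature function `Φ(x) = m^{-1/2} (φ_{ω_1}(x), …, φ_{ω_m}(x))`. -/
def featureMap {d m : ℕ} (lam : ℝ) (ω : Fin m → Space d) (x : Space d) :
    EuclideanSpace ℂ (Fin m) :=
  WithLp.toLp 2 fun j => feature lam (ω j) x / (√(m : ℝ) : ℂ)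

/-- The sketching operator `A(P) = 𝔼_{X ∼ P} Φ(X)`. -/
def sketch {d m : ℕ} (lam : ℝ) (ω : Fin m → Space d) (P : Measure (Space d)) :
    EuclideanSpace ℂ (Fin m) :=
  ∫ x, featureMap lam ω x ∂P

/-- `h` is learned from the sketch `y` over the class `H`: together with suitable weights it
minimizes `‖∑_{c ∈ h'} α'_c Φ(c) - y‖²` over all `h' ∈ H` and all weights `α'` in the simplex. -/
def IsSketchEstimate {d m : ℕ} (lam : ℝ) (ω : Fin m → Space d) (H : Set (Finset (Space d)))
    (y : EuclideanSpace ℂ (Fin m)) (h : Finset (Space d)) : Prop :=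
  h ∈ H ∧ ∃ α ∈ stdSimplex ℝ h, ∀ h' ∈ H, ∀ α' ∈ stdSimplex ℝ h',
    ‖∑ c : h, (α c : ℂ) • featureMap lam ω (c : Space d) - y‖ ^ 2 ≤
      ‖∑ c : h', (α' c : ℂ) • featureMap lam ω (c : Space d) - y‖ ^ 2

/-! ### Kernel, maximum mean discrepancy, compatibility constant, bias term -/

/-- The kernel `κ(x, x') = 𝔼_{ω ∼ Λ} φ_ω(x) conj(φ_ω(x'))` whose integral representation is given
by the random features (it is real-valued, the law of `ω` being symmetric). -/
def kernel {d : ℕ} (lam : ℝ) (x x' : Space d) : ℝ :=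
  (∫ ω, feature lam ω x * (starRingEnd ℂ) (feature lam ω x') ∂(freqLaw d lam)).re

/-- The mean map embedding `κ(P, Q) = 𝔼_{X ∼ P} 𝔼_{X' ∼ Q} κ(X, X')`. -/
def meanKernel {d : ℕ} (lam : ℝ) (P Q : Measure (Space d)) : ℝ :=
  ∫ x, ∫ x', kernel lam x x' ∂Q ∂P

/-- The maximum mean discrepancy `‖P - Q‖_κ`. -/
def mmd {d : ℕ} (lam : ℝ) (P Q : Measure (Space d)) : ℝ :=
  √(meanKernel lam P P - 2 * meanKernel lam P Q + meanKernel lam Q Q)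

/-- The compatibility constant `C_κ(L(H), S_H)`: the supremum of `‖P - Q‖_{L(H)} / ‖P - Q‖_κ` over
`P, Q` in the model set with `‖P - Q‖_κ > 0`. -/
def compat {d : ℕ} (lam : ℝ) (p : ℕ) (H : Set (Finset (Space d))) : ℝ≥0∞ :=
  ⨆ P ∈ model H, ⨆ Q ∈ model H, ⨆ (_ : 0 < mmd lam P Q),
    riskDist p H P Q / ENNReal.ofReal (mmd lam P Q)

/-- The bias term
`D(P₀, S_H) = inf_{Q ∈ S_H} (‖P₀ - Q‖_{L(H)} + 2 C_A ‖A(P₀ - Q)‖)`. -/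
def bias {d m : ℕ} (lam : ℝ) (p : ℕ) (ω : Fin m → Space d) (CA : ℝ≥0∞)
    (H : Set (Finset (Space d))) (P₀ : Measure (Space d)) : ℝ≥0∞ :=
  ⨅ Q ∈ model H, riskDist p H P₀ Q + 2 * CA * ‖sketch lam ω P₀ - sketch lam ω Q‖ₑ

/-- `σ_k = (2.4 (log(2k-1) + 10))^{-1/2}`. -/
def sigma (k : ℕ) : ℝ := (√(2.4 * (Real.log (2 * (k : ℝ) - 1) + 10)))⁻¹

/-- `k log(ek) min(log(ek), d) / δ²` times
`k d (1 + log(kd) + log(R/ε) + log(1/δ)) + log(1/ζ)`. -/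
def sketchSize (d k : ℕ) (ε R δ ζ : ℝ) : ℝ :=
  (δ ^ 2)⁻¹ * k * Real.log (k * Real.exp 1) * min (Real.log (k * Real.exp 1)) d *
    (k * d * (1 + Real.log (k * d) + Real.log (R / ε) + Real.log (1 / δ)) + Real.log (1 / ζ))

end CompressiveClustering

end

open MeasureTheory
open scoped ENNReal

noncomputable section

namespace CompressiveClustering

/-! ### Gaussian integrals and the law of the frequencies -/

/-! The weight in the features and the factor `w²` in the frequency law cancel, so the kernel is
exactly the Gaussian `exp(-λ²‖x - y‖²/2)` (`integral_feature_mul_conj`). Everything reduces to the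
geometry of differences of two separated mixtures in this kernel norm.

Dipoles. If the centroids of each of two hypotheses are `2ε`-separated, a centroid of one lies
within `ε` of at most one centroid of the other. Pairing these writes the difference of two mixtures
as a sum of at most `2k` dipoles `a δ_p - b δ_q` with `‖p - q‖ ≤ ε`, whose segments are at distance
at least `ε` (`exists_dipoleFamily`). Since `λε = 1/σ_k` is of order `√(log k)`, distinct dipoles
are nearly orthogonal: their normalized inner products are at most `3 * tailBound (λε)`, and `2k`
times this is at most `1/100`. Hence the squared norm of the sum controls the sum of the squared
norms (`DipoleFamily.sum_sq_le_quad`). A single dipole controls the integral of any bounded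
Lipschitz function (`norm_sub_sq_le_dipole`). Applied to the losses, with Cauchy-Schwarz over `2k`
dipoles, this bounds the compatibility constant by `2√6 √k R^p` (`compat_le`).

Lower isometry. Only the lower inequality `(1 - δ) ‖P - Q‖_κ² ≤ ‖A(P - Q)‖²` is needed, uniformly
over normalized dipole families. For a fixed family the squared feature is nonnegative with mean `1`
and second moment `O(k log(ek))` (`DipoleFamily.integral_norm_feat_pow_four_le`), and the lower tail
of a mean of nonnegative variables needs nothing more (`measure_pi_sum_le`). Uniformity comes from a
net of `2k(3d + 1)` real parameters in which the feature is Lipschitz uniformly in the frequency,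
because the weight dominates the quadratic growth (`DipoleFamily.norm_feat_sub_le`). A union bound
gives `exists_measurableSet_lower_isometry`. The event involves neither the class nor the data.

Decoding. Compatibility and lower isometry bound risk distances on the model by sketch distances.
Combined with the optimality of the fitted mixture and the fact that a mixture has zero risk at its
own centroids, this gives the excess risk bound (`excess_risk_le`). The constant obtained is four
times smaller than `8√6 √k R^p`, which turns the factor `4` of (a) into the factor `1` of (b). -/

lemma nontrivial_space {d : ℕ} (hd : 1 ≤ d) : Nontrivial (Space d) := by
  have : Nonempty (Fin d) := ⟨⟨0, hd⟩⟩
  infer_instance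

lemma integrable_norm_pow_mul_gauss {d : ℕ} (hd : 1 ≤ d) {b : ℝ} (hb : 0 < b) (n : ℕ) :
    Integrable (fun ω : Space d => ‖ω‖ ^ n * Real.exp (-b * ‖ω‖ ^ 2)) := by
  have := nontrivial_space hd
  rw [integrable_fun_norm_addHaar volume (f := fun r => r ^ n * Real.exp (-b * r ^ 2))]
  have h := integrableOn_rpow_mul_exp_neg_mul_sq hb (s := ((d - 1 + n : ℕ) : ℝ))
    (by have : (0 : ℝ) ≤ ((d - 1 + n : ℕ) : ℝ) := Nat.cast_nonneg _
        linarith)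
  refine h.congr_fun (fun x hx => ?_) measurableSet_Ioi
  simp only [smul_eq_mul, finrank_euclideanSpace, Fintype.card_fin]
  rw [Real.rpow_natCast, pow_add, mul_assoc]

lemma integral_norm_pow_mul_gauss {d : ℕ} (hd : 1 ≤ d) {b : ℝ} (hb : 0 < b) (n : ℕ) :
    ∫ ω : Space d, ‖ω‖ ^ n * Real.exp (-b * ‖ω‖ ^ 2) =
      d * (volume.real (Metric.ball (0 : Space d) 1)) *
        (b ^ (-((d : ℝ) + n) / 2) * (1 / 2) * Real.Gamma (((d : ℝ) + n) / 2)) := by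
  have := nontrivial_space hd
  rw [integral_fun_norm_addHaar volume (f := fun r => r ^ n * Real.exp (-b * r ^ 2))]
  have hq : -1 < (((d - 1 + n : ℕ) : ℝ)) := by
    have : (0 : ℝ) ≤ ((d - 1 + n : ℕ) : ℝ) := Nat.cast_nonneg _
    linarith
  have h := integral_rpow_mul_exp_neg_mul_rpow (p := 2) (by norm_num) hq hb
  have e : (((d - 1 + n : ℕ) : ℝ)) + 1 = d + n := by
    rw [Nat.cast_add, Nat.cast_sub hd]; push_cast; ring
  rw [e] at h
  rw [← h]
  simp only [smul_eq_mul, nsmul_eq_mul, finrank_euclideanSpace, Fintype.card_fin]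
  rw [mul_assoc]
  congr 2
  refine setIntegral_congr_fun measurableSet_Ioi (fun x hx => ?_)
  rw [Real.rpow_natCast, pow_add, mul_assoc]
  norm_num

/-- The integral of the unnormalized Gaussian density. -/
def gaussMass (d : ℕ) (lam : ℝ) : ℝ := ∫ ω : Space d, Real.exp (-‖ω‖ ^ 2 / (2 * lam ^ 2))

lemma gauss_exponent {d : ℕ} (lam : ℝ) (ω : Space d) :
    -‖ω‖ ^ 2 / (2 * lam ^ 2) = -(1 / (2 * lam ^ 2)) * ‖ω‖ ^ 2 := by ring

lemma integrable_gauss {d : ℕ} (hd : 1 ≤ d) {lam : ℝ} (hl : 0 < lam) :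
    Integrable (fun ω : Space d => Real.exp (-‖ω‖ ^ 2 / (2 * lam ^ 2))) := by
  have h := integrable_norm_pow_mul_gauss (d := d) hd (b := 1 / (2 * lam ^ 2)) (by positivity) 0
  simpa only [pow_zero, one_mul, gauss_exponent] using h

lemma gaussMass_pos {d : ℕ} (hd : 1 ≤ d) {lam : ℝ} (hl : 0 < lam) : 0 < gaussMass d lam :=
  integral_exp_pos (integrable_gauss hd hl)

/-- In polar coordinates the moments are Gamma values with a common ball volume, so their ratio to
the total mass follows from `Γ(s + 1) = s Γ(s)`. -/
lemma integral_sq_mul_gauss {d : ℕ} (hd : 1 ≤ d) {lam : ℝ} (hl : 0 < lam) :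
    ∫ ω : Space d, ‖ω‖ ^ 2 * Real.exp (-‖ω‖ ^ 2 / (2 * lam ^ 2)) =
      d * lam ^ 2 * gaussMass d lam := by
  have hb : (0 : ℝ) < 1 / (2 * lam ^ 2) := by positivity
  have h0 := integral_norm_pow_mul_gauss (d := d) hd hb 0
  have h2 := integral_norm_pow_mul_gauss (d := d) hd hb 2
  have hd' : (0 : ℝ) < d := by exact_mod_cast hd
  simp only [pow_zero, one_mul, ← gauss_exponent] at h0 h2
  rw [gaussMass, h0, h2]
  have e1 : ((d : ℝ) + (2 : ℕ)) / 2 = d / 2 + 1 := by push_cast; ring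
  have e2 : -((d : ℝ) + (2 : ℕ)) / 2 = -d / 2 + -1 := by push_cast; ring
  rw [e1, e2, Real.Gamma_add_one (by positivity), Real.rpow_add hb, Real.rpow_neg_one]
  simp only [Nat.cast_zero, add_zero]
  field_simp

lemma integral_pow_four_mul_gauss {d : ℕ} (hd : 1 ≤ d) {lam : ℝ} (hl : 0 < lam) :
    ∫ ω : Space d, ‖ω‖ ^ 4 * Real.exp (-‖ω‖ ^ 2 / (2 * lam ^ 2)) =
      d * (d + 2) * lam ^ 4 * gaussMass d lam := by
  have hb : (0 : ℝ) < 1 / (2 * lam ^ 2) := by positivity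
  have h0 := integral_norm_pow_mul_gauss (d := d) hd hb 0
  have h2 := integral_norm_pow_mul_gauss (d := d) hd hb 4
  have hd' : (0 : ℝ) < d := by exact_mod_cast hd
  simp only [pow_zero, one_mul, ← gauss_exponent] at h0 h2
  rw [gaussMass, h0, h2]
  have e1 : ((d : ℝ) + (4 : ℕ)) / 2 = d / 2 + 1 + 1 := by push_cast; ring
  have e2 : -((d : ℝ) + (4 : ℕ)) / 2 = -d / 2 + -1 + -1 := by push_cast; ring
  rw [e1, e2, Real.Gamma_add_one (by positivity), Real.Gamma_add_one (by positivity),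
    Real.rpow_add hb, Real.rpow_add hb, Real.rpow_neg_one]
  simp only [Nat.cast_zero, add_zero]
  field_simp

lemma CΛ_sq (d : ℕ) : CΛ d ^ 2 = 4 + 2 / d := by
  rw [CΛ, Real.sq_sqrt (by positivity)]

lemma CΛ_sq_pos (d : ℕ) : 0 < CΛ d ^ 2 := by rw [CΛ_sq]; positivity

lemma CΛ_nonneg (d : ℕ) : 0 ≤ CΛ d := Real.sqrt_nonneg _

lemma CΛ_sq_le {d : ℕ} (hd : 1 ≤ d) : CΛ d ^ 2 ≤ 6 := by
  rw [CΛ_sq]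
  have hd' : (1 : ℝ) ≤ d := by exact_mod_cast hd
  have : 2 / (d : ℝ) ≤ 2 := div_le_self (by norm_num) hd'
  linarith

lemma one_le_weight {d : ℕ} (lam : ℝ) (ω : Space d) : 1 ≤ weight lam ω := by
  rw [weight]
  have : 0 ≤ ‖ω‖ ^ 2 / (lam ^ 2 * d) := by positivity
  linarith

lemma weight_pos {d : ℕ} (lam : ℝ) (ω : Space d) : 0 < weight lam ω :=
  one_pos.trans_le (one_le_weight lam ω)

@[fun_prop]
lemma continuous_weight {d : ℕ} (lam : ℝ) : Continuous (weight (d := d) lam) := by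
  unfold weight; fun_prop

/-- Expanding `w²` and inserting the Gaussian moments gives `1 + 2 + (d + 2)/d = 4 + 2/d`, which is
where the value of `C_Λ²` comes from. -/
lemma integrable_weight_sq_mul_gauss {d : ℕ} (hd : 1 ≤ d) {lam : ℝ} (hl : 0 < lam) :
    Integrable (fun ω : Space d => weight lam ω ^ 2 * Real.exp (-‖ω‖ ^ 2 / (2 * lam ^ 2))) ∧
    ∫ ω : Space d, weight lam ω ^ 2 * Real.exp (-‖ω‖ ^ 2 / (2 * lam ^ 2)) =
      CΛ d ^ 2 * gaussMass d lam := by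
  have hb : (0 : ℝ) < 1 / (2 * lam ^ 2) := by positivity
  have hd' : (0 : ℝ) < d := by exact_mod_cast hd
  have i0 := integrable_gauss hd hl
  have i2 := integrable_norm_pow_mul_gauss (d := d) hd hb 2
  have i4 := integrable_norm_pow_mul_gauss (d := d) hd hb 4
  simp only [← gauss_exponent] at i2 i4
  have e : (fun ω : Space d => weight lam ω ^ 2 * Real.exp (-‖ω‖ ^ 2 / (2 * lam ^ 2))) =
      fun ω => Real.exp (-‖ω‖ ^ 2 / (2 * lam ^ 2)) +
        2 / (lam ^ 2 * d) * (‖ω‖ ^ 2 * Real.exp (-‖ω‖ ^ 2 / (2 * lam ^ 2))) +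
        1 / (lam ^ 2 * d) ^ 2 * (‖ω‖ ^ 4 * Real.exp (-‖ω‖ ^ 2 / (2 * lam ^ 2))) := by
    ext ω
    rw [weight]; ring
  rw [e]
  refine ⟨(i0.add (i2.const_mul _)).add (i4.const_mul _), ?_⟩
  have i02 : Integrable fun ω : Space d => Real.exp (-‖ω‖ ^ 2 / (2 * lam ^ 2)) +
      2 / (lam ^ 2 * d) * (‖ω‖ ^ 2 * Real.exp (-‖ω‖ ^ 2 / (2 * lam ^ 2))) :=
    i0.add (i2.const_mul _)
  rw [integral_add i02 (i4.const_mul _), integral_add i0 (i2.const_mul _),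
    integral_const_mul, integral_const_mul, integral_sq_mul_gauss hd hl,
    integral_pow_four_mul_gauss hd hl, CΛ_sq, ← gaussMass]
  field_simp
  ring

lemma lintegral_freqDensity {d : ℕ} (hd : 1 ≤ d) {lam : ℝ} (hl : 0 < lam) :
    ∫⁻ ω : Space d, freqDensity lam ω = ENNReal.ofReal (CΛ d ^ 2 * gaussMass d lam) := by
  obtain ⟨h1, h2⟩ := integrable_weight_sq_mul_gauss hd hl
  rw [← h2, ofReal_integral_eq_lintegral_ofReal h1 (ae_of_all _ fun ω => by positivity)]
  rfl

lemma measurable_freqDensity {d : ℕ} (lam : ℝ) : Measurable (freqDensity (d := d) lam) := by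
  unfold freqDensity
  exact (Continuous.measurable (by fun_prop)).ennreal_ofReal

lemma freqDensity_toReal {d : ℕ} (lam : ℝ) (ω : Space d) :
    (freqDensity lam ω).toReal = weight lam ω ^ 2 * Real.exp (-‖ω‖ ^ 2 / (2 * lam ^ 2)) := by
  rw [freqDensity, ENNReal.toReal_ofReal (by positivity)]

lemma isProbabilityMeasure_freqLaw {d : ℕ} (hd : 1 ≤ d) {lam : ℝ} (hl : 0 < lam) :
    IsProbabilityMeasure (freqLaw d lam) := by
  constructor
  rw [freqLaw, Measure.smul_apply, withDensity_apply _ MeasurableSet.univ, Measure.restrict_univ,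
    lintegral_freqDensity hd hl, smul_eq_mul]
  have := mul_pos (CΛ_sq_pos d) (gaussMass_pos hd hl)
  exact ENNReal.inv_mul_cancel (by simpa using this) ENNReal.ofReal_ne_top

lemma integral_freqLaw {d : ℕ} (hd : 1 ≤ d) {lam : ℝ} (hl : 0 < lam) {E : Type*}
    [NormedAddCommGroup E] [NormedSpace ℝ E] (f : Space d → E) :
    ∫ ω, f ω ∂(freqLaw d lam) = (CΛ d ^ 2 * gaussMass d lam)⁻¹ •
      ∫ ω : Space d, (weight lam ω ^ 2 * Real.exp (-‖ω‖ ^ 2 / (2 * lam ^ 2))) • f ω := by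
  have h := mul_pos (CΛ_sq_pos d) (gaussMass_pos hd hl)
  rw [freqLaw, integral_smul_measure, lintegral_freqDensity hd hl, ENNReal.toReal_inv,
    ENNReal.toReal_ofReal h.le, integral_withDensity_eq_integral_toReal_smul
    (measurable_freqDensity lam) (ae_of_all _ fun ω => ENNReal.ofReal_lt_top)]
  simp only [freqDensity_toReal]

/-- Integrating against the Gaussian law is integrating `C_Λ² f / w²` against the law of the
frequencies. -/
lemma integral_freqLaw_div_weight_sq {d : ℕ} (hd : 1 ≤ d) {lam : ℝ} (hl : 0 < lam) {E : Type*}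
    [NormedAddCommGroup E] [NormedSpace ℝ E] (f : Space d → E) :
    ∫ ω, (CΛ d ^ 2 / weight lam ω ^ 2) • f ω ∂(freqLaw d lam) = (gaussMass d lam)⁻¹ •
      ∫ ω : Space d, Real.exp (-‖ω‖ ^ 2 / (2 * lam ^ 2)) • f ω := by
  have h1 : CΛ d ≠ 0 := fun h => (CΛ_sq_pos d).ne' (by rw [h]; simp)
  have h2 := (gaussMass_pos hd hl).ne'
  rw [integral_freqLaw hd hl]
  have : ∀ ω : Space d, (weight lam ω ^ 2 * Real.exp (-‖ω‖ ^ 2 / (2 * lam ^ 2))) •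
      (CΛ d ^ 2 / weight lam ω ^ 2) • f ω =
      (CΛ d ^ 2) • Real.exp (-‖ω‖ ^ 2 / (2 * lam ^ 2)) • f ω := by
    intro ω
    have := (weight_pos lam ω).ne'
    rw [smul_smul, smul_smul]
    congr 1
    field_simp
  simp only [this]
  rw [integral_smul, smul_smul]
  congr 1
  field_simp

/-- The Gaussian kernel. -/
def gaussKernel {d : ℕ} (lam : ℝ) (x y : Space d) : ℝ := Real.exp (-(lam ^ 2 * ‖x - y‖ ^ 2) / 2)

/-- The complex parameter `c` serves two purposes: `c = i` gives the kernel, and real `c` gives the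
exponential moments used for the tails. -/
lemma integral_cexp_mul_gauss {d : ℕ} (hd : 1 ≤ d) {lam : ℝ} (hl : 0 < lam) (c : ℂ)
    (u : Space d) :
    Integrable (fun ω : Space d => Real.exp (-‖ω‖ ^ 2 / (2 * lam ^ 2)) •
      Complex.exp (c * (inner ℝ ω u : ℝ))) ∧
    (gaussMass d lam)⁻¹ • ∫ ω : Space d, Real.exp (-‖ω‖ ^ 2 / (2 * lam ^ 2)) •
      Complex.exp (c * (inner ℝ ω u : ℝ)) = Complex.exp (c ^ 2 * lam ^ 2 * ‖u‖ ^ 2 / 2) := by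
  have hb : 0 < ((1 / (2 * lam ^ 2) : ℝ) : ℂ).re := by
    rw [Complex.ofReal_re]; positivity
  have e : ∀ ω : Space d, Real.exp (-‖ω‖ ^ 2 / (2 * lam ^ 2)) •
      Complex.exp (c * (inner ℝ ω u : ℝ)) =
      Complex.exp (-((1 / (2 * lam ^ 2) : ℝ) : ℂ) * ‖ω‖ ^ 2 + c * (inner ℝ u ω : ℝ)) := by
    intro ω
    rw [Complex.real_smul, Complex.exp_add, real_inner_comm, gauss_exponent]
    push_cast
    rfl
  simp only [e]
  refine ⟨GaussianFourier.integrable_cexp_neg_mul_sq_norm_add hb c u, ?_⟩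
  have hm : ((gaussMass d lam : ℝ) : ℂ) = ∫ v : Space d,
      Complex.exp (-((1 / (2 * lam ^ 2) : ℝ) : ℂ) * ‖v‖ ^ 2) := by
    rw [gaussMass, ← integral_complex_ofReal]
    congr 1
    ext ω
    rw [gauss_exponent]
    push_cast
    rfl
  rw [GaussianFourier.integral_cexp_neg_mul_sq_norm_add hb,
    ← GaussianFourier.integral_cexp_neg_mul_sq_norm hb, ← hm, Complex.real_smul, ← mul_assoc,
    Complex.ofReal_inv, inv_mul_cancel₀, one_mul]
  · congr 1
    have : (lam : ℂ) ≠ 0 := by exact_mod_cast hl.ne'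
    push_cast
    field_simp
    ring
  · exact_mod_cast (gaussMass_pos hd hl).ne'

lemma norm_feature {d : ℕ} (lam : ℝ) (ω x : Space d) :
    ‖feature lam ω x‖ = CΛ d / weight lam ω := by
  rw [feature, norm_div, norm_mul, mul_comm Complex.I, Complex.norm_exp_ofReal_mul_I,
    Complex.norm_real, Complex.norm_real, mul_one, Real.norm_of_nonneg (CΛ_nonneg d),
    Real.norm_of_nonneg (weight_pos lam ω).le]

lemma norm_feature_le {d : ℕ} (lam : ℝ) (ω x : Space d) : ‖feature lam ω x‖ ≤ CΛ d := by
  rw [norm_feature]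
  exact div_le_self (CΛ_nonneg d) (one_le_weight lam ω)

@[fun_prop]
lemma continuous_feature_left {d : ℕ} (lam : ℝ) (x : Space d) :
    Continuous (fun ω => feature lam ω x) := by
  unfold feature
  refine Continuous.div (by fun_prop) (by fun_prop) fun ω => ?_
  exact_mod_cast (weight_pos lam ω).ne'

/-- The product of two features carries `C_Λ²/w²`, which undoes the tilt of the frequency law. What
remains is the characteristic function of `N(0, λ² I)` at `x - y`. -/
lemma integral_feature_mul_conj {d : ℕ} (hd : 1 ≤ d) {lam : ℝ} (hl : 0 < lam) (x y : Space d) :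
    ∫ ω, feature lam ω x * (starRingEnd ℂ) (feature lam ω y) ∂(freqLaw d lam) =
      (gaussKernel lam x y : ℂ) := by
  have e : ∀ ω : Space d, feature lam ω x * (starRingEnd ℂ) (feature lam ω y) =
      (CΛ d ^ 2 / weight lam ω ^ 2) • Complex.exp (Complex.I * (inner ℝ ω (x - y) : ℝ)) := by
    intro ω
    rw [feature, feature, map_div₀, map_mul, ← Complex.exp_conj, map_mul, Complex.conj_ofReal,
      Complex.conj_ofReal, Complex.conj_ofReal, Complex.conj_I, Complex.real_smul, inner_sub_right]
    have : Complex.exp (Complex.I * ((inner ℝ ω x - inner ℝ ω y : ℝ) : ℂ)) =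
      Complex.exp (Complex.I * (inner ℝ ω x : ℝ)) *
        Complex.exp (-Complex.I * (inner ℝ ω y : ℝ)) := by
      rw [← Complex.exp_add]; push_cast; ring_nf
    rw [this]
    push_cast
    ring
  simp only [e]
  rw [integral_freqLaw_div_weight_sq hd hl, (integral_cexp_mul_gauss hd hl _ _).2, gaussKernel]
  rw [Complex.I_sq]
  push_cast
  ring_nf

lemma kernel_eq_gaussKernel {d : ℕ} (hd : 1 ≤ d) {lam : ℝ} (hl : 0 < lam) (x y : Space d) :
    kernel lam x y = gaussKernel lam x y := by
  rw [kernel, integral_feature_mul_conj hd hl, Complex.ofReal_re]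

/-! ### Dipoles and the Gaussian kernel -/

/-- Meant for `x = |a - b|` and `y = |a + b|`: the last factor is then `a² + b² - 2abK`, the energy
of a dipole diagonalized into its total mass and its antisymmetric part. -/
lemma sq_add_mul_le {α β L K x y : ℝ} (hK0 : 0 ≤ K) (hK1 : K ≤ 1)
    (hβ : 2 * β ^ 2 * K ≤ L ^ 2 * (1 - K)) :
    (x * α + y * β) ^ 2 ≤
      (2 * α ^ 2 + 2 * β ^ 2 + L ^ 2) * (x ^ 2 * (1 + K) / 2 + y ^ 2 * (1 - K) / 2) := by
  have h2 : 2 * β ^ 2 ≤ (2 * β ^ 2 + L ^ 2) * (1 - K) := by linarith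
  have hcross : 2 * (x * α * (y * β)) ≤
      α ^ 2 * y ^ 2 * (1 - K) + (2 * β ^ 2 + L ^ 2) * x ^ 2 / 2 := by
    -- For `K < 1` the cross term is handled by a square after multiplication by `1 - K`; for `K =
    -- 1` the hypothesis forces `β = 0`.
    rcases hK1.lt_or_eq with h | h
    · have hD : 0 < 1 - K := by linarith
      have h3 : β ^ 2 * x ^ 2 ≤ (2 * β ^ 2 + L ^ 2) * (1 - K) * x ^ 2 / 2 := by
        nlinarith [sq_nonneg x]
      have h4 : 0 ≤ (α * y * (1 - K) - β * x) ^ 2 := sq_nonneg _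
      have h5 : (1 - K) * (2 * (x * α * (y * β))) ≤
          (1 - K) * (α ^ 2 * y ^ 2 * (1 - K) + (2 * β ^ 2 + L ^ 2) * x ^ 2 / 2) := by
        nlinarith
      exact le_of_mul_le_mul_left h5 hD
    · have hb : β = 0 := by
        rw [h] at h2
        have : β ^ 2 ≤ 0 := by linarith
        exact pow_eq_zero_iff two_ne_zero |>.1 (le_antisymm this (sq_nonneg _))
      rw [hb, h]
      simp only [mul_zero, sub_self, ne_eq, OfNat.ofNat_ne_zero, not_false_eq_true, zero_pow]
      nlinarith [mul_nonneg (sq_nonneg L) (sq_nonneg x)]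
  have h6 : (2 * β ^ 2 + L ^ 2) * x ^ 2 / 2 ≤ (2 * β ^ 2 + L ^ 2) * x ^ 2 * (1 + K) / 2 := by
    have : 0 ≤ (2 * β ^ 2 + L ^ 2) * x ^ 2 * K := by positivity
    linarith
  have h7 : α ^ 2 * x ^ 2 ≤ α ^ 2 * x ^ 2 * (1 + K) := by
    have : 0 ≤ α ^ 2 * x ^ 2 * K := by positivity
    linarith
  have h8 : y ^ 2 * (2 * β ^ 2) ≤ y ^ 2 * ((2 * β ^ 2 + L ^ 2) * (1 - K)) :=
    mul_le_mul_of_nonneg_left h2 (sq_nonneg y)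
  nlinarith

/-- The squared kernel norm `a² + b² - 2 a b exp(-r²/2)` of the dipole `a δ_p - b δ_q`,
`r = λ ‖p - q‖`, controls the integral against it of a function with values `u`, `v` at `p`, `q`. -/
lemma norm_sub_sq_le_dipole {a b r L : ℝ} {u v : ℂ} (huv : ‖u - v‖ ≤ L * r) :
    ‖(a : ℂ) * u - b * v‖ ^ 2 ≤ (‖u‖ ^ 2 + ‖v‖ ^ 2 + L ^ 2) *
      (a ^ 2 + b ^ 2 - 2 * a * b * Real.exp (-r ^ 2 / 2)) := by
  set K := Real.exp (-r ^ 2 / 2) with hK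
  have hK0 : 0 < K := Real.exp_pos _
  have hK1 : K ≤ 1 := Real.exp_le_one_iff.2 (by nlinarith [sq_nonneg r])
  -- The quantity `1 - K` is at least of the order of the squared distance, up to a factor `K`; this
  -- is how the Lipschitz bound on `u - v` is absorbed.
  have hr2 : r ^ 2 / 2 * K ≤ 1 - K := by
    have h1 : 1 + r ^ 2 / 2 ≤ Real.exp (r ^ 2 / 2) := by
      linarith [Real.add_one_le_exp (r ^ 2 / 2)]
    have h2 : Real.exp (r ^ 2 / 2) * K = 1 := by
      rw [hK, ← Real.exp_add]; simp; ring
    nlinarith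
  have e : (a : ℂ) * u - b * v = ((a - b : ℝ) : ℂ) * ((u + v) / 2) +
      ((a + b : ℝ) : ℂ) * ((u - v) / 2) := by push_cast; ring
  have hB : ‖(u - v) / 2‖ = ‖u - v‖ / 2 := by rw [norm_div]; simp
  have hA : ‖(u + v) / 2‖ = ‖u + v‖ / 2 := by rw [norm_div]; simp
  have hpar : ‖u + v‖ ^ 2 + ‖u - v‖ ^ 2 = 2 * (‖u‖ ^ 2 + ‖v‖ ^ 2) := by
    have := parallelogram_law_with_norm ℝ u v
    nlinarith
  have hn : ‖(a : ℂ) * u - b * v‖ ≤ |a - b| * (‖u + v‖ / 2) + |a + b| * (‖u - v‖ / 2) := by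
    rw [e]
    refine (norm_add_le _ _).trans (le_of_eq ?_)
    rw [norm_mul, norm_mul, hA, hB, Complex.norm_real, Complex.norm_real, Real.norm_eq_abs,
      Real.norm_eq_abs]
  have hβ : 2 * (‖u - v‖ / 2) ^ 2 * K ≤ L ^ 2 * (1 - K) := by
    have h3 : ‖u - v‖ ^ 2 ≤ (L * r) ^ 2 := pow_le_pow_left₀ (norm_nonneg _) huv 2
    have h4 : 2 * (‖u - v‖ / 2) ^ 2 * K ≤ (L * r) ^ 2 / 2 * K :=
      mul_le_mul_of_nonneg_right (by linarith) hK0.le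
    have h5 : L ^ 2 * (r ^ 2 / 2 * K) ≤ L ^ 2 * (1 - K) :=
      mul_le_mul_of_nonneg_left hr2 (sq_nonneg L)
    nlinarith
  have key := sq_add_mul_le (α := ‖u + v‖ / 2) (x := |a - b|) (y := |a + b|)
    hK0.le hK1 hβ
  calc ‖(a : ℂ) * u - b * v‖ ^ 2 ≤ _ := pow_le_pow_left₀ (norm_nonneg _) hn 2
    _ ≤ _ := key
    _ = _ := by
      rw [sq_abs, sq_abs]
      have : 2 * (‖u + v‖ / 2) ^ 2 + 2 * (‖u - v‖ / 2) ^ 2 = ‖u‖ ^ 2 + ‖v‖ ^ 2 := by linarith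
      rw [this]
      ring

/-- The squared kernel norm of the dipole `a δ_p - b δ_q`. -/
def dipoleSq {d : ℕ} (lam a b : ℝ) (p q : Space d) : ℝ :=
  a ^ 2 + b ^ 2 - 2 * a * b * gaussKernel lam p q

lemma norm_sub_sq_le_dipoleSq {d : ℕ} {lam a b L : ℝ} {p q : Space d} {u v : ℂ}
    (huv : ‖u - v‖ ≤ L * (lam * ‖p - q‖)) :
    ‖(a : ℂ) * u - b * v‖ ^ 2 ≤ (‖u‖ ^ 2 + ‖v‖ ^ 2 + L ^ 2) * dipoleSq lam a b p q := by
  have := norm_sub_sq_le_dipole (a := a) (b := b) huv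
  rwa [mul_pow] at this

lemma sub_sq_le_dipoleSq {d : ℕ} {lam a b L : ℝ} {p q : Space d} {u v : ℝ}
    (huv : |u - v| ≤ L * (lam * ‖p - q‖)) :
    (a * u - b * v) ^ 2 ≤ (u ^ 2 + v ^ 2 + L ^ 2) * dipoleSq lam a b p q := by
  have := norm_sub_sq_le_dipoleSq (a := a) (b := b) (u := u) (v := v) (p := p) (q := q) (L := L)
    (by rw [← Complex.ofReal_sub, Complex.norm_real]; exact huv)
  rw [← Complex.ofReal_mul, ← Complex.ofReal_mul, ← Complex.ofReal_sub, Complex.norm_real,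
    Complex.norm_real, Complex.norm_real] at this
  simpa only [Real.norm_eq_abs, sq_abs] using this

lemma gaussKernel_self {d : ℕ} (lam : ℝ) (x : Space d) : gaussKernel lam x x = 1 := by
  simp [gaussKernel]

lemma gaussKernel_comm {d : ℕ} (lam : ℝ) (x y : Space d) :
    gaussKernel lam x y = gaussKernel lam y x := by
  rw [gaussKernel, gaussKernel, norm_sub_rev]

lemma gaussKernel_pos {d : ℕ} (lam : ℝ) (x y : Space d) : 0 < gaussKernel lam x y :=
  Real.exp_pos _

lemma gaussKernel_le_one {d : ℕ} (lam : ℝ) (x y : Space d) : gaussKernel lam x y ≤ 1 :=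
  Real.exp_le_one_iff.2 (by have : 0 ≤ lam ^ 2 * ‖x - y‖ ^ 2 := by positivity
                            linarith)

lemma dipoleSq_nonneg {d : ℕ} (lam a b : ℝ) (p q : Space d) : 0 ≤ dipoleSq lam a b p q := by
  have h1 := gaussKernel_pos lam p q
  have h2 := gaussKernel_le_one lam p q
  rw [dipoleSq]
  nlinarith [mul_nonneg h1.le (sq_nonneg (a - b)),
    mul_nonneg (sub_nonneg.2 h2) (add_nonneg (sq_nonneg a) (sq_nonneg b))]

/-! ### Differences of the Gaussian kernel at well separated points -/

/-- Since `T ≥ 1`, `(1 + t²)/(1 + T²) ≤ 1 + (t² - T²)/2 ≤ exp((t² - T²)/2)`. -/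
lemma one_add_sq_mul_exp_le {T t : ℝ} (hT : 1 ≤ T) (ht : T ≤ t) :
    (1 + t ^ 2) * Real.exp (-t ^ 2 / 2) ≤ (1 + T ^ 2) * Real.exp (-T ^ 2 / 2) := by
  have h1 : Real.exp (-T ^ 2 / 2) = Real.exp ((t ^ 2 - T ^ 2) / 2) * Real.exp (-t ^ 2 / 2) := by
    rw [← Real.exp_add]; ring_nf
  rw [h1, ← mul_assoc]
  refine mul_le_mul_of_nonneg_right ?_ (Real.exp_pos _).le
  have h2 := Real.add_one_le_exp ((t ^ 2 - T ^ 2) / 2)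
  have h3 : 1 ≤ T ^ 2 := one_le_pow₀ hT
  have h4 : T ^ 2 ≤ t ^ 2 := pow_le_pow_left₀ (by linarith) ht 2
  nlinarith

/-- The Gaussian profile, `gaussKernel lam x y = gaussProfile lam (x - y)`. -/
def gaussProfile {d : ℕ} (lam : ℝ) (z : Space d) : ℝ := Real.exp (-(lam ^ 2 * ‖z‖ ^ 2) / 2)

/-- A bound on the Gaussian profile and its scaled first and second derivatives at distance at
least `T / λ`. -/
def tailBound (T : ℝ) : ℝ := (1 + T ^ 2) * Real.exp (-T ^ 2 / 2)

lemma tailBound_nonneg (T : ℝ) : 0 ≤ tailBound T := by unfold tailBound; positivity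

lemma one_add_sq_mul_gaussProfile_le {d : ℕ} {lam T : ℝ} {z : Space d} (hT : 1 ≤ T)
    (hz : T ≤ lam * ‖z‖) : (1 + (lam * ‖z‖) ^ 2) * gaussProfile lam z ≤ tailBound T := by
  have := one_add_sq_mul_exp_le hT hz
  rw [tailBound, gaussProfile, ← mul_pow]
  exact this

lemma gaussProfile_pos {d : ℕ} (lam : ℝ) (z : Space d) : 0 < gaussProfile lam z := Real.exp_pos _

lemma gaussProfile_le {d : ℕ} {lam T : ℝ} {z : Space d} (hT : 1 ≤ T)
    (hz : T ≤ lam * ‖z‖) : gaussProfile lam z ≤ tailBound T := by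
  refine le_trans ?_ (one_add_sq_mul_gaussProfile_le hT hz)
  have := mul_nonneg (sq_nonneg (lam * ‖z‖)) (gaussProfile_pos lam z).le
  linarith

lemma hasDerivAt_gaussProfile {d : ℕ} (lam : ℝ) (z v : Space d) (s : ℝ) :
    HasDerivAt (fun s : ℝ => gaussProfile lam (z + s • v))
      (-(lam ^ 2 * inner ℝ (z + s • v) v) * gaussProfile lam (z + s • v)) s := by
  have h1 : HasDerivAt (fun s : ℝ => z + s • v) v s := by
    simpa using ((hasDerivAt_id s).smul_const v).const_add z
  exact ((h1.norm_sq.const_mul (lam ^ 2)).neg.div_const 2).exp.congr_deriv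
    (by simp only [gaussProfile, Pi.neg_apply]; ring)

lemma abs_gaussProfile_sub_le {d : ℕ} {lam T : ℝ} (hl : 0 < lam) (hT : 1 ≤ T) (z v : Space d)
    (h : ∀ s ∈ Set.Icc (0 : ℝ) 1, T ≤ lam * ‖z + s • v‖) :
    |gaussProfile lam (z + v) - gaussProfile lam z| ≤ tailBound T * (lam * ‖v‖) := by
  have := norm_image_sub_le_of_norm_deriv_le_segment_01'
    (f := fun s : ℝ => gaussProfile lam (z + s • v)) (C := tailBound T * (lam * ‖v‖))
    (fun s _ => (hasDerivAt_gaussProfile lam z v s).hasDerivWithinAt) (fun s hs => ?_)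
  · simpa using this
  · have h1 := one_add_sq_mul_gaussProfile_le hT (h s ⟨hs.1, hs.2.le⟩)
    have h2 := gaussProfile_pos lam (z + s • v)
    have h3 := abs_real_inner_le_norm (z + s • v) v
    rw [norm_mul, Real.norm_of_nonneg h2.le, norm_neg, norm_mul, Real.norm_eq_abs, Real.norm_eq_abs,
      abs_of_nonneg (sq_nonneg lam)]
    set t := lam * ‖z + s • v‖ with ht
    have h4 : lam ^ 2 * |inner ℝ (z + s • v) v| ≤ t * (lam * ‖v‖) := by
      rw [ht]
      nlinarith [sq_nonneg lam]
    have h5 : t ≤ 1 + t ^ 2 := by nlinarith [sq_nonneg (t - 1)]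
    have h6 : 0 ≤ lam * ‖v‖ := by positivity
    calc lam ^ 2 * |inner ℝ (z + s • v) v| * gaussProfile lam (z + s • v)
        ≤ (1 + t ^ 2) * (lam * ‖v‖) * gaussProfile lam (z + s • v) := by
          refine mul_le_mul_of_nonneg_right (h4.trans ?_) h2.le
          exact mul_le_mul_of_nonneg_right h5 h6
      _ = (1 + t ^ 2) * gaussProfile lam (z + s • v) * (lam * ‖v‖) := by ring
      _ ≤ _ := by gcongr

/-- The mean value inequality is applied in `s` and then in `t`. The mixed derivative of the profile
at scaled distance `r` is at most `(1 + r²) exp(-r²/2)` times the scaled lengths of `v` and `v'`,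
whence the shape of `tailBound`. -/
lemma abs_gaussProfile_second_diff_le {d : ℕ} {lam T : ℝ} (hl : 0 < lam) (hT : 1 ≤ T)
    (z v v' : Space d)
    (h : ∀ s ∈ Set.Icc (0 : ℝ) 1, ∀ t ∈ Set.Icc (0 : ℝ) 1, T ≤ lam * ‖z + s • v + t • v'‖) :
    |(gaussProfile lam (z + v + v') - gaussProfile lam (z + v)) -
      (gaussProfile lam (z + v') - gaussProfile lam z)| ≤
      tailBound T * (lam * ‖v‖) * (lam * ‖v'‖) := by
  have hder : ∀ s : ℝ, HasDerivAt
      (fun s : ℝ => gaussProfile lam (z + s • v + v') - gaussProfile lam (z + s • v))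
      (-(lam ^ 2 * inner ℝ (z + s • v + v') v) * gaussProfile lam (z + s • v + v') -
        -(lam ^ 2 * inner ℝ (z + s • v) v) * gaussProfile lam (z + s • v)) s := by
    intro s
    have h1 := hasDerivAt_gaussProfile lam (z + v') v s
    have e : ∀ s : ℝ, z + v' + s • v = z + s • v + v' := fun s => by abel
    simp only [e] at h1
    exact h1.sub (hasDerivAt_gaussProfile lam z v s)
  have := norm_image_sub_le_of_norm_deriv_le_segment_01'
    (f := fun s : ℝ => gaussProfile lam (z + s • v + v') - gaussProfile lam (z + s • v))
    (C := tailBound T * (lam * ‖v‖) * (lam * ‖v'‖))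
    (fun s _ => (hder s).hasDerivWithinAt) (fun s hs => ?_)
  · simpa using this
  · have hder2 : ∀ t : ℝ, HasDerivAt
        (fun t : ℝ => -(lam ^ 2 * inner ℝ (z + s • v + t • v') v) *
          gaussProfile lam (z + s • v + t • v'))
        (-(lam ^ 2 * inner ℝ v' v) * gaussProfile lam (z + s • v + t • v') +
          -(lam ^ 2 * inner ℝ (z + s • v + t • v') v) *
            (-(lam ^ 2 * inner ℝ (z + s • v + t • v') v') *
              gaussProfile lam (z + s • v + t • v'))) t := by
      intro t
      have h1 : HasDerivAt (fun t : ℝ => z + s • v + t • v') v' t := by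
        simpa using ((hasDerivAt_id t).smul_const v').const_add (z + s • v)
      have h2 := ((h1.inner ℝ (hasDerivAt_const t v)).const_mul (lam ^ 2)).neg
      exact (h2.mul (hasDerivAt_gaussProfile lam (z + s • v) v' t)).congr_deriv (by simp)
    have := norm_image_sub_le_of_norm_deriv_le_segment_01'
      (f := fun t : ℝ => -(lam ^ 2 * inner ℝ (z + s • v + t • v') v) *
          gaussProfile lam (z + s • v + t • v'))
      (C := tailBound T * (lam * ‖v‖) * (lam * ‖v'‖))
      (fun s _ => (hder2 s).hasDerivWithinAt) (fun t ht => ?_)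
    · simpa using this
    · set y := z + s • v + t • v' with hy
      have h1 := one_add_sq_mul_gaussProfile_le hT (h s ⟨hs.1, hs.2.le⟩ t ⟨ht.1, ht.2.le⟩)
      have h2 := gaussProfile_pos lam y
      have e : -(lam ^ 2 * inner ℝ v' v) * gaussProfile lam y +
          -(lam ^ 2 * inner ℝ y v) * (-(lam ^ 2 * inner ℝ y v') * gaussProfile lam y) =
          (-(lam ^ 2 * inner ℝ v' v) + (lam ^ 2 * inner ℝ y v) * (lam ^ 2 * inner ℝ y v')) *
            gaussProfile lam y := by ring
      rw [e, norm_mul, Real.norm_of_nonneg h2.le]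
      have b1 : ‖-(lam ^ 2 * inner ℝ v' v)‖ ≤ (lam * ‖v‖) * (lam * ‖v'‖) := by
        rw [norm_neg, norm_mul, Real.norm_of_nonneg (sq_nonneg lam), Real.norm_eq_abs]
        have := abs_real_inner_le_norm v' v
        nlinarith [sq_nonneg lam]
      have b2 : ∀ w : Space d, ‖lam ^ 2 * inner ℝ y w‖ ≤ (lam * ‖y‖) * (lam * ‖w‖) := by
        intro w
        rw [norm_mul, Real.norm_of_nonneg (sq_nonneg lam), Real.norm_eq_abs]
        have := abs_real_inner_le_norm y w
        nlinarith [sq_nonneg lam]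
      have b3 : ‖-(lam ^ 2 * inner ℝ v' v) + (lam ^ 2 * inner ℝ y v) * (lam ^ 2 * inner ℝ y v')‖ ≤
          (1 + (lam * ‖y‖) ^ 2) * ((lam * ‖v‖) * (lam * ‖v'‖)) := by
        refine (norm_add_le _ _).trans ?_
        rw [norm_mul]
        have := mul_le_mul (b2 v) (b2 v') (norm_nonneg _) (by positivity)
        linarith
      calc _ ≤ (1 + (lam * ‖y‖) ^ 2) * ((lam * ‖v‖) * (lam * ‖v'‖)) * gaussProfile lam y := by
            gcongr
        _ = (1 + (lam * ‖y‖) ^ 2) * gaussProfile lam y * ((lam * ‖v‖) * (lam * ‖v'‖)) := by ring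
        _ ≤ tailBound T * ((lam * ‖v‖) * (lam * ‖v'‖)) := by gcongr
        _ = _ := by ring

/-! ### Incoherence of separated dipoles -/

/-- The kernel inner product of the dipoles `a δ_p - b δ_q` and `a' δ_p' - b' δ_q'`. -/
def dipoleInner {d : ℕ} (lam a b : ℝ) (p q : Space d) (a' b' : ℝ) (p' q' : Space d) : ℝ :=
  a * (a' * gaussKernel lam p p' - b' * gaussKernel lam p q') -
    b * (a' * gaussKernel lam q p' - b' * gaussKernel lam q q')

lemma dipoleInner_self {d : ℕ} (lam a b : ℝ) (p q : Space d) :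
    dipoleInner lam a b p q a b p q = dipoleSq lam a b p q := by
  rw [dipoleInner, dipoleSq, gaussKernel_self, gaussKernel_self, gaussKernel_comm lam q p]
  ring

/-- The single-dipole inequality is used twice. Integrating the kernel against the second dipole
gives a function whose values at `p`, `q` and whose Lipschitz quotient between them all have square
at most `3M²N'`; integrating this function against the first dipole gives `9M²NN'`. -/
lemma abs_dipoleInner_le {d : ℕ} {lam T : ℝ} (hl : 0 < lam) (hT : 1 ≤ T) (a b a' b' : ℝ)
    (p q p' q' : Space d)
    (h : ∀ s ∈ Set.Icc (0 : ℝ) 1, ∀ t ∈ Set.Icc (0 : ℝ) 1,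
      T ≤ lam * ‖(q + s • (p - q)) - (q' + t • (p' - q'))‖) :
    |dipoleInner lam a b p q a' b' p' q'| ≤
      3 * tailBound T * (√(dipoleSq lam a b p q) * √(dipoleSq lam a' b' p' q')) := by
  have hM := tailBound_nonneg T
  set M := tailBound T
  have i0 : (0 : ℝ) ∈ Set.Icc (0 : ℝ) 1 := ⟨le_rfl, zero_le_one⟩
  have i1 : (1 : ℝ) ∈ Set.Icc (0 : ℝ) 1 := ⟨zero_le_one, le_rfl⟩
  set N := dipoleSq lam a b p q with hN
  set N' := dipoleSq lam a' b' p' q' with hN'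
  have hN0 : 0 ≤ N := dipoleSq_nonneg ..
  have hN0' : 0 ≤ N' := dipoleSq_nonneg ..
  have sq_le : ∀ x : ℝ, |x| ≤ M → x ^ 2 ≤ M ^ 2 := fun x hx => sq_le_sq' (abs_le.1 hx).1 (abs_le.1 hx).2
  have gk : ∀ x y : Space d, T ≤ lam * ‖x - y‖ → |gaussKernel lam x y| ≤ M := fun x y hxy => by
    rw [abs_of_pos (gaussKernel_pos lam x y)]
    exact gaussProfile_le hT hxy
  have bpp : |gaussKernel lam p p'| ≤ M := gk _ _ (by simpa using h 1 i1 1 i1)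
  have bpq : |gaussKernel lam p q'| ≤ M := gk _ _ (by simpa using h 1 i1 0 i0)
  have bqp : |gaussKernel lam q p'| ≤ M := gk _ _ (by simpa using h 0 i0 1 i1)
  have bqq : |gaussKernel lam q q'| ≤ M := gk _ _ (by simpa using h 0 i0 0 i0)
  -- differences in the second argument
  have dsec : ∀ s ∈ Set.Icc (0 : ℝ) 1,
      |gaussKernel lam (q + s • (p - q)) p' - gaussKernel lam (q + s • (p - q)) q'| ≤
        M * (lam * ‖p' - q'‖) := by
    intro s hs
    have := abs_gaussProfile_sub_le hl hT (q + s • (p - q) - q') (-(p' - q')) (fun t ht => by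
      convert h s hs t ht using 3
      module)
    rw [norm_neg] at this
    have e : q + s • (p - q) - q' + -(p' - q') = q + s • (p - q) - p' := by abel
    rwa [e] at this
  have dfst : ∀ t ∈ Set.Icc (0 : ℝ) 1,
      |gaussKernel lam p (q' + t • (p' - q')) - gaussKernel lam q (q' + t • (p' - q'))| ≤
        M * (lam * ‖p - q‖) := by
    intro t ht
    have := abs_gaussProfile_sub_le hl hT (q - (q' + t • (p' - q'))) (p - q) (fun s hs => by
      convert h s hs t ht using 3
      module)
    have e : q - (q' + t • (p' - q')) + (p - q) = p - (q' + t • (p' - q')) := by abel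
    rwa [e] at this
  have dp := dsec 1 i1
  have dq := dsec 0 i0
  have dp' := dfst 1 i1
  have dq' := dfst 0 i0
  simp only [one_smul, zero_smul, add_zero, add_sub_cancel] at dp dq dp' dq'
  have dd : |(gaussKernel lam p p' - gaussKernel lam q p') -
      (gaussKernel lam p q' - gaussKernel lam q q')| ≤
      (M * (lam * ‖p - q‖)) * (lam * ‖p' - q'‖) := by
    have := abs_gaussProfile_second_diff_le hl hT (q - q') (p - q) (-(p' - q')) (fun s hs t ht => by
      convert h s hs t ht using 3
      module)
    rw [norm_neg] at this
    have e1 : q - q' + (p - q) + -(p' - q') = p - p' := by abel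
    have e2 : q - q' + (p - q) = p - q' := by abel
    have e3 : q - q' + -(p' - q') = q - p' := by abel
    rw [e1, e2, e3] at this
    refine le_trans (le_of_eq ?_) this
    simp only [gaussKernel, gaussProfile]
    ring_nf
  -- The first use, against the second dipole: two values at `p` and `q`, and their difference,
  -- whose Lipschitz constant comes from the second difference of the kernel.
  have fp := sub_sq_le_dipoleSq (a := a') (b := b') dp
  have fq := sub_sq_le_dipoleSq (a := a') (b := b') dq
  have fd := sub_sq_le_dipoleSq (a := a') (b := b') dd
  rw [← hN'] at fp fq fd
  have fp' : (a' * gaussKernel lam p p' - b' * gaussKernel lam p q') ^ 2 ≤ 3 * M ^ 2 * N' :=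
    fp.trans (mul_le_mul_of_nonneg_right (by linarith [sq_le _ bpp, sq_le _ bpq]) hN0')
  have fq' : (a' * gaussKernel lam q p' - b' * gaussKernel lam q q') ^ 2 ≤ 3 * M ^ 2 * N' :=
    fq.trans (mul_le_mul_of_nonneg_right (by linarith [sq_le _ bqp, sq_le _ bqq]) hN0')
  have hr : 0 ≤ lam * ‖p - q‖ := by positivity
  have fd' : |(a' * gaussKernel lam p p' - b' * gaussKernel lam p q') -
      (a' * gaussKernel lam q p' - b' * gaussKernel lam q q')| ≤
      √(3 * M ^ 2 * N') * (lam * ‖p - q‖) := by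
    rw [← Real.sqrt_sq hr, ← Real.sqrt_mul (by positivity), ← Real.sqrt_sq_eq_abs]
    apply Real.sqrt_le_sqrt
    have e : a' * gaussKernel lam p p' - b' * gaussKernel lam p q' -
        (a' * gaussKernel lam q p' - b' * gaussKernel lam q q') =
        a' * (gaussKernel lam p p' - gaussKernel lam q p') -
        b' * (gaussKernel lam p q' - gaussKernel lam q q') := by ring
    rw [e]
    refine fd.trans ?_
    rw [mul_right_comm]
    refine mul_le_mul_of_nonneg_right ?_ hN0'
    have s1 : (gaussKernel lam p p' - gaussKernel lam q p') ^ 2 ≤ (M * (lam * ‖p - q‖)) ^ 2 :=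
      sq_le_sq' (abs_le.1 dp').1 (abs_le.1 dp').2
    have s2 : (gaussKernel lam p q' - gaussKernel lam q q') ^ 2 ≤ (M * (lam * ‖p - q‖)) ^ 2 :=
      sq_le_sq' (abs_le.1 dq').1 (abs_le.1 dq').2
    nlinarith
  have final := sub_sq_le_dipoleSq (a := a) (b := b) fd'
  rw [Real.sq_sqrt (by positivity), ← hN] at final
  have hsq : dipoleInner lam a b p q a' b' p' q' ^ 2 ≤ (3 * M * (√N * √N')) ^ 2 := by
    rw [dipoleInner, mul_pow, mul_pow (√N), mul_pow 3 M, Real.sq_sqrt hN0, Real.sq_sqrt hN0']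
    refine final.trans ?_
    have := mul_le_mul_of_nonneg_right (add_le_add (add_le_add fp' fq') (le_refl (3 * M ^ 2 * N')))
      hN0
    linarith
  exact abs_le_of_sq_le_sq hsq (by positivity)

/-- A family of dipoles `a_i δ_{p_i} - b_i δ_{q_i}` supported in the ball of radius `R`, each of
diameter at most `ε`, and such that the segments `[p_i, q_i]` of nonzero dipoles are at distance
at least `ε` from one another. -/
structure DipoleFamily (d : ℕ) (ε R : ℝ) (ι : Type) where
  a : ι → ℝ
  b : ι → ℝ
  p : ι → Space d
  q : ι → Space d
  norm_p_le : ∀ i, ‖p i‖ ≤ R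
  norm_q_le : ∀ i, ‖q i‖ ≤ R
  dist_le : ∀ i, ‖p i - q i‖ ≤ ε
  sep : ∀ i j, i ≠ j → (a i ≠ 0 ∨ b i ≠ 0) → (a j ≠ 0 ∨ b j ≠ 0) →
    ∀ s ∈ Set.Icc (0 : ℝ) 1, ∀ t ∈ Set.Icc (0 : ℝ) 1,
      ε ≤ ‖(q i + s • (p i - q i)) - (q j + t • (p j - q j))‖

namespace DipoleFamily

variable {d : ℕ} {ε R : ℝ} {ι : Type}

/-- The squared kernel norm of one dipole of the family. -/
def sq (D : DipoleFamily d ε R ι) (lam : ℝ) (i : ι) : ℝ :=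
  dipoleSq lam (D.a i) (D.b i) (D.p i) (D.q i)

/-- The kernel inner product of two dipoles of the family. -/
def ip (D : DipoleFamily d ε R ι) (lam : ℝ) (i j : ι) : ℝ :=
  dipoleInner lam (D.a i) (D.b i) (D.p i) (D.q i) (D.a j) (D.b j) (D.p j) (D.q j)

/-- The squared kernel norm of the sum of the dipoles. -/
def quad [Fintype ι] (D : DipoleFamily d ε R ι) (lam : ℝ) : ℝ := ∑ i, ∑ j, D.ip lam i j

lemma sq_nonneg (D : DipoleFamily d ε R ι) (lam : ℝ) (i : ι) : 0 ≤ D.sq lam i :=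
  dipoleSq_nonneg ..

lemma abs_ip_le (D : DipoleFamily d ε R ι) {lam : ℝ} (hl : 0 < lam) (hT : 1 ≤ lam * ε) {i j : ι}
    (hij : i ≠ j) : |D.ip lam i j| ≤
      3 * tailBound (lam * ε) * (√(D.sq lam i) * √(D.sq lam j)) := by
  have hM := tailBound_nonneg (lam * ε)
  by_cases hi : D.a i ≠ 0 ∨ D.b i ≠ 0
  · by_cases hj : D.a j ≠ 0 ∨ D.b j ≠ 0
    · exact abs_dipoleInner_le hl hT _ _ _ _ _ _ _ _ fun s hs t ht =>
        mul_le_mul_of_nonneg_left (D.sep i j hij hi hj s hs t ht) hl.le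
    · push Not at hj
      have : D.ip lam i j = 0 := by simp [ip, dipoleInner, hj]
      rw [this, abs_zero]; positivity
  · push Not at hi
    have : D.ip lam i j = 0 := by simp [ip, dipoleInner, hi]
    rw [this, abs_zero]; positivity

/-- Diagonal dominance: the off-diagonal part is at most `η (∑ √sq)²`, and Cauchy-Schwarz bounds
this by `η` times the number of dipoles times the diagonal. -/
lemma sum_sq_le_quad [Fintype ι] (D : DipoleFamily d ε R ι) {lam : ℝ} (hl : 0 < lam)
    (hT : 1 ≤ lam * ε) (hM : 3 * tailBound (lam * ε) * Fintype.card ι ≤ 1 / 100) :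
    99 / 100 * ∑ i, D.sq lam i ≤ D.quad lam := by
  classical
  have hM0 := tailBound_nonneg (lam * ε)
  set η := 3 * tailBound (lam * ε)
  have hη : 0 ≤ η := by positivity
  -- The error is charged on the diagonal as well, so that the subtracted double sum is a perfect
  -- square.
  have hlow : ∀ i j, (if i = j then D.sq lam i else 0) - η * (√(D.sq lam i) * √(D.sq lam j)) ≤
      D.ip lam i j := by
    intro i j
    by_cases hij : i = j
    · subst hij
      rw [if_pos rfl]
      have : D.ip lam i i = D.sq lam i := dipoleInner_self ..
      rw [this]
      have : 0 ≤ η * (√(D.sq lam i) * √(D.sq lam i)) := by positivity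
      linarith
    · rw [if_neg hij]
      have := (abs_le.1 (D.abs_ip_le hl hT hij)).1
      linarith
  have h1 : ∑ i, ∑ j, ((if i = j then D.sq lam i else 0) - η * (√(D.sq lam i) * √(D.sq lam j))) ≤
      D.quad lam := Finset.sum_le_sum fun i _ => Finset.sum_le_sum fun j _ => hlow i j
  have h2 : ∑ i, ∑ j, ((if i = j then D.sq lam i else 0) - η * (√(D.sq lam i) * √(D.sq lam j))) =
      ∑ i, D.sq lam i - η * (∑ i, √(D.sq lam i)) ^ 2 := by
    simp only [Finset.sum_sub_distrib, Finset.sum_ite_eq, Finset.mem_univ, if_true]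
    rw [pow_two, Finset.sum_mul_sum, Finset.mul_sum]
    simp only [Finset.mul_sum]
  have h3 : (∑ i, √(D.sq lam i)) ^ 2 ≤ Fintype.card ι * ∑ i, D.sq lam i := by
    have := sq_sum_le_card_mul_sum_sq (s := Finset.univ) (f := fun i => √(D.sq lam i))
    simpa only [Real.sq_sqrt (D.sq_nonneg lam _), Finset.card_univ] using this
  have h4 : 0 ≤ ∑ i, D.sq lam i := Finset.sum_nonneg fun i _ => D.sq_nonneg lam i
  have h5 : η * (∑ i, √(D.sq lam i)) ^ 2 ≤ 1 / 100 * ∑ i, D.sq lam i := by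
    calc _ ≤ η * (Fintype.card ι * ∑ i, D.sq lam i) := mul_le_mul_of_nonneg_left h3 hη
      _ = η * Fintype.card ι * ∑ i, D.sq lam i := by ring
      _ ≤ _ := mul_le_mul_of_nonneg_right hM h4
  linarith

lemma sum_sq_le_two_mul_quad [Fintype ι] (D : DipoleFamily d ε R ι) {lam : ℝ} (hl : 0 < lam)
    (hT : 1 ≤ lam * ε) (hM : 3 * tailBound (lam * ε) * Fintype.card ι ≤ 1 / 100) :
    ∑ i, D.sq lam i ≤ 100 / 99 * D.quad lam := by
  linarith [D.sum_sq_le_quad hl hT hM]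

end DipoleFamily

/-! ### The separation scale -/

lemma separation_scale {k : ℕ} (hk : 1 ≤ k) {lam ε : ℝ} (hl : 0 < lam)
    (hε : ε = 1 / (lam * sigma k)) :
    0 < ε ∧ 1 ≤ lam * ε ∧ (lam * ε) ^ 2 = 2.4 * (Real.log (2 * (k : ℝ) - 1) + 10) := by
  have hk' : (1 : ℝ) ≤ k := by exact_mod_cast hk
  have hlog : 0 ≤ Real.log (2 * (k : ℝ) - 1) := Real.log_nonneg (by linarith)
  have hpos : 0 < 2.4 * (Real.log (2 * (k : ℝ) - 1) + 10) := by positivity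
  have hs : 0 < sigma k := by unfold sigma; positivity
  have e : lam * ε = √(2.4 * (Real.log (2 * (k : ℝ) - 1) + 10)) := by
    rw [hε, sigma]
    field_simp
  refine ⟨by rw [hε]; positivity, ?_, ?_⟩
  · rw [e, Real.one_le_sqrt]
    norm_num
    linarith
  · rw [e, Real.sq_sqrt hpos.le]

/-- With `L = log(2k - 1)`, `T²/2 = 12 + L + L/5`. The factor `exp(-L)` pays for the number `2k ≤ 2
exp L` of dipoles, `exp(-L/5)` for the polynomial `1 + T²`, and `exp(-12)` for the constants. -/
lemma tailBound_mul_le {k : ℕ} (hk : 1 ≤ k) {T : ℝ}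
    (hT : T ^ 2 = 2.4 * (Real.log (2 * (k : ℝ) - 1) + 10)) :
    3 * tailBound T * (2 * k : ℕ) ≤ 1 / 100 := by
  have hk' : (1 : ℝ) ≤ k := by exact_mod_cast hk
  set L := Real.log (2 * (k : ℝ) - 1) with hL
  have hL0 : 0 ≤ L := Real.log_nonneg (by linarith)
  have hexp : Real.exp L = 2 * k - 1 := Real.exp_log (by linarith)
  have h12 : Real.exp (-12) ≤ 1 / 20000 := by
    rw [Real.exp_neg, inv_le_comm₀ (Real.exp_pos _) (by norm_num)]
    have h1 := Real.exp_one_gt_d9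
    have h2 : Real.exp 12 = Real.exp 1 ^ 12 := by rw [← Real.exp_nat_mul]; norm_num
    rw [h2]
    have h3 : (2.5 : ℝ) ^ 12 ≤ Real.exp 1 ^ 12 := pow_le_pow_left₀ (by norm_num) (by linarith) 12
    refine le_trans ?_ h3
    norm_num
  have h2k : ((2 * k : ℕ) : ℝ) ≤ 2 * Real.exp L := by
    rw [hexp]; push_cast; linarith
  have hTe : Real.exp (-T ^ 2 / 2) = Real.exp (-12) * Real.exp (-L) * Real.exp (-(L / 5)) := by
    rw [← Real.exp_add, ← Real.exp_add, show -T ^ 2 = -(T ^ 2) by ring, hT]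
    congr 1
    ring
  have h25 : 1 + T ^ 2 ≤ 25 * Real.exp (L / 5) := by
    rw [hT]
    linarith [Real.add_one_le_exp (L / 5)]
  have hc : Real.exp (L / 5) * Real.exp (-(L / 5)) = 1 := by rw [← Real.exp_add]; simp
  have hc' : Real.exp L * Real.exp (-L) = 1 := by rw [← Real.exp_add]; simp
  calc 3 * tailBound T * (2 * k : ℕ)
      ≤ 3 * (25 * Real.exp (L / 5) * (Real.exp (-12) * Real.exp (-L) * Real.exp (-(L / 5)))) *
        (2 * Real.exp L) := by
        rw [tailBound, hTe]
        gcongr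
    _ = 150 * Real.exp (-12) * (Real.exp (L / 5) * Real.exp (-(L / 5))) *
        (Real.exp L * Real.exp (-L)) := by ring
    _ ≤ 1 / 100 := by rw [hc, hc']; linarith

/-! ### Decomposition of a difference of two separated mixtures into dipoles -/

/-- Moving the two points to the `p` ends costs at most `(2 - s - t)ε`, and to the `q` ends at most
`(s + t)ε`; the cheaper move costs at most `ε`. If one segment is a point, the move to the `p` ends
already costs at most `ε`. -/
lemma le_norm_sub_of_segments {d : ℕ} {ε : ℝ} {p q p' q' : Space d} (hpq : ‖p - q‖ ≤ ε)
    (hpq' : ‖p' - q'‖ ≤ ε) (hp : 2 * ε ≤ ‖p - p'‖)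
    (hq : 2 * ε ≤ ‖q - q'‖ ∨ p = q ∨ p' = q') {s t : ℝ} (hs : s ∈ Set.Icc (0 : ℝ) 1)
    (ht : t ∈ Set.Icc (0 : ℝ) 1) :
    ε ≤ ‖(q + s • (p - q)) - (q' + t • (p' - q'))‖ := by
  set z := (q + s • (p - q)) - (q' + t • (p' - q')) with hz
  have n1 : ‖(1 - s) • (p - q)‖ = (1 - s) * ‖p - q‖ := by
    rw [norm_smul, Real.norm_of_nonneg (by linarith [hs.2])]
  have n2 : ‖(1 - t) • (p' - q')‖ = (1 - t) * ‖p' - q'‖ := by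
    rw [norm_smul, Real.norm_of_nonneg (by linarith [ht.2])]
  have n3 : ‖s • (p - q)‖ = s * ‖p - q‖ := by
    rw [norm_smul, Real.norm_of_nonneg hs.1]
  have n4 : ‖t • (p' - q')‖ = t * ‖p' - q'‖ := by
    rw [norm_smul, Real.norm_of_nonneg ht.1]
  have h1 : ‖p - p'‖ ≤ ‖z‖ + (1 - s) * ‖p - q‖ + (1 - t) * ‖p' - q'‖ := by
    have e : p - p' = z + (1 - s) • (p - q) - (1 - t) • (p' - q') := by rw [hz]; module
    rw [e]
    refine (norm_sub_le _ _).trans ?_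
    rw [n2, ← n1]
    gcongr
    exact norm_add_le _ _
  have h2 : ‖q - q'‖ ≤ ‖z‖ + s * ‖p - q‖ + t * ‖p' - q'‖ := by
    have e : q - q' = z - s • (p - q) + t • (p' - q') := by rw [hz]; module
    rw [e]
    refine (norm_add_le _ _).trans ?_
    rw [n4, ← n3]
    gcongr
    exact norm_sub_le _ _
  have m1 := mul_le_mul_of_nonneg_left hpq hs.1
  have m2 := mul_le_mul_of_nonneg_left hpq' ht.1
  have m3 := mul_le_mul_of_nonneg_left hpq (sub_nonneg.2 hs.2)
  have m4 := mul_le_mul_of_nonneg_left hpq' (sub_nonneg.2 ht.2)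
  have m5 : 0 ≤ t * ‖p' - q'‖ := mul_nonneg ht.1 (norm_nonneg _)
  have m6 : 0 ≤ s * ‖p - q‖ := mul_nonneg hs.1 (norm_nonneg _)
  rcases hq with h | h | h
  · linarith
  · have e : ‖p - q‖ = 0 := by rw [h, sub_self, norm_zero]
    rw [e] at h1
    linarith
  · have e : ‖p' - q'‖ = 0 := by rw [h, sub_self, norm_zero]
    rw [e] at h1
    linarith

/-- The relation `‖x i - y j‖ < ε` is a partial matching because both sets are `2ε`-separated. Each
matched pair is one dipole and each unmatched point is a degenerate dipole. The identity holds for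
every `f`, so it applies to losses and to features alike. -/
lemma exists_dipoleFamily_sum {d : ℕ} {ε R : ℝ} (hε : 0 < ε) {A B : Type} [Fintype A] [Fintype B]
    (x : A → Space d) (y : B → Space d) (α : A → ℝ) (β : B → ℝ) (hxR : ∀ i, ‖x i‖ ≤ R)
    (hyR : ∀ i, ‖y i‖ ≤ R) (hx : ∀ i j, i ≠ j → 2 * ε ≤ ‖x i - x j‖)
    (hy : ∀ i j, i ≠ j → 2 * ε ≤ ‖y i - y j‖) :
    ∃ D : DipoleFamily d ε R (A ⊕ B), ∀ f : Space d → ℂ,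
      ∑ i, (α i : ℂ) * f (x i) - ∑ j, (β j : ℂ) * f (y j) =
        ∑ i, ((D.a i : ℂ) * f (D.p i) - (D.b i : ℂ) * f (D.q i)) := by
  classical
  have uy : ∀ i j j', ‖x i - y j‖ < ε → ‖x i - y j'‖ < ε → j = j' := by
    intro i j j' h h'
    by_contra hne
    have h1 := hy j j' hne
    have h2 : ‖y j - y j'‖ ≤ ‖x i - y j'‖ + ‖x i - y j‖ := by
      have : y j - y j' = (x i - y j') - (x i - y j) := by abel
      rw [this]; exact norm_sub_le _ _
    linarith
  have ux : ∀ j i i', ‖x i - y j‖ < ε → ‖x i' - y j‖ < ε → i = i' := by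
    intro j i i' h h'
    by_contra hne
    have h1 := hx i i' hne
    have h2 : ‖x i - x i'‖ ≤ ‖x i - y j‖ + ‖x i' - y j‖ := by
      have : x i - x i' = (x i - y j) - (x i' - y j) := by abel
      rw [this]; exact norm_sub_le _ _
    linarith
  -- An unmatched `x i` is given itself as partner with coefficient `0`. A matched `y j` is already
  -- used by its partner, so its own coefficient is `0`.
  let q₁ : A → Space d := fun i => if h : ∃ j, ‖x i - y j‖ < ε then y h.choose else x i
  let b₁ : A → ℝ := fun i => if h : ∃ j, ‖x i - y j‖ < ε then β h.choose else 0
  let b₂ : B → ℝ := fun j => if ∃ i, ‖x i - y j‖ < ε then 0 else β j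
  have hq₁ : ∀ i j, ‖x i - y j‖ < ε → q₁ i = y j ∧ b₁ i = β j := by
    intro i j hij
    have h : ∃ j, ‖x i - y j‖ < ε := ⟨j, hij⟩
    have e : h.choose = j := uy i _ _ h.choose_spec hij
    constructor
    · change (if h : ∃ j, ‖x i - y j‖ < ε then y h.choose else x i) = _
      rw [dif_pos h, e]
    · change (if h : ∃ j, ‖x i - y j‖ < ε then β h.choose else 0) = _
      rw [dif_pos h, e]
  have hq₁' : ∀ i, (¬ ∃ j, ‖x i - y j‖ < ε) → q₁ i = x i ∧ b₁ i = 0 := fun i h =>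
    ⟨dif_neg h, dif_neg h⟩
  have hdist : ∀ i, ‖x i - q₁ i‖ ≤ ε := by
    intro i
    by_cases h : ∃ j, ‖x i - y j‖ < ε
    · obtain ⟨j, hj⟩ := h
      rw [(hq₁ i j hj).1]; exact hj.le
    · rw [(hq₁' i h).1, sub_self, norm_zero]; exact hε.le
  have hsep₁ : ∀ i i', i ≠ i' → ∀ s ∈ Set.Icc (0 : ℝ) 1, ∀ t ∈ Set.Icc (0 : ℝ) 1,
      ε ≤ ‖(q₁ i + s • (x i - q₁ i)) - (q₁ i' + t • (x i' - q₁ i'))‖ := by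
    intro i i' hne s hs t ht
    refine le_norm_sub_of_segments (hdist i) (hdist i') (hx i i' hne) ?_ hs ht
    by_cases h : ∃ j, ‖x i - y j‖ < ε
    · by_cases h' : ∃ j, ‖x i' - y j‖ < ε
      · obtain ⟨j, hj⟩ := h
        obtain ⟨j', hj'⟩ := h'
        left
        rw [(hq₁ i j hj).1, (hq₁ i' j' hj').1]
        refine hy j j' ?_
        rintro rfl
        exact hne (ux _ _ _ hj hj')
      · exact Or.inr (Or.inr (hq₁' i' h').1.symm)
    · exact Or.inr (Or.inl (hq₁' i h).1.symm)
  have hsep₂ : ∀ i j, b₂ j ≠ 0 → ∀ s ∈ Set.Icc (0 : ℝ) 1,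
      ε ≤ ‖(q₁ i + s • (x i - q₁ i)) - y j‖ := by
    intro i j hj s hs
    have hun : ¬ ∃ i, ‖x i - y j‖ < ε := fun h => hj (if_pos h)
    by_cases h : ∃ j, ‖x i - y j‖ < ε
    · obtain ⟨j', hj'⟩ := h
      have hne : j' ≠ j := by
        rintro rfl
        exact hun ⟨i, hj'⟩
      have := le_norm_sub_of_segments (p := y j') (q := y j') (p' := y j) (q' := y j)
        (by simpa using hε.le) (by simpa using hε.le) (hy j' j hne) (Or.inr (Or.inl rfl)) hs hs
      rw [(hq₁ i j' hj').1]
      have h1 := hy j' j hne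
      have h2 : ‖y j' - y j‖ ≤ ‖y j' + s • (x i - y j') - y j‖ + ‖s • (x i - y j')‖ := by
        have : y j' - y j = (y j' + s • (x i - y j') - y j) - s • (x i - y j') := by abel
        conv_lhs => rw [this]
        exact norm_sub_le _ _
      have h3 : ‖s • (x i - y j')‖ ≤ ε := by
        rw [norm_smul, Real.norm_of_nonneg hs.1]
        nlinarith [hs.2, norm_nonneg (x i - y j')]
      linarith
    · rw [(hq₁' i h).1, sub_self, smul_zero, add_zero]
      exact not_lt.1 fun h' => hun ⟨i, h'⟩
  refine ⟨{ a := Sum.elim α 0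
            b := Sum.elim b₁ b₂
            p := Sum.elim x y
            q := Sum.elim q₁ y
            norm_p_le := ?_
            norm_q_le := ?_
            dist_le := ?_
            sep := ?_ }, ?_⟩
  · rintro (i | j)
    · exact hxR i
    · exact hyR j
  · rintro (i | j)
    · by_cases h : ∃ j, ‖x i - y j‖ < ε
      · obtain ⟨j, hj⟩ := h
        simp only [Sum.elim_inl, (hq₁ i j hj).1, hyR]
      · simp only [Sum.elim_inl, (hq₁' i h).1, hxR]
    · exact hyR j
  · rintro (i | j)
    · exact hdist i
    · simpa using hε.le
  · rintro (i | j) (i' | j') hne hi hj s hs t ht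
    · exact hsep₁ i i' (fun h => hne (by rw [h])) s hs t ht
    · simp only [Sum.elim_inr, Pi.zero_apply, ne_eq, not_true_eq_false, false_or] at hj
      simpa using hsep₂ i j' hj s hs
    · simp only [Sum.elim_inr, Pi.zero_apply, ne_eq, not_true_eq_false, false_or] at hi
      rw [norm_sub_rev]
      simpa using hsep₂ i' j hi t ht
    · have := hy j j' (fun h => hne (by rw [h]))
      simp only [Sum.elim_inr, sub_self, smul_zero, add_zero]
      linarith
  · intro f
    simp only [Fintype.sum_sum_type, Sum.elim_inl, Sum.elim_inr, Pi.zero_apply,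
      Complex.ofReal_zero, zero_mul, Finset.sum_sub_distrib, Finset.sum_const_zero]
    -- Both sides of the regrouping are written as sums over the close pairs, so that exchanging the
    -- order of summation proves the identity.
    have h1 : ∀ i, (b₁ i : ℂ) * f (q₁ i) =
        ∑ j, if ‖x i - y j‖ < ε then (β j : ℂ) * f (y j) else 0 := by
      intro i
      by_cases h : ∃ j, ‖x i - y j‖ < ε
      · obtain ⟨j, hj⟩ := h
        rw [Finset.sum_eq_single j, if_pos hj, (hq₁ i j hj).1, (hq₁ i j hj).2]
        · intro j' _ hne
          exact if_neg fun h => hne (uy _ _ _ h hj)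
        · intro h; exact absurd (Finset.mem_univ _) h
      · rw [(hq₁' i h).2, Complex.ofReal_zero, zero_mul]
        exact (Finset.sum_eq_zero fun j _ => if_neg fun h' => h ⟨j, h'⟩).symm
    have h2 : ∀ j, (β j : ℂ) * f (y j) - (b₂ j : ℂ) * f (y j) =
        ∑ i, if ‖x i - y j‖ < ε then (β j : ℂ) * f (y j) else 0 := by
      intro j
      by_cases h : ∃ i, ‖x i - y j‖ < ε
      · have hb : b₂ j = 0 := if_pos h
        obtain ⟨i, hi⟩ := h
        rw [hb, Finset.sum_eq_single i, if_pos hi, Complex.ofReal_zero, zero_mul, sub_zero]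
        · intro i' _ hne
          exact if_neg fun h => hne (ux _ _ _ h hi)
        · intro h; exact absurd (Finset.mem_univ _) h
      · have hb : b₂ j = β j := if_neg h
        rw [hb, sub_self]
        exact (Finset.sum_eq_zero fun i _ => if_neg fun h' => h ⟨i, h'⟩).symm
    have h3 : ∑ i, (b₁ i : ℂ) * f (q₁ i) =
        ∑ j, (β j : ℂ) * f (y j) - ∑ j, (b₂ j : ℂ) * f (y j) := by
      rw [← Finset.sum_sub_distrib, Finset.sum_congr rfl fun i _ => h1 i,
        Finset.sum_congr rfl fun j _ => h2 j, Finset.sum_comm]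
    rw [h3]
    ring

/-- Extension of a family of dipoles along an embedding of the index set by zero dipoles. -/
def DipoleFamily.extend {d : ℕ} {ε R : ℝ} {ι κ : Type} (D : DipoleFamily d ε R ι) (e : ι ↪ κ)
    (hε : 0 ≤ ε) (hR : 0 ≤ R) : DipoleFamily d ε R κ where
  a := Function.extend e D.a 0
  b := Function.extend e D.b 0
  p := Function.extend e D.p 0
  q := Function.extend e D.q 0
  norm_p_le j := by
    by_cases h : ∃ i, e i = j
    · obtain ⟨i, rfl⟩ := h
      rw [e.injective.extend_apply]; exact D.norm_p_le i
    · rw [Function.extend_apply' _ _ _ h]; simpa using hR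
  norm_q_le j := by
    by_cases h : ∃ i, e i = j
    · obtain ⟨i, rfl⟩ := h
      rw [e.injective.extend_apply]; exact D.norm_q_le i
    · rw [Function.extend_apply' _ _ _ h]; simpa using hR
  dist_le j := by
    by_cases h : ∃ i, e i = j
    · obtain ⟨i, rfl⟩ := h
      rw [e.injective.extend_apply, e.injective.extend_apply]; exact D.dist_le i
    · rw [Function.extend_apply' _ _ _ h, Function.extend_apply' _ _ _ h]; simpa using hε
  sep j j' hne hj hj' s hs t ht := by
    have key : ∀ j, (Function.extend e D.a 0 j ≠ 0 ∨ Function.extend e D.b 0 j ≠ 0) →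
        ∃ i, e i = j := by
      intro j hj
      by_contra h
      rw [Function.extend_apply' _ _ _ h, Function.extend_apply' _ _ _ h] at hj
      simp at hj
    obtain ⟨i, rfl⟩ := key j hj
    obtain ⟨i', rfl⟩ := key j' hj'
    simp only [e.injective.extend_apply] at hj hj' ⊢
    exact D.sep i i' (fun h => hne (by rw [h])) hj hj' s hs t ht

lemma DipoleFamily.sum_extend {d : ℕ} {ε R : ℝ} {ι κ : Type} [Fintype ι] [Fintype κ]
    (D : DipoleFamily d ε R ι) (e : ι ↪ κ) (hε : 0 ≤ ε) (hR : 0 ≤ R) (f : Space d → ℂ) :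
    ∑ j, (((D.extend e hε hR).a j : ℂ) * f ((D.extend e hε hR).p j) -
      ((D.extend e hε hR).b j : ℂ) * f ((D.extend e hε hR).q j)) =
    ∑ i, ((D.a i : ℂ) * f (D.p i) - (D.b i : ℂ) * f (D.q i)) := by
  refine (Finset.sum_of_injOn e e.injective.injOn (fun _ _ => Finset.mem_coe.2 (Finset.mem_univ _))
    (fun j _ hj => ?_) fun i _ => ?_).symm
  · have h : ¬ ∃ i, e i = j := by simpa using hj
    simp only [DipoleFamily.extend, Function.extend_apply' _ _ _ h]
    simp
  · simp only [DipoleFamily.extend, e.injective.extend_apply]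

/-- Padding with zero dipoles gives every difference of two mixtures the same index set `Fin (2 *
k)`, hence a common parameter space for the net. -/
lemma exists_dipoleFamily {d k : ℕ} {ε R : ℝ} (hε : 0 < ε) (hR : 0 ≤ R) {h h' : Finset (Space d)}
    (hh : h ∈ separated d k (2 * ε) R) (hh' : h' ∈ separated d k (2 * ε) R)
    (α : h → ℝ) (α' : h' → ℝ) :
    ∃ D : DipoleFamily d ε R (Fin (2 * k)), ∀ f : Space d → ℂ,
      ∑ c : h, (α c : ℂ) * f c - ∑ c : h', (α' c : ℂ) * f c =
        ∑ i, ((D.a i : ℂ) * f (D.p i) - (D.b i : ℂ) * f (D.q i)) := by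
  obtain ⟨D, hD⟩ := exists_dipoleFamily_sum (R := R) hε (fun c : h => (c : Space d))
    (fun c : h' => (c : Space d)) α α' (fun c => hh.2.2.2 c c.2) (fun c => hh'.2.2.2 c c.2)
    (fun c c' hne => hh.2.2.1 c c.2 c' c'.2 fun e => hne (Subtype.ext e))
    (fun c c' hne => hh'.2.2.1 c c.2 c' c'.2 fun e => hne (Subtype.ext e))
  have hcard : Fintype.card (h ⊕ h') ≤ Fintype.card (Fin (2 * k)) := by
    rw [Fintype.card_sum, Fintype.card_fin, Fintype.card_coe, Fintype.card_coe]
    have := hh.2.1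
    have := hh'.2.1
    omega
  obtain ⟨e⟩ := Function.Embedding.nonempty_of_card_le hcard
  exact ⟨D.extend e hε.le hR, fun f => by rw [hD f, D.sum_extend e hε.le hR f]⟩

/-! ### Integrals against mixtures -/

section Mixture

variable {d : ℕ} {E : Type*} [NormedAddCommGroup E] [NormedSpace ℝ E] [CompleteSpace E]

lemma integral_mixture {h : Finset (Space d)} {α : h → ℝ} (hα : α ∈ stdSimplex ℝ h)
    (f : Space d → E) : ∫ x, f x ∂(mixture h α) = ∑ c : h, α c • f c := by
  rw [mixture, integral_finsetSum_measure fun c _ =>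
    (integrable_dirac (by simp)).smul_measure ENNReal.ofReal_ne_top]
  refine Finset.sum_congr rfl fun c _ => ?_
  rw [integral_smul_measure, integral_dirac, ENNReal.toReal_ofReal (hα.1 c)]

end Mixture

/-! ### The kernel energy as a second moment of the random feature -/

lemma integral_norm_sum_feature_sq {d : ℕ} (hd : 1 ≤ d) {lam : ℝ} (hl : 0 < lam) {ι : Type*}
    [Fintype ι] (c : ι → ℝ) (x : ι → Space d) :
    ∫ ω, ‖∑ i, (c i : ℂ) * feature lam ω (x i)‖ ^ 2 ∂(freqLaw d lam) =
      ∑ i, ∑ j, c i * c j * gaussKernel lam (x i) (x j) := by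
  have := isProbabilityMeasure_freqLaw hd hl
  have e : ∀ ω, ((‖∑ i, (c i : ℂ) * feature lam ω (x i)‖ ^ 2 : ℝ) : ℂ) =
      ∑ i, ∑ j, ((c i * c j : ℝ) : ℂ) *
        (feature lam ω (x i) * (starRingEnd ℂ) (feature lam ω (x j))) := by
    intro ω
    rw [Complex.ofReal_pow, ← Complex.mul_conj', map_sum, Finset.sum_mul_sum]
    refine Finset.sum_congr rfl fun i _ => Finset.sum_congr rfl fun j _ => ?_
    rw [map_mul, Complex.conj_ofReal]
    push_cast
    ring
  have hint : ∀ i j, Integrable (fun ω => ((c i * c j : ℝ) : ℂ) *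
      (feature lam ω (x i) * (starRingEnd ℂ) (feature lam ω (x j)))) (freqLaw d lam) := by
    intro i j
    refine Integrable.const_mul (Integrable.of_bound (C := CΛ d * CΛ d)
      (Continuous.aestronglyMeasurable (by
        exact (continuous_feature_left lam _).mul
          (Complex.continuous_conj.comp (continuous_feature_left lam _))))
      (ae_of_all _ fun ω => ?_)) _
    rw [norm_mul, RCLike.norm_conj]
    exact mul_le_mul (norm_feature_le ..) (norm_feature_le ..) (norm_nonneg _) (CΛ_nonneg d)
  apply Complex.ofReal_injective
  rw [← integral_complex_ofReal]
  simp only [e]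
  rw [integral_finsetSum _ fun i _ => integrable_finsetSum _ fun j _ => hint i j]
  rw [Complex.ofReal_sum]
  refine Finset.sum_congr rfl fun i _ => ?_
  rw [Complex.ofReal_sum, integral_finsetSum _ fun j _ => hint i j]
  refine Finset.sum_congr rfl fun j _ => ?_
  rw [integral_const_mul, integral_feature_mul_conj hd hl]
  push_cast
  rfl

namespace DipoleFamily

variable {d : ℕ} {ε R : ℝ} {ι : Type} [Fintype ι]

/-- The value at the frequency `ω` of the characteristic function (weighted by the feature weight)
of the signed measure `∑ᵢ (a_i δ_{p_i} - b_i δ_{q_i})`. -/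
def feat (D : DipoleFamily d ε R ι) (lam : ℝ) (ω : Space d) : ℂ :=
  ∑ i, ((D.a i : ℂ) * feature lam ω (D.p i) - (D.b i : ℂ) * feature lam ω (D.q i))

@[fun_prop]
lemma continuous_feat (D : DipoleFamily d ε R ι) (lam : ℝ) : Continuous (D.feat lam) := by
  unfold feat; fun_prop

lemma integral_norm_feat_sq (D : DipoleFamily d ε R ι) (hd : 1 ≤ d) {lam : ℝ} (hl : 0 < lam) :
    ∫ ω, ‖D.feat lam ω‖ ^ 2 ∂(freqLaw d lam) = D.quad lam := by
  have h := integral_norm_sum_feature_sq hd hl (Sum.elim D.a (fun i => -D.b i)) (Sum.elim D.p D.q)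
  simp only [Fintype.sum_sum_type, Sum.elim_inl, Sum.elim_inr, Complex.ofReal_neg, neg_mul,
    Finset.sum_neg_distrib, ← sub_eq_add_neg] at h
  simp only [feat, Finset.sum_sub_distrib]
  rw [h]
  simp only [quad, ip, dipoleInner, Finset.sum_add_distrib, Finset.sum_sub_distrib,
    mul_sub, mul_neg, neg_mul, Finset.sum_neg_distrib, ← mul_assoc]
  ring

end DipoleFamily

lemma meanKernel_mixture {d : ℕ} (hd : 1 ≤ d) {lam : ℝ} (hl : 0 < lam) {h h' : Finset (Space d)}
    {α : h → ℝ} {α' : h' → ℝ} (hα : α ∈ stdSimplex ℝ h) (hα' : α' ∈ stdSimplex ℝ h') :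
    meanKernel lam (mixture h α) (mixture h' α') =
      ∑ c : h, ∑ c' : h', α c * α' c' * gaussKernel lam (c : Space d) (c' : Space d) := by
  rw [meanKernel, integral_mixture hα]
  refine Finset.sum_congr rfl fun c _ => ?_
  rw [integral_mixture hα', smul_eq_mul, Finset.mul_sum]
  refine Finset.sum_congr rfl fun c' _ => ?_
  rw [kernel_eq_gaussKernel hd hl, smul_eq_mul, mul_assoc]

lemma mmd_mixture {d : ℕ} (hd : 1 ≤ d) {lam : ℝ} (hl : 0 < lam) {h h' : Finset (Space d)}
    {α : h → ℝ} {α' : h' → ℝ} (hα : α ∈ stdSimplex ℝ h) (hα' : α' ∈ stdSimplex ℝ h') :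
    mmd lam (mixture h α) (mixture h' α') =
      √(∫ ω, ‖∑ c : h, (α c : ℂ) * feature lam ω c - ∑ c : h', (α' c : ℂ) * feature lam ω c‖ ^ 2
        ∂(freqLaw d lam)) := by
  have e := integral_norm_sum_feature_sq hd hl (Sum.elim α (fun i => -α' i))
    (Sum.elim (fun c : h => (c : Space d)) (fun c : h' => (c : Space d)))
  simp only [Fintype.sum_sum_type, Sum.elim_inl, Sum.elim_inr, Complex.ofReal_neg, neg_mul,
    Finset.sum_neg_distrib, ← sub_eq_add_neg] at e
  rw [e, mmd, meanKernel_mixture hd hl hα hα, meanKernel_mixture hd hl hα hα',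
    meanKernel_mixture hd hl hα' hα']
  congr 1
  simp only [Finset.sum_add_distrib, Finset.sum_sub_distrib, Finset.sum_neg_distrib, mul_neg,
    neg_mul]
  have hc : ∑ x : h', ∑ x_1 : h, α' x * α x_1 * gaussKernel lam (x : Space d) x_1 =
      ∑ c : h, ∑ c' : h', α c * α' c' * gaussKernel lam (c : Space d) (c' : Space d) := by
    rw [Finset.sum_comm]
    refine Finset.sum_congr rfl fun c _ => Finset.sum_congr rfl fun c' _ => ?_
    rw [gaussKernel_comm, mul_comm (α' c')]
  rw [hc]
  ring

lemma featureMap_apply {d m : ℕ} (lam : ℝ) (ω : Fin m → Space d) (x : Space d) (j : Fin m) :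
    featureMap lam ω x j = feature lam (ω j) x / (√(m : ℝ) : ℂ) := rfl

lemma sketch_mixture {d m : ℕ} (lam : ℝ) (ω : Fin m → Space d) {h : Finset (Space d)}
    {α : h → ℝ} (hα : α ∈ stdSimplex ℝ h) :
    sketch lam ω (mixture h α) = ∑ c : h, (α c : ℂ) • featureMap lam ω (c : Space d) := by
  rw [sketch, integral_mixture hα]
  refine Finset.sum_congr rfl fun c _ => ?_
  rw [Complex.coe_smul]

/-- The empirical counterpart of `mmd_mixture`: the same function of the frequency, averaged over
the draw instead of integrated. -/
lemma norm_sketch_mixture_sub_sq {d m : ℕ} (lam : ℝ) (ω : Fin m → Space d)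
    {h h' : Finset (Space d)} {α : h → ℝ} {α' : h' → ℝ} (hα : α ∈ stdSimplex ℝ h)
    (hα' : α' ∈ stdSimplex ℝ h') :
    ‖sketch lam ω (mixture h α) - sketch lam ω (mixture h' α')‖ ^ 2 =
      (∑ j, ‖∑ c : h, (α c : ℂ) * feature lam (ω j) c -
        ∑ c : h', (α' c : ℂ) * feature lam (ω j) c‖ ^ 2) / m := by
  rw [sketch_mixture lam ω hα, sketch_mixture lam ω hα', EuclideanSpace.norm_sq_eq,
    Finset.sum_div]
  refine Finset.sum_congr rfl fun j _ => ?_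
  have e : (∑ c : h, (α c : ℂ) • featureMap lam ω (c : Space d) -
      ∑ c : h', (α' c : ℂ) • featureMap lam ω (c : Space d)) j =
      (∑ c : h, (α c : ℂ) * feature lam (ω j) c -
        ∑ c : h', (α' c : ℂ) * feature lam (ω j) c) / (√(m : ℝ) : ℂ) := by
    simp only [PiLp.sub_apply, WithLp.ofLp_sum, Finset.sum_apply, PiLp.smul_apply, smul_eq_mul,
      featureMap_apply]
    rw [sub_div, Finset.sum_div, Finset.sum_div]
    simp only [mul_div_assoc]
  rw [e, norm_div, div_pow, Complex.norm_real, Real.norm_eq_abs, sq_abs,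
    Real.sq_sqrt (Nat.cast_nonneg m)]

/-! ### Losses -/

lemma loss_bounds {d p : ℕ} {x : Space d} {h : Finset (Space d)} (hne : h.Nonempty) {R : ℝ}
    (hh : ∀ c ∈ h, ‖c‖ ≤ R) (hx : ‖x‖ ≤ R) : 0 ≤ loss p x h ∧ loss p x h ≤ (2 * R) ^ p := by
  obtain ⟨c, hc⟩ := hne
  have : Nonempty h := ⟨⟨c, hc⟩⟩
  refine ⟨le_ciInf fun c => by positivity, ?_⟩
  refine (ciInf_le (Set.finite_range _).bddBelow (⟨c, hc⟩ : h)).trans ?_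
  refine pow_le_pow_left₀ (norm_nonneg _) ?_ p
  have := norm_sub_le x c
  have := hh c hc
  simp only
  linarith

lemma loss_nonneg {d : ℕ} (p : ℕ) (x : Space d) (h : Finset (Space d)) : 0 ≤ loss p x h :=
  Real.iInf_nonneg fun c => by positivity

lemma loss_eq_zero {d p : ℕ} (hp : p ≠ 0) {h : Finset (Space d)} {c : Space d} (hc : c ∈ h) :
    loss p c h = 0 := by
  refine le_antisymm ?_ (loss_nonneg ..)
  refine (ciInf_le (Set.finite_range _).bddBelow (⟨c, hc⟩ : h)).trans ?_
  simp [hp]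

/-- The two points are compared at each fixed centroid. For `p = 2` the difference of squares is at
most `‖x - y‖` times a sum of two distances, each at most `2R`; for `p = 1` the constant `4` is
generous. -/
lemma loss_sub_le {d p : ℕ} (hp : p = 1 ∨ p = 2) {x y : Space d} {h : Finset (Space d)}
    (hne : h.Nonempty) {R : ℝ} (hh : ∀ c ∈ h, ‖c‖ ≤ R) (hx : ‖x‖ ≤ R) (hy : ‖y‖ ≤ R) :
    loss p x h - loss p y h ≤ 4 * R ^ (p - 1) * ‖x - y‖ := by
  obtain ⟨c₀, hc₀⟩ := hne
  have : Nonempty h := ⟨⟨c₀, hc₀⟩⟩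
  rw [sub_le_iff_le_add, ← sub_le_iff_le_add']
  refine le_ciInf fun c => ?_
  rw [sub_le_iff_le_add']
  refine (ciInf_le (Set.finite_range _).bddBelow c).trans ?_
  have h1 : ‖x - c‖ ≤ ‖x - y‖ + ‖y - c‖ := by
    have : x - (c : Space d) = (x - y) + (y - c) := by abel
    rw [this]; exact norm_add_le _ _
  have hc := hh c c.2
  have h2 := norm_sub_le x (c : Space d)
  have h3 := norm_sub_le y (c : Space d)
  have h4 := norm_nonneg (x - y)
  have h5 := norm_nonneg (x - (c : Space d))
  have h6 := norm_nonneg (y - (c : Space d))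
  rcases hp with rfl | rfl
  · simp only [pow_one, Nat.sub_self, pow_zero, mul_one]
    linarith
  · simp only [Nat.add_one_sub_one, pow_one]
    nlinarith

lemma abs_loss_sub_le {d p : ℕ} (hp : p = 1 ∨ p = 2) {x y : Space d} {h : Finset (Space d)}
    (hne : h.Nonempty) {R : ℝ} (hh : ∀ c ∈ h, ‖c‖ ≤ R) (hx : ‖x‖ ≤ R) (hy : ‖y‖ ≤ R) :
    |loss p x h - loss p y h| ≤ 4 * R ^ (p - 1) * ‖x - y‖ := by
  rw [abs_le']
  refine ⟨loss_sub_le hp hne hh hx hy, ?_⟩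
  have := loss_sub_le hp hne hh hy hx
  rw [norm_sub_rev] at this
  linarith

/-! ### The compatibility constant -/

/-- Each dipole costs `4 + 4 + 2/3 = 26/3`: two squared values, and a Lipschitz term `16/(λR)²` with
`(λR)² ≥ (λε)² ≥ 24`. Cauchy-Schwarz over `2k` dipoles and the near orthogonality factor `100/99`
leave the total below `24k = (2√6 √k)²`. -/
lemma DipoleFamily.sum_sub_sq_le {d k p : ℕ} (hk : 1 ≤ k) (hp : p = 1 ∨ p = 2)
    {lam ε R : ℝ} (hl : 0 < lam) (hε : ε = 1 / (lam * sigma k)) (hR : ε < R)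
    (D : DipoleFamily d ε R (Fin (2 * k))) {f : Space d → ℝ}
    (hf : ∀ x : Space d, ‖x‖ ≤ R → |f x| ≤ 2 * R ^ p)
    (hf' : ∀ x y : Space d, ‖x‖ ≤ R → ‖y‖ ≤ R → |f x - f y| ≤ 4 * R ^ (p - 1) * ‖x - y‖) :
    (∑ i, (D.a i * f (D.p i) - D.b i * f (D.q i))) ^ 2 ≤ 24 * k * (R ^ p) ^ 2 * D.quad lam := by
  obtain ⟨hε0, hT1, hT2⟩ := separation_scale hk hl hε
  have hk' : (1 : ℝ) ≤ k := by exact_mod_cast hk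
  have hR0 : 0 < R := hε0.trans hR
  have hcard : 3 * tailBound (lam * ε) * Fintype.card (Fin (2 * k)) ≤ 1 / 100 := by
    rw [Fintype.card_fin]; exact tailBound_mul_le hk hT2
  have hq := D.sum_sq_le_two_mul_quad hl hT1 hcard
  have hlog : 0 ≤ Real.log (2 * (k : ℝ) - 1) := Real.log_nonneg (by linarith)
  have hlR : 24 ≤ (lam * R) ^ 2 := by
    have : (lam * ε) ^ 2 ≤ (lam * R) ^ 2 :=
      pow_le_pow_left₀ (by positivity) (mul_le_mul_of_nonneg_left hR.le hl.le) 2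
    linarith
  have hRp : R ^ p = R ^ (p - 1) * R := by
    rw [← pow_succ]; congr 1; rcases hp with rfl | rfl <;> rfl
  have hL : (4 * R ^ (p - 1) / lam) ^ 2 ≤ 2 / 3 * (R ^ p) ^ 2 := by
    have e : 2 / 3 * (R ^ p) ^ 2 = (4 * R ^ (p - 1) / lam) ^ 2 * ((lam * R) ^ 2 / 24) := by
      rw [hRp]; field_simp; ring
    rw [e]
    exact le_mul_of_one_le_right (_root_.sq_nonneg _) (by linarith)
  have hterm : ∀ i, (D.a i * f (D.p i) - D.b i * f (D.q i)) ^ 2 ≤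
      26 / 3 * (R ^ p) ^ 2 * D.sq lam i := by
    intro i
    have h1 := sub_sq_le_dipoleSq (a := D.a i) (b := D.b i) (lam := lam) (p := D.p i) (q := D.q i)
      (u := f (D.p i)) (v := f (D.q i)) (L := 4 * R ^ (p - 1) / lam) (by
        refine (hf' _ _ (D.norm_p_le i) (D.norm_q_le i)).trans (le_of_eq ?_)
        field_simp)
    refine h1.trans (mul_le_mul_of_nonneg_right ?_ (D.sq_nonneg lam i))
    have h2 := abs_le.1 (hf _ (D.norm_p_le i))
    have h3 := abs_le.1 (hf _ (D.norm_q_le i))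
    have h4 := sq_le_sq' h2.1 h2.2
    have h5 := sq_le_sq' h3.1 h3.2
    linarith
  have h1 := sq_sum_le_card_mul_sum_sq (s := Finset.univ)
    (f := fun i => D.a i * f (D.p i) - D.b i * f (D.q i))
  rw [Finset.card_univ, Fintype.card_fin] at h1
  have h2 : ∑ i, (D.a i * f (D.p i) - D.b i * f (D.q i)) ^ 2 ≤
      26 / 3 * (R ^ p) ^ 2 * ∑ i, D.sq lam i := by
    rw [Finset.mul_sum]; exact Finset.sum_le_sum fun i _ => hterm i
  have h3 : 0 ≤ D.quad lam := by
    have := Finset.sum_nonneg fun i (_ : i ∈ Finset.univ) => D.sq_nonneg lam i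
    linarith
  calc _ ≤ ((2 * k : ℕ) : ℝ) * (26 / 3 * (R ^ p) ^ 2 * (100 / 99 * D.quad lam)) := by
        refine h1.trans ?_
        gcongr
        exact h2.trans (by gcongr)
    _ = (5200 / 297) * (k * (R ^ p) ^ 2 * D.quad lam) := by push_cast; ring
    _ ≤ 24 * (k * (R ^ p) ^ 2 * D.quad lam) := by
        gcongr
        norm_num
    _ = _ := by ring

lemma risk_mixture {d p : ℕ} {h₁ h : Finset (Space d)} {α : h₁ → ℝ} (hα : α ∈ stdSimplex ℝ h₁) :
    risk p (mixture h₁ α) h = ∑ c : h₁, α c * loss p (c : Space d) h := by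
  rw [risk, integral_mixture hα]
  simp only [smul_eq_mul]

lemma mmd_mixture_sq {d : ℕ} (hd : 1 ≤ d) {lam : ℝ} (hl : 0 < lam) {ε R : ℝ} {ι : Type}
    [Fintype ι] {h h' : Finset (Space d)} {α : h → ℝ} {α' : h' → ℝ} (hα : α ∈ stdSimplex ℝ h)
    (hα' : α' ∈ stdSimplex ℝ h') {D : DipoleFamily d ε R ι}
    (hD : ∀ f : Space d → ℂ, ∑ c : h, (α c : ℂ) * f c - ∑ c : h', (α' c : ℂ) * f c =
        ∑ i, ((D.a i : ℂ) * f (D.p i) - (D.b i : ℂ) * f (D.q i))) :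
    mmd lam (mixture h α) (mixture h' α') ^ 2 = D.quad lam := by
  rw [mmd_mixture hd hl hα hα', Real.sq_sqrt (integral_nonneg fun ω => by positivity),
    ← D.integral_norm_feat_sq hd hl]
  congr 1
  ext ω
  rw [hD, DipoleFamily.feat]

lemma abs_risk_sub_le {d k p : ℕ} (hd : 1 ≤ d) (hk : 1 ≤ k) (hp : p = 1 ∨ p = 2)
    {lam ε R : ℝ} (hl : 0 < lam) (hε : ε = 1 / (lam * sigma k)) (hR : ε < R)
    {h₁ h₂ h : Finset (Space d)} (hh₁ : h₁ ∈ separated d k (2 * ε) R)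
    (hh₂ : h₂ ∈ separated d k (2 * ε) R) (hh : h ∈ separated d k (2 * ε) R)
    {α₁ : h₁ → ℝ} {α₂ : h₂ → ℝ} (hα₁ : α₁ ∈ stdSimplex ℝ h₁) (hα₂ : α₂ ∈ stdSimplex ℝ h₂) :
    |risk p (mixture h₁ α₁) h - risk p (mixture h₂ α₂) h| ≤
      2 * √6 * √(k : ℝ) * R ^ p * mmd lam (mixture h₁ α₁) (mixture h₂ α₂) := by
  have hε0 := (separation_scale hk hl hε).1
  have hR0 : 0 < R := hε0.trans hR
  obtain ⟨D, hD⟩ := exists_dipoleFamily hε0 hR0.le hh₁ hh₂ α₁ α₂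
  -- Both mixtures have mass one, so subtracting a constant from the loss changes nothing;
  -- subtracting half of the bound on its range halves its supremum norm.
  set f : Space d → ℝ := fun x => loss p x h - (2 * R) ^ p / 2 with hf
  have hpow : (2 * R) ^ p ≤ 4 * R ^ p := by
    rcases hp with rfl | rfl
    · rw [pow_one, pow_one]; linarith
    · exact le_of_eq (by ring)
  have hpow0 : 0 ≤ R ^ p := by positivity
  have key := D.sum_sub_sq_le hk hp hl hε hR (f := f)
    (fun x hx => by
      obtain ⟨h1, h2⟩ := loss_bounds (p := p) hh.1 hh.2.2.2 hx
      rw [hf, abs_le]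
      constructor <;> simp only <;> linarith)
    (fun x y hx hy => by
      have := abs_loss_sub_le hp hh.1 hh.2.2.2 hx hy
      simpa [hf] using this)
  have e : risk p (mixture h₁ α₁) h - risk p (mixture h₂ α₂) h =
      ∑ i, (D.a i * f (D.p i) - D.b i * f (D.q i)) := by
    have h1 := hD (fun x => (f x : ℂ))
    have h2 : ∑ c : h₁, α₁ c * f c - ∑ c : h₂, α₂ c * f c =
      ∑ i, (D.a i * f (D.p i) - D.b i * f (D.q i)) := by exact_mod_cast h1
    rw [← h2, risk_mixture hα₁, risk_mixture hα₂]
    simp only [hf, mul_sub, Finset.sum_sub_distrib, ← Finset.sum_mul]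
    rw [hα₁.2, hα₂.2]
    ring
  have hC : (2 * √6 * √(k : ℝ) * R ^ p * mmd lam (mixture h₁ α₁) (mixture h₂ α₂)) ^ 2 =
      24 * k * (R ^ p) ^ 2 * D.quad lam := by
    rw [← mmd_mixture_sq hd hl hα₁ hα₂ hD, mul_pow, mul_pow, mul_pow, mul_pow,
      Real.sq_sqrt (by norm_num), Real.sq_sqrt (Nat.cast_nonneg k)]
    ring
  have hm : 0 ≤ mmd lam (mixture h₁ α₁) (mixture h₂ α₂) := Real.sqrt_nonneg _
  refine abs_le_of_sq_le_sq ?_ (by positivity)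
  rw [hC, e]
  exact key

lemma riskDist_model_le {d k p : ℕ} (hd : 1 ≤ d) (hk : 1 ≤ k) (hp : p = 1 ∨ p = 2)
    {lam ε R : ℝ} (hl : 0 < lam) (hε : ε = 1 / (lam * sigma k)) (hR : ε < R)
    {H : Set (Finset (Space d))} (hH : H ⊆ separated d k (2 * ε) R) {P Q : Measure (Space d)}
    (hP : P ∈ model H) (hQ : Q ∈ model H) :
    riskDist p H P Q ≤
      ENNReal.ofReal (2 * √6 * √(k : ℝ) * R ^ p) * ENNReal.ofReal (mmd lam P Q) := by
  obtain ⟨h₁, hh₁, α₁, hα₁, rfl⟩ := hP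
  obtain ⟨h₂, hh₂, α₂, hα₂, rfl⟩ := hQ
  have hR0 : 0 < R := (separation_scale hk hl hε).1.trans hR
  rw [← ENNReal.ofReal_mul (by positivity)]
  exact iSup₂_le fun h hh => ENNReal.ofReal_le_ofReal
    (abs_risk_sub_le hd hk hp hl hε hR (hH hh₁) (hH hh₂) (hH hh) hα₁ hα₂)

lemma compat_le {d k p : ℕ} (hd : 1 ≤ d) (hk : 1 ≤ k) (hp : p = 1 ∨ p = 2)
    {lam ε R : ℝ} (hl : 0 < lam) (hε : ε = 1 / (lam * sigma k)) (hR : ε < R)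
    {H : Set (Finset (Space d))} (hH : H ⊆ separated d k (2 * ε) R) :
    compat lam p H ≤ ENNReal.ofReal (2 * √6 * √(k : ℝ) * R ^ p) := by
  refine iSup₂_le fun P hP => iSup₂_le fun Q hQ => iSup_le fun hpos => ?_
  exact ENNReal.div_le_of_le_mul (riskDist_model_le hd hk hp hl hε hR hH hP hQ)

lemma mmd_nonneg {d : ℕ} (lam : ℝ) (P Q : Measure (Space d)) : 0 ≤ mmd lam P Q :=
  Real.sqrt_nonneg _

/-- The supremum defining `compat` omits the pairs at zero kernel distance; for these the explicit
bound shows that the risk distance vanishes too. -/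
lemma riskDist_model_le_compat {d k p : ℕ} (hd : 1 ≤ d) (hk : 1 ≤ k) (hp : p = 1 ∨ p = 2)
    {lam ε R : ℝ} (hl : 0 < lam) (hε : ε = 1 / (lam * sigma k)) (hR : ε < R)
    {H : Set (Finset (Space d))} (hH : H ⊆ separated d k (2 * ε) R) {P Q : Measure (Space d)}
    (hP : P ∈ model H) (hQ : Q ∈ model H) :
    riskDist p H P Q ≤ compat lam p H * ENNReal.ofReal (mmd lam P Q) := by
  rcases (mmd_nonneg lam P Q).lt_or_eq with h | h
  · have : riskDist p H P Q / ENNReal.ofReal (mmd lam P Q) ≤ compat lam p H :=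
      le_iSup₂_of_le P hP (le_iSup₂_of_le Q hQ (le_iSup_of_le h le_rfl))
    exact (ENNReal.div_le_iff (by simpa using h) ENNReal.ofReal_ne_top).1 this
  · refine (riskDist_model_le hd hk hp hl hε hR hH hP hQ).trans ?_
    rw [← h]
    simp

/-! ### The second moment of a normalized squared feature -/

lemma integrable_freqLaw_div_weight_sq {d : ℕ} (hd : 1 ≤ d) {lam : ℝ} (hl : 0 < lam) {E : Type*}
    [NormedAddCommGroup E] [NormedSpace ℝ E] {f : Space d → E}
    (hf : Integrable fun ω : Space d => Real.exp (-‖ω‖ ^ 2 / (2 * lam ^ 2)) • f ω) :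
    Integrable (fun ω => (CΛ d ^ 2 / weight lam ω ^ 2) • f ω) (freqLaw d lam) := by
  have h := mul_pos (CΛ_sq_pos d) (gaussMass_pos hd hl)
  rw [freqLaw, lintegral_freqDensity hd hl]
  refine Integrable.smul_measure ?_ (by simpa using h)
  rw [integrable_withDensity_iff_integrable_smul' (measurable_freqDensity lam)
    (ae_of_all _ fun ω => ENNReal.ofReal_lt_top)]
  refine (hf.smul (CΛ d ^ 2)).congr (ae_of_all _ fun ω => ?_)
  have := (weight_pos lam ω).ne'
  simp only [freqDensity_toReal, Pi.smul_apply]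
  rw [smul_smul, smul_smul]
  congr 1
  field_simp

/-- The factor `C_Λ²/w²` turns the frequency law into the Gaussian one, under which `⟨ω, u⟩/λ` is
centered normal with variance `‖u‖²`. -/
lemma integral_exp_inner_freqLaw {d : ℕ} (hd : 1 ≤ d) {lam : ℝ} (hl : 0 < lam) (c : ℝ)
    (u : Space d) :
    Integrable (fun ω => CΛ d ^ 2 / weight lam ω ^ 2 * Real.exp (c * (inner ℝ ω u / lam)))
      (freqLaw d lam) ∧
    ∫ ω, CΛ d ^ 2 / weight lam ω ^ 2 * Real.exp (c * (inner ℝ ω u / lam)) ∂(freqLaw d lam) =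
      Real.exp (c ^ 2 * ‖u‖ ^ 2 / 2) := by
  obtain ⟨h1, h2⟩ := integral_cexp_mul_gauss hd hl ((c / lam : ℝ) : ℂ) u
  have e : ∀ ω : Space d, Real.exp (-‖ω‖ ^ 2 / (2 * lam ^ 2)) •
      Complex.exp (((c / lam : ℝ) : ℂ) * (inner ℝ ω u : ℝ)) =
      ((Real.exp (-‖ω‖ ^ 2 / (2 * lam ^ 2)) • Real.exp (c * (inner ℝ ω u / lam)) : ℝ) : ℂ) := by
    intro ω
    rw [Complex.real_smul, smul_eq_mul, Complex.ofReal_mul, Complex.ofReal_exp (c * _)]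
    congr 2
    push_cast
    ring
  simp only [e] at h1 h2
  have h1' : Integrable (fun ω : Space d => Real.exp (-‖ω‖ ^ 2 / (2 * lam ^ 2)) •
      Real.exp (c * (inner ℝ ω u / lam))) := by
    exact h1.re.congr (ae_of_all _ fun ω => Complex.ofReal_re _)
  refine ⟨integrable_freqLaw_div_weight_sq hd hl h1', ?_⟩
  have h3 := integral_freqLaw_div_weight_sq hd hl
    (fun ω : Space d => Real.exp (c * (inner ℝ ω u / lam)))
  simp only [smul_eq_mul] at h3 h2
  rw [h3]
  rw [integral_complex_ofReal, Complex.real_smul] at h2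
  apply Complex.ofReal_injective
  rw [Complex.ofReal_mul, h2, Complex.ofReal_exp]
  congr 1
  have : (lam : ℂ) ≠ 0 := by exact_mod_cast hl.ne'
  push_cast
  field_simp

lemma norm_feature_sub_le {d : ℕ} (lam : ℝ) (ω x y : Space d) :
    ‖feature lam ω x - feature lam ω y‖ ≤ CΛ d / weight lam ω * |inner ℝ ω (x - y)| := by
  have e : feature lam ω x - feature lam ω y = ((CΛ d / weight lam ω : ℝ) : ℂ) *
      (Complex.exp (Complex.I * (inner ℝ ω x : ℝ)) -
        Complex.exp (Complex.I * (inner ℝ ω y : ℝ))) := by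
    rw [feature, feature]; push_cast; ring
  have e2 : Complex.exp (Complex.I * (inner ℝ ω x : ℝ)) - Complex.exp (Complex.I * (inner ℝ ω y : ℝ))
      = Complex.exp ((inner ℝ ω y : ℝ) * Complex.I) *
        (Complex.exp (Complex.I * (inner ℝ ω (x - y) : ℝ)) - 1) := by
    rw [mul_sub, mul_one, ← Complex.exp_add, inner_sub_right]
    push_cast
    ring_nf
  rw [e, norm_mul, Complex.norm_real, Real.norm_of_nonneg
    (div_nonneg (CΛ_nonneg d) (weight_pos lam ω).le), e2, norm_mul, Complex.norm_exp_ofReal_mul_I,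
    one_mul]
  exact mul_le_mul_of_nonneg_left (Real.norm_exp_I_mul_ofReal_sub_one_le)
    (div_nonneg (CΛ_nonneg d) (weight_pos lam ω).le)

/-- A smooth bound for the part of `(2 + x²)²` beyond `|x| = s`: there the factor `exp(s(|x| - s))`
is at least `1`, and inserting it gives exponential moments with the prefactor `exp(-s²)`. -/
lemma sq_two_add_sq_le {s x : ℝ} (hs : 0 ≤ s) (hx : 2 + s ^ 2 < 2 + x ^ 2) :
    (2 + x ^ 2) ^ 2 ≤ 56 * Real.exp (-s ^ 2) *
      (Real.exp ((s + 1) * x) + Real.exp (-(s + 1) * x)) := by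
  have hsx : s ≤ |x| := by
    refine le_of_not_gt fun h => ?_
    have := sq_lt_sq' (by linarith [abs_nonneg x]) h
    rw [sq_abs] at this
    linarith
  have h1 : Real.exp (|x| + s * (|x| - s)) ≤ Real.exp (-s ^ 2) *
      (Real.exp ((s + 1) * x) + Real.exp (-(s + 1) * x)) := by
    rw [mul_add, ← Real.exp_add, ← Real.exp_add]
    rcases abs_cases x with ⟨h, -⟩ | ⟨h, -⟩
    · have : |x| + s * (|x| - s) = -s ^ 2 + (s + 1) * x := by rw [h]; ring
      rw [this]; linarith [Real.exp_pos (-s ^ 2 + -(s + 1) * x)]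
    · have : |x| + s * (|x| - s) = -s ^ 2 + -(s + 1) * x := by rw [h]; ring
      rw [this]; linarith [Real.exp_pos (-s ^ 2 + (s + 1) * x)]
  have h2 : Real.exp |x| ≤ Real.exp (|x| + s * (|x| - s)) :=
    Real.exp_le_exp.2 (by nlinarith)
  have h3 : |x| ^ 4 / 24 ≤ Real.exp |x| := by
    have := Real.pow_div_factorial_le_exp |x| (abs_nonneg x) 4
    simpa [Nat.factorial] using this
  have h4 : 1 ≤ Real.exp |x| := Real.one_le_exp (abs_nonneg x)
  have h5 : |x| ^ 4 = (x ^ 2) ^ 2 := by rw [← sq_abs x]; ring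
  -- From `4x² ≤ 4 + x⁴` the left side is at most `8 + 2x⁴`, and `x⁴ ≤ 24 exp|x|`; `8 + 48 = 56`.
  have h6 : (2 + x ^ 2) ^ 2 ≤ 56 * Real.exp |x| := by
    rw [h5] at h3
    nlinarith [sq_nonneg (x ^ 2 - 2)]
  calc _ ≤ _ := h6
    _ ≤ 56 * (Real.exp (-s ^ 2) * (Real.exp ((s + 1) * x) + Real.exp (-(s + 1) * x))) := by
      linarith
    _ = _ := by ring

/-! ### Pointwise and fourth moment bounds for the feature of a dipole family -/

namespace DipoleFamily

variable {d : ℕ} {ε R : ℝ} {ι : Type}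

/-- The unit vector in the direction of the `i`-th dipole, or zero. -/
def dir (D : DipoleFamily d ε R ι) (i : ι) : Space d := ‖D.p i - D.q i‖⁻¹ • (D.p i - D.q i)

lemma norm_dir_le (D : DipoleFamily d ε R ι) (i : ι) : ‖D.dir i‖ ≤ 1 := by
  rw [dir, norm_smul, norm_inv, norm_norm]
  exact inv_mul_le_one

/-- The phase difference between the two poles depends on `ω` only through its component along the
dipole. This keeps the bound independent of the dimension. -/
lemma norm_term_sq_le (D : DipoleFamily d ε R ι) (hd : 1 ≤ d) {lam : ℝ} (hl : 0 < lam) (i : ι)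
    (ω : Space d) :
    ‖(D.a i : ℂ) * feature lam ω (D.p i) - (D.b i : ℂ) * feature lam ω (D.q i)‖ ^ 2 ≤
      6 / weight lam ω ^ 2 * (2 + (inner ℝ ω (D.dir i) / lam) ^ 2) * D.sq lam i := by
  have hw := weight_pos lam ω
  have h := norm_sub_sq_le_dipoleSq (a := D.a i) (b := D.b i) (lam := lam) (p := D.p i)
    (q := D.q i) (u := feature lam ω (D.p i)) (v := feature lam ω (D.q i))
    (L := CΛ d / weight lam ω * |inner ℝ ω (D.dir i) / lam|) (by
      refine (norm_feature_sub_le lam ω _ _).trans (le_of_eq ?_)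
      rw [mul_assoc]
      congr 1
      rw [abs_div, abs_of_pos hl, dir, inner_smul_right, abs_mul, abs_inv, abs_norm]
      by_cases h0 : ‖D.p i - D.q i‖ = 0
      · rw [norm_eq_zero.1 h0]; simp
      · field_simp)
  refine h.trans (mul_le_mul_of_nonneg_right ?_ (D.sq_nonneg lam i))
  rw [norm_feature, norm_feature, mul_pow, sq_abs, div_pow]
  have hC := CΛ_sq_le hd
  calc _ = CΛ d ^ 2 / weight lam ω ^ 2 * (2 + (inner ℝ ω (D.dir i) / lam) ^ 2) := by ring
    _ ≤ _ := by gcongr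

variable [Fintype ι]

lemma norm_feat_sq_le (D : DipoleFamily d ε R ι) (hd : 1 ≤ d) {lam : ℝ} (hl : 0 < lam)
    (hT : 1 ≤ lam * ε) (hM : 3 * tailBound (lam * ε) * Fintype.card ι ≤ 1 / 100) (ω : Space d) :
    ‖D.feat lam ω‖ ^ 2 ≤ 7 * D.quad lam / weight lam ω ^ 2 *
      ∑ i, (2 + (inner ℝ ω (D.dir i) / lam) ^ 2) := by
  have hw := weight_pos lam ω
  set g : ι → ℝ := fun i => 2 + (inner ℝ ω (D.dir i) / lam) ^ 2 with hg
  have hg0 : ∀ i, 0 ≤ g i := fun i => by positivity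
  have h1 : ‖D.feat lam ω‖ ≤ ∑ i, √(6 / weight lam ω ^ 2 * g i) * √(D.sq lam i) := by
    refine (norm_sum_le _ _).trans (Finset.sum_le_sum fun i _ => ?_)
    rw [← Real.sqrt_mul (by have := hg0 i; positivity)]
    exact Real.le_sqrt_of_sq_le (D.norm_term_sq_le hd hl i ω)
  have h2 := Finset.sum_mul_sq_le_sq_mul_sq Finset.univ (fun i => √(6 / weight lam ω ^ 2 * g i))
    (fun i => √(D.sq lam i))
  have e1 : ∀ i, √(6 / weight lam ω ^ 2 * g i) ^ 2 = 6 / weight lam ω ^ 2 * g i := fun i =>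
    Real.sq_sqrt (by have := hg0 i; positivity)
  simp only [Real.sq_sqrt (D.sq_nonneg lam _), e1, ← Finset.mul_sum] at h2
  have hq := D.sum_sq_le_two_mul_quad hl hT hM
  have hs0 : 0 ≤ ∑ i, g i := Finset.sum_nonneg fun i _ => hg0 i
  have hs1 : 0 ≤ ∑ i, D.sq lam i := Finset.sum_nonneg fun i _ => D.sq_nonneg lam i
  calc _ ≤ _ := (pow_le_pow_left₀ (norm_nonneg _) h1 2).trans h2
    _ ≤ 6 / weight lam ω ^ 2 * (∑ i, g i) * (100 / 99 * D.quad lam) := by gcongr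
    _ ≤ 6 / weight lam ω ^ 2 * (∑ i, g i) * (7 / 6 * D.quad lam) := by
      exact mul_le_mul_of_nonneg_left (by linarith) (by positivity)
    _ = _ := by ring

/-- Truncation at level `s`. If every directional component is at most `s`, one factor of the
squared feature is bounded by a constant. Otherwise the largest component exceeds `s` and its
exponential bound is used. The sum over `i` is there because the maximizing index depends on `ω`. -/
lemma norm_feat_pow_four_le (D : DipoleFamily d ε R ι) (hd : 1 ≤ d) {lam : ℝ} (hl : 0 < lam)
    (hT : 1 ≤ lam * ε) (hM : 3 * tailBound (lam * ε) * Fintype.card ι ≤ 1 / 100) {s : ℝ}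
    (hs : 0 ≤ s) (ω : Space d) :
    (‖D.feat lam ω‖ ^ 2) ^ 2 ≤
      7 * D.quad lam * (Fintype.card ι * (2 + s ^ 2)) * ‖D.feat lam ω‖ ^ 2 +
      ∑ i, 49 * D.quad lam ^ 2 * (Fintype.card ι : ℝ) ^ 2 * (56 * Real.exp (-s ^ 2)) *
        (CΛ d ^ 2 / weight lam ω ^ 2 * Real.exp ((s + 1) * (inner ℝ ω (D.dir i) / lam)) +
          CΛ d ^ 2 / weight lam ω ^ 2 * Real.exp (-(s + 1) * (inner ℝ ω (D.dir i) / lam))) := by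
  have hw := weight_pos lam ω
  have hw1 := one_le_weight lam ω
  set w := weight lam ω
  set n : ℝ := ((Fintype.card ι : ℕ) : ℝ)
  have hX := D.norm_feat_sq_le hd hl hT hM ω
  set X := ‖D.feat lam ω‖ ^ 2
  have hX0 : 0 ≤ X := by positivity
  set x : ι → ℝ := fun i => inner ℝ ω (D.dir i) / lam with hx
  have hq : 0 ≤ D.quad lam := by
    have := D.sum_sq_le_two_mul_quad hl hT hM
    have := Finset.sum_nonneg fun i (_ : i ∈ Finset.univ) => D.sq_nonneg lam i
    linarith
  have hn : 0 ≤ n := Nat.cast_nonneg _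
  have hterm : ∀ i, 0 ≤ 49 * D.quad lam ^ 2 * n ^ 2 * (56 * Real.exp (-s ^ 2)) *
        (CΛ d ^ 2 / w ^ 2 * Real.exp ((s + 1) * x i) +
          CΛ d ^ 2 / w ^ 2 * Real.exp (-(s + 1) * x i)) := fun i => by positivity
  have hsum0 : 0 ≤ ∑ i, (2 + x i ^ 2) := Finset.sum_nonneg fun i _ => by positivity
  have hXw : X ≤ 7 * D.quad lam * ∑ i, (2 + x i ^ 2) := by
    refine hX.trans (mul_le_mul_of_nonneg_right (div_le_self (by positivity) ?_) hsum0)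
    exact one_le_pow₀ hw1
  by_cases hall : ∀ i, x i ^ 2 ≤ s ^ 2
  · have h1 : ∑ i, (2 + x i ^ 2) ≤ n * (2 + s ^ 2) := by
      have := Finset.sum_le_card_nsmul Finset.univ (fun i => 2 + x i ^ 2) (2 + s ^ 2)
        (fun i _ => by linarith [hall i])
      rwa [Finset.card_univ, nsmul_eq_mul] at this
    have h2 : X * X ≤ 7 * D.quad lam * (n * (2 + s ^ 2)) * X :=
      mul_le_mul_of_nonneg_right (hXw.trans (by gcongr)) hX0
    have h3 := Finset.sum_nonneg fun i (_ : i ∈ Finset.univ) => hterm i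
    rw [pow_two]
    linarith
  · push Not at hall
    obtain ⟨i₁, hi₁⟩ := hall
    obtain ⟨i₀, -, hi₀⟩ := Finset.exists_max_image Finset.univ (fun i => x i ^ 2)
      ⟨i₁, Finset.mem_univ _⟩
    have hbig : 2 + s ^ 2 < 2 + x i₀ ^ 2 := by linarith [hi₀ i₁ (Finset.mem_univ _)]
    have h1 : ∑ i, (2 + x i ^ 2) ≤ n * (2 + x i₀ ^ 2) := by
      have := Finset.sum_le_card_nsmul Finset.univ (fun i => 2 + x i ^ 2) (2 + x i₀ ^ 2)
        (fun i hi => by linarith [hi₀ i hi])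
      rwa [Finset.card_univ, nsmul_eq_mul] at this
    have h2 := sq_two_add_sq_le hs hbig
    have hC : 1 ≤ CΛ d ^ 2 := by
      rw [CΛ_sq]
      have : 0 ≤ 2 / (d : ℝ) := by positivity
      linarith
    have h3 : X ≤ 7 * D.quad lam / w ^ 2 * (n * (2 + x i₀ ^ 2)) := hX.trans (by gcongr)
    -- One of the two factors `1/w²` is given up; the other is what makes the exponential moments
    -- computable under the frequency law.
    have hw2 : 1 / (w ^ 2) ^ 2 ≤ CΛ d ^ 2 / w ^ 2 := by
      have hw4 : 1 ≤ w ^ 2 := one_le_pow₀ hw1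
      rw [div_le_div_iff₀ (by positivity) (by positivity)]
      nlinarith
    have h4 : X ^ 2 ≤ 49 * D.quad lam ^ 2 * n ^ 2 * (56 * Real.exp (-s ^ 2)) *
        (CΛ d ^ 2 / w ^ 2 * Real.exp ((s + 1) * x i₀) +
          CΛ d ^ 2 / w ^ 2 * Real.exp (-(s + 1) * x i₀)) := by
      calc X ^ 2 ≤ (7 * D.quad lam / w ^ 2 * (n * (2 + x i₀ ^ 2))) ^ 2 :=
            pow_le_pow_left₀ hX0 h3 2
        _ = 49 * D.quad lam ^ 2 * n ^ 2 * (1 / (w ^ 2) ^ 2) * (2 + x i₀ ^ 2) ^ 2 := by ring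
        _ ≤ 49 * D.quad lam ^ 2 * n ^ 2 * (CΛ d ^ 2 / w ^ 2) * (56 * Real.exp (-s ^ 2) *
              (Real.exp ((s + 1) * x i₀) + Real.exp (-(s + 1) * x i₀))) := by gcongr
        _ = _ := by ring
    have h5 := Finset.single_le_sum (fun i _ => hterm i) (Finset.mem_univ i₀)
    have h6 : 0 ≤ 7 * D.quad lam * (n * (2 + s ^ 2)) * X := by positivity
    exact (h4.trans h5).trans (le_add_of_nonneg_left h6)

lemma norm_feat_le (D : DipoleFamily d ε R ι) (lam : ℝ) (ω : Space d) :
    ‖D.feat lam ω‖ ≤ ∑ i, (|D.a i| + |D.b i|) * CΛ d := by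
  refine (norm_sum_le _ _).trans (Finset.sum_le_sum fun i _ => ?_)
  refine (norm_sub_le _ _).trans ?_
  rw [norm_mul, norm_mul, Complex.norm_real, Complex.norm_real, Real.norm_eq_abs, Real.norm_eq_abs,
    add_mul]
  have h1 := norm_feature_le lam ω (D.p i)
  have h2 := norm_feature_le lam ω (D.q i)
  gcongr

lemma integrable_norm_feat_pow (D : DipoleFamily d ε R ι) (hd : 1 ≤ d) {lam : ℝ} (hl : 0 < lam)
    (n : ℕ) : Integrable (fun ω => ‖D.feat lam ω‖ ^ n) (freqLaw d lam) := by
  have := isProbabilityMeasure_freqLaw hd hl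
  refine Integrable.of_bound (C := (∑ i, (|D.a i| + |D.b i|) * CΛ d) ^ n)
    (Continuous.aestronglyMeasurable (by fun_prop)) (ae_of_all _ fun ω => ?_)
  rw [Real.norm_of_nonneg (by positivity)]
  exact pow_le_pow_left₀ (norm_nonneg _) (D.norm_feat_le lam ω) n

end DipoleFamily

lemma one_le_log_mul_exp {k : ℕ} (hk : 1 ≤ k) :
    1 ≤ Real.log (k * Real.exp 1) ∧ Real.log (k * Real.exp 1) = Real.log k + 1 := by
  have hk' : (1 : ℝ) ≤ k := by exact_mod_cast hk
  have e : Real.log (k * Real.exp 1) = Real.log k + 1 := by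
    rw [Real.log_mul (by positivity) (Real.exp_pos 1).ne', Real.log_exp]
  exact ⟨by rw [e]; linarith [Real.log_nonneg hk'], e⟩

/-- The maximum over `2k` directions exceeds `√(12 log(ek))` so rarely that its contribution, of
size `k³` before the exponential gain, is `O(1)`. The truncated part gives `k log(ek)`. The
constants add up to `28 + 168 + 43904 = 44100`. -/
lemma DipoleFamily.integral_norm_feat_pow_four_le {d k : ℕ} (hd : 1 ≤ d) (hk : 1 ≤ k)
    {lam ε R : ℝ} (hl : 0 < lam) (hε : ε = 1 / (lam * sigma k))
    (D : DipoleFamily d ε R (Fin (2 * k))) :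
    ∫ ω, (‖D.feat lam ω‖ ^ 2) ^ 2 ∂(freqLaw d lam) ≤
      44100 * k * Real.log (k * Real.exp 1) * D.quad lam ^ 2 := by
  obtain ⟨hε0, hT1, hT2⟩ := separation_scale hk hl hε
  have hM : 3 * tailBound (lam * ε) * Fintype.card (Fin (2 * k)) ≤ 1 / 100 := by
    rw [Fintype.card_fin]; exact tailBound_mul_le hk hT2
  obtain ⟨hℓ, hℓ'⟩ := one_le_log_mul_exp hk
  set ℓ := Real.log (k * Real.exp 1)
  have hk' : (1 : ℝ) ≤ k := by exact_mod_cast hk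
  set s := √(12 * ℓ) with hs
  have hs0 : 0 ≤ s := Real.sqrt_nonneg _
  have hs2 : s ^ 2 = 12 * ℓ := Real.sq_sqrt (by linarith)
  set Q := D.quad lam
  set c := 49 * Q ^ 2 * ((Fintype.card (Fin (2 * k)) : ℕ) : ℝ) ^ 2 * (56 * Real.exp (-s ^ 2))
    with hc
  have hexpint := fun i : Fin (2 * k) => integral_exp_inner_freqLaw hd hl (s + 1) (D.dir i)
  have hexpint' := fun i : Fin (2 * k) => integral_exp_inner_freqLaw hd hl (-(s + 1)) (D.dir i)
  have hi1 : Integrable (fun ω => 7 * Q * (((Fintype.card (Fin (2 * k)) : ℕ) : ℝ) * (2 + s ^ 2)) *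
      ‖D.feat lam ω‖ ^ 2) (freqLaw d lam) := (D.integrable_norm_feat_pow hd hl 2).const_mul _
  have hi2 : ∀ i ∈ (Finset.univ : Finset (Fin (2 * k))), Integrable (fun ω => c *
        (CΛ d ^ 2 / weight lam ω ^ 2 * Real.exp ((s + 1) * (inner ℝ ω (D.dir i) / lam)) +
          CΛ d ^ 2 / weight lam ω ^ 2 * Real.exp (-(s + 1) * (inner ℝ ω (D.dir i) / lam))))
      (freqLaw d lam) := fun i _ => ((hexpint i).1.add (hexpint' i).1).const_mul c
  have h1 : ∫ ω, (‖D.feat lam ω‖ ^ 2) ^ 2 ∂(freqLaw d lam) ≤ _ :=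
    integral_mono_of_nonneg (ae_of_all _ fun ω => by positivity)
      (hi1.add (integrable_finsetSum _ hi2))
      (ae_of_all _ fun ω => D.norm_feat_pow_four_le hd hl hT1 hM hs0 ω)
  refine h1.trans ?_
  simp only [Pi.add_apply]
  rw [integral_add hi1 (integrable_finsetSum _ hi2), integral_const_mul,
    D.integral_norm_feat_sq hd hl, integral_finsetSum _ hi2]
  have hterm : ∀ i : Fin (2 * k), ∫ ω, c *
        (CΛ d ^ 2 / weight lam ω ^ 2 * Real.exp ((s + 1) * (inner ℝ ω (D.dir i) / lam)) +
          CΛ d ^ 2 / weight lam ω ^ 2 * Real.exp (-(s + 1) * (inner ℝ ω (D.dir i) / lam)))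
      ∂(freqLaw d lam) ≤ c * (2 * Real.exp ((s + 1) ^ 2 / 2)) := by
    intro i
    rw [integral_const_mul, integral_add (hexpint i).1 (hexpint' i).1, (hexpint i).2,
      (hexpint' i).2, neg_sq]
    have hdir : ‖D.dir i‖ ^ 2 ≤ 1 := pow_le_one₀ (norm_nonneg _) (D.norm_dir_le i)
    have h2 : Real.exp ((s + 1) ^ 2 * ‖D.dir i‖ ^ 2 / 2) ≤ Real.exp ((s + 1) ^ 2 / 2) :=
      Real.exp_le_exp.2 (by nlinarith [_root_.sq_nonneg (s + 1)])
    have hc0 : 0 ≤ c := by positivity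
    exact mul_le_mul_of_nonneg_left (by linarith) hc0
  have hsum := Finset.sum_le_card_nsmul Finset.univ _ _ fun i _ => hterm i
  rw [Finset.card_univ, Fintype.card_fin, nsmul_eq_mul] at hsum
  -- The exponent is `-s²/2 + s + 1/2 ≤ -s²/4 + 3/2`, and `s² = 12 (log k + 1)`.
  have hexp : Real.exp (-s ^ 2) * Real.exp ((s + 1) ^ 2 / 2) ≤ ((k : ℝ) ^ 3)⁻¹ := by
    rw [← Real.exp_add]
    have hk3 : ((k : ℝ) ^ 3)⁻¹ = Real.exp (-3 * Real.log k) := by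
      rw [neg_mul, Real.exp_neg, show (3 : ℝ) = (3 : ℕ) by norm_num, Real.exp_nat_mul,
        Real.exp_log (by linarith)]
    rw [hk3]
    apply Real.exp_le_exp.2
    nlinarith [_root_.sq_nonneg (s - 2)]
  have hfin : ((2 * k : ℕ) : ℝ) * (c * (2 * Real.exp ((s + 1) ^ 2 / 2))) ≤ 43904 * Q ^ 2 := by
    have e : ((2 * k : ℕ) : ℝ) * (c * (2 * Real.exp ((s + 1) ^ 2 / 2))) =
        43904 * Q ^ 2 * ((k : ℝ) ^ 3 * (Real.exp (-s ^ 2) * Real.exp ((s + 1) ^ 2 / 2))) := by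
      rw [hc, Fintype.card_fin]; push_cast; ring
    rw [e]
    have : (k : ℝ) ^ 3 * (Real.exp (-s ^ 2) * Real.exp ((s + 1) ^ 2 / 2)) ≤ 1 := by
      calc _ ≤ (k : ℝ) ^ 3 * ((k : ℝ) ^ 3)⁻¹ := by gcongr
        _ = 1 := mul_inv_cancel₀ (by positivity)
    nlinarith [_root_.sq_nonneg Q]
  have hkl : 1 ≤ k * ℓ := by nlinarith
  have hkl' : (k : ℝ) ≤ k * ℓ := by nlinarith
  calc _ ≤ 7 * Q * (((Fintype.card (Fin (2 * k)) : ℕ) : ℝ) * (2 + s ^ 2)) * Q + 43904 * Q ^ 2 :=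
        add_le_add le_rfl (hsum.trans hfin)
    _ = (28 * k + 168 * (k * ℓ) + 43904) * Q ^ 2 := by
        rw [hs2, Fintype.card_fin]; push_cast; ring
    _ ≤ (44100 * k * ℓ) * Q ^ 2 := by
        refine mul_le_mul_of_nonneg_right ?_ (_root_.sq_nonneg Q)
        linarith

/-! ### Lower tails of empirical means of nonnegative variables -/

/-- `(1 - y + y²/2)(1 + y + y²/2) = 1 + y⁴/4 ≥ 1`, and the second factor is at most `exp y`. -/
lemma exp_neg_le_quadratic {y : ℝ} (hy : 0 ≤ y) : Real.exp (-y) ≤ 1 - y + y ^ 2 / 2 := by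
  have h1 := Real.quadratic_le_exp_of_nonneg hy
  have h2 : Real.exp (-y) * Real.exp y = 1 := by rw [← Real.exp_add]; simp
  have h3 : 0 < Real.exp y := Real.exp_pos y
  have h4 : 0 ≤ 1 - y + y ^ 2 / 2 := by nlinarith [sq_nonneg (y - 1)]
  refine le_of_mul_le_mul_right ?_ h3
  rw [h2]
  have h5 := mul_le_mul_of_nonneg_left h1 h4
  nlinarith [sq_nonneg (y ^ 2)]

/-- Chernoff's method for the lower tail. As `X ≥ 0`, the quadratic bound on `exp(-tX)` holds for
all values of `X`, so a second moment suffices and no upper bound on `X` enters. -/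
lemma measure_pi_sum_le {Ω : Type*} [MeasurableSpace Ω] (μ : Measure Ω) [IsProbabilityMeasure μ]
    {X : Ω → ℝ} (hXm : Measurable X) (hX0 : ∀ ω, 0 ≤ X ω) (hX1 : Integrable X μ)
    (hX2 : Integrable (fun ω => X ω ^ 2) μ) (hmean : ∫ ω, X ω ∂μ = 1) {V : ℝ} (hV : 0 < V)
    (hXV : ∫ ω, X ω ^ 2 ∂μ ≤ V) {η : ℝ} (hη : 0 < η) (m : ℕ) :
    (Measure.pi fun _ : Fin m => μ) {ω | ∑ j, X (ω j) ≤ m * (1 - η)} ≤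
      ENNReal.ofReal (Real.exp (-(m * η ^ 2 / (2 * V)))) := by
  -- The minimizer of `-tη + t²V/2`.
  set t := η / V with ht
  have ht0 : 0 < t := by positivity
  have hexp_int : Integrable (fun ω => Real.exp (-(t * X ω))) μ := by
    refine Integrable.of_bound (C := 1)
      (Measurable.aestronglyMeasurable (by fun_prop)) (ae_of_all _ fun ω => ?_)
    rw [Real.norm_of_nonneg (Real.exp_pos _).le, Real.exp_le_one_iff]
    have := mul_nonneg ht0.le (hX0 ω)
    linarith
  have h1 : ∫ ω, Real.exp (-(t * X ω)) ∂μ ≤ Real.exp (-t + t ^ 2 * V / 2) := by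
    have i2 : Integrable (fun ω => 1 - t * X ω + t ^ 2 / 2 * X ω ^ 2) μ :=
      ((integrable_const 1).sub (hX1.const_mul t)).add (hX2.const_mul _)
    have h2 : ∫ ω, Real.exp (-(t * X ω)) ∂μ ≤ ∫ ω, (1 - t * X ω + t ^ 2 / 2 * X ω ^ 2) ∂μ := by
      refine integral_mono hexp_int i2 fun ω => ?_
      refine (exp_neg_le_quadratic (mul_nonneg ht0.le (hX0 ω))).trans (le_of_eq ?_)
      ring
    have i3 : Integrable (fun ω => 1 - t * X ω) μ := (integrable_const 1).sub (hX1.const_mul t)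
    rw [integral_add i3 (hX2.const_mul _), integral_sub (integrable_const 1) (hX1.const_mul t),
      integral_const_mul, integral_const_mul, hmean] at h2
    simp only [integral_const, probReal_univ, one_smul, mul_one] at h2
    have h3 := Real.add_one_le_exp (-t + t ^ 2 * V / 2)
    have h4 : t ^ 2 / 2 * ∫ ω, X ω ^ 2 ∂μ ≤ t ^ 2 / 2 * V :=
      mul_le_mul_of_nonneg_left hXV (by positivity)
    linarith
  have hprod : ∫ ω : Fin m → Ω, ∏ j, Real.exp (-(t * X (ω j))) ∂(Measure.pi fun _ : Fin m => μ) =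
      (∫ ω, Real.exp (-(t * X ω)) ∂μ) ^ m := by
    rw [integral_fintype_prod_eq_prod (f := fun _ ω => Real.exp (-(t * X ω)))]
    simp
  have hint : Integrable (fun ω : Fin m → Ω => ∏ j, Real.exp (-(t * X (ω j))))
      (Measure.pi fun _ : Fin m => μ) :=
    Integrable.fintype_prod (f := fun _ ω => Real.exp (-(t * X ω))) fun _ => hexp_int
  have hmarkov := mul_meas_ge_le_integral_of_nonneg (μ := Measure.pi fun _ : Fin m => μ)
    (ae_of_all _ fun ω => Finset.prod_nonneg fun j _ => (Real.exp_pos _).le) hint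
    (Real.exp (-(t * (m * (1 - η)))))
  rw [hprod] at hmarkov
  have hset : {ω : Fin m → Ω | Real.exp (-(t * (m * (1 - η)))) ≤ ∏ j, Real.exp (-(t * X (ω j)))} =
      {ω | ∑ j, X (ω j) ≤ m * (1 - η)} := by
    ext ω
    simp only [Set.mem_ofPred_eq]
    rw [← Real.exp_sum, Real.exp_le_exp, Finset.sum_neg_distrib, ← Finset.mul_sum, neg_le_neg_iff,
      mul_le_mul_iff_right₀ ht0]
  rw [hset] at hmarkov
  rw [← ofReal_measureReal]
  apply ENNReal.ofReal_le_ofReal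
  have h5 : (∫ ω, Real.exp (-(t * X ω)) ∂μ) ^ m ≤ Real.exp (-t + t ^ 2 * V / 2) ^ m :=
    pow_le_pow_left₀ (integral_nonneg fun ω => (Real.exp_pos _).le) h1 m
  have h6 : Real.exp (-t + t ^ 2 * V / 2) ^ m =
      Real.exp (-(t * (m * (1 - η)))) * Real.exp (-(m * η ^ 2 / (2 * V))) := by
    rw [← Real.exp_nat_mul, ← Real.exp_add]
    congr 1
    rw [ht]
    field_simp
    ring
  rw [h6] at h5
  exact le_of_mul_le_mul_left (hmarkov.trans h5) (Real.exp_pos _)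

/-! ### Finite nets by rounding finitely many real parameters -/

/-- One representative of `S` is kept for each occupied cell of the grid of mesh `η`. The net lies
in `S`, so its members are again normalized families. -/
lemma exists_finset_net {S ι : Type*} [Fintype ι] (θ : S → ι → ℝ) {B η : ℝ} (hη : 0 < η)
    (hB : ∀ s i, |θ s i| ≤ B) :
    ∃ F : Finset S, F.card ≤ (2 * ⌈B / η⌉₊ + 1) ^ Fintype.card ι ∧
      ∀ s, ∃ s' ∈ F, ∀ i, |θ s i - θ s' i| ≤ η := by
  classical
  set N := ⌈B / η⌉₊ with hN
  let cell : S → ι → ℤ := fun s i => ⌊θ s i / η⌋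
  let cells : Finset (ι → ℤ) := Fintype.piFinset fun _ => Finset.Icc (-(N : ℤ)) N
  have hcell : ∀ s, cell s ∈ cells := by
    intro s
    rw [Fintype.mem_piFinset]
    intro i
    have h1 := abs_le.1 (hB s i)
    have h2 : B / η ≤ N := Nat.le_ceil _
    rw [Finset.mem_Icc]
    constructor
    · refine Int.le_floor.2 ?_
      have : -(B / η) ≤ θ s i / η := by
        rw [← neg_div]; exact div_le_div_of_nonneg_right h1.1 hη.le
      push_cast
      linarith
    · have h3 : θ s i / η ≤ B / η := div_le_div_of_nonneg_right h1.2 hη.le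
      have h4 : ((⌊θ s i / η⌋ : ℤ) : ℝ) ≤ (N : ℤ) := by
        push_cast
        exact (Int.floor_le _).trans (h3.trans h2)
      exact_mod_cast h4
  let used : Finset (ι → ℤ) := cells.filter fun c => ∃ s, cell s = c
  have hused : ∀ c : used, ∃ s, cell s = c := fun c => (Finset.mem_filter.1 c.2).2
  choose rep hrep using hused
  refine ⟨Finset.univ.image rep, ?_, fun s => ?_⟩
  · refine Finset.card_image_le.trans ?_
    rw [Finset.card_univ, Fintype.card_coe]
    refine (Finset.card_filter_le _ _).trans (le_of_eq ?_)
    rw [Fintype.card_piFinset, Finset.prod_const, Finset.card_univ, Int.card_Icc]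
    congr 1
    omega
  · have hs : cell s ∈ used := Finset.mem_filter.2 ⟨hcell s, s, rfl⟩
    refine ⟨rep ⟨cell s, hs⟩, Finset.mem_image_of_mem _ (Finset.mem_univ _), fun i => ?_⟩
    have h1 : ⌊θ s i / η⌋ = ⌊θ (rep ⟨cell s, hs⟩) i / η⌋ := (congrFun (hrep ⟨cell s, hs⟩) i).symm
    have h2 := (Int.abs_sub_lt_one_of_floor_eq_floor h1).le
    rwa [← sub_div, abs_div, abs_of_pos hη, div_le_one hη] at h2

/-! ### Lipschitz parametrization of sums of dipoles -/

/-- The entire function `(exp(i y) - 1) / (i y)`. -/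
def expQuot (y : ℝ) : ℂ := ∫ s in (0 : ℝ)..1, Complex.exp (Complex.I * y * s)

lemma I_mul_expQuot (y : ℝ) :
    Complex.I * y * expQuot y = Complex.exp (Complex.I * y) - 1 := by
  by_cases hy : y = 0
  · simp [hy]
  · have hc : Complex.I * (y : ℂ) ≠ 0 := mul_ne_zero Complex.I_ne_zero (by exact_mod_cast hy)
    rw [expQuot, integral_exp_mul_complex hc, mul_div_cancel₀ _ hc]
    simp

lemma norm_cexp_I_mul (y : ℝ) : ‖Complex.exp (Complex.I * y)‖ = 1 := by
  rw [mul_comm, Complex.norm_exp_ofReal_mul_I]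

lemma norm_cexp_I_sub_le (x y : ℝ) :
    ‖Complex.exp (Complex.I * x) - Complex.exp (Complex.I * y)‖ ≤ |x - y| := by
  have e : Complex.exp (Complex.I * x) - Complex.exp (Complex.I * y) =
      Complex.exp (Complex.I * y) * (Complex.exp (Complex.I * (x - y : ℝ)) - 1) := by
    rw [mul_sub, mul_one, ← Complex.exp_add]
    push_cast
    ring_nf
  rw [e, norm_mul, norm_cexp_I_mul, one_mul]
  exact Real.norm_exp_I_mul_ofReal_sub_one_le

lemma norm_expQuot_le (y : ℝ) : ‖expQuot y‖ ≤ 1 := by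
  have := intervalIntegral.norm_integral_le_of_norm_le_const (a := (0 : ℝ)) (b := 1) (C := 1)
    (f := fun s : ℝ => Complex.exp (Complex.I * y * s)) (fun s _ => by
      have : Complex.I * (y : ℂ) * s = Complex.I * ((y * s : ℝ) : ℂ) := by push_cast; ring
      rw [this, norm_cexp_I_mul])
  simpa [expQuot] using this

lemma norm_expQuot_sub_le (x y : ℝ) : ‖expQuot x - expQuot y‖ ≤ |x - y| := by
  have hi : ∀ y : ℝ, IntervalIntegrable (fun s : ℝ => Complex.exp (Complex.I * y * s)) volume 0 1 :=
    fun y => Continuous.intervalIntegrable (by fun_prop) _ _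
  rw [expQuot, expQuot, ← intervalIntegral.integral_sub (hi x) (hi y)]
  have := intervalIntegral.norm_integral_le_of_norm_le_const (a := (0 : ℝ)) (b := 1) (C := |x - y|)
    (f := fun s : ℝ => Complex.exp (Complex.I * x * s) - Complex.exp (Complex.I * y * s))
    (fun s hs => by
      rw [Set.uIoc_of_le zero_le_one] at hs
      have e : ∀ y : ℝ, Complex.I * (y : ℂ) * s = Complex.I * ((y * s : ℝ) : ℂ) := fun y => by
        push_cast; ring
      rw [e, e]
      refine (norm_cexp_I_sub_le _ _).trans ?_
      rw [← sub_mul, abs_mul, abs_of_pos hs.1]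
      exact mul_le_of_le_one_right (abs_nonneg _) hs.2)
  simpa using this

/-- A dipole of total mass `A` and moment `v` with displacement `z` and base point `y`, seen by the
frequency `x`. -/
def dipoleWave {d : ℕ} (x : Space d) (A : ℝ) (v z y : Space d) : ℂ :=
  (A + Complex.I * (inner ℝ x v : ℝ) * expQuot (inner ℝ x z)) *
    Complex.exp (Complex.I * (inner ℝ x y : ℝ))

/-- The parameters are changed one at a time, using that `expQuot` is bounded by `1` and
`1`-Lipschitz. The growth in `x` is at most quadratic. -/
lemma norm_dipoleWave_sub_le {d : ℕ} (x : Space d) (A A' : ℝ) (v z y v' z' y' : Space d) :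
    ‖dipoleWave x A v z y - dipoleWave x A' v' z' y'‖ ≤
      |A - A'| + ‖x‖ * (‖v - v'‖ + |A'| * ‖y - y'‖) +
        ‖x‖ ^ 2 * (‖v'‖ * (‖z - z'‖ + ‖y - y'‖)) := by
  set e := Complex.exp (Complex.I * (inner ℝ x y : ℝ)) with he
  set e' := Complex.exp (Complex.I * (inner ℝ x y' : ℝ)) with he'
  set E := expQuot (inner ℝ x z)
  set E' := expQuot (inner ℝ x z')
  have hin : ∀ u : Space d, |inner ℝ x u| ≤ ‖x‖ * ‖u‖ := fun u => abs_real_inner_le_norm x u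
  have hE : ‖E‖ ≤ 1 := norm_expQuot_le _
  have hE' : ‖E'‖ ≤ 1 := norm_expQuot_le _
  have hEE : ‖E - E'‖ ≤ ‖x‖ * ‖z - z'‖ := by
    refine (norm_expQuot_sub_le _ _).trans ?_
    rw [← inner_sub_right]; exact hin _
  have hee : ‖e - e'‖ ≤ ‖x‖ * ‖y - y'‖ := by
    refine (norm_cexp_I_sub_le _ _).trans ?_
    rw [← inner_sub_right]; exact hin _
  have hn : ‖e‖ = 1 := norm_cexp_I_mul _
  have hdec : dipoleWave x A v z y - dipoleWave x A' v' z' y' =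
      ((A - A' : ℝ) : ℂ) * e + Complex.I * (inner ℝ x (v - v') : ℝ) * E * e +
      Complex.I * (inner ℝ x v' : ℝ) * (E - E') * e +
      (A' + Complex.I * (inner ℝ x v' : ℝ) * E') * (e - e') := by
    rw [dipoleWave, dipoleWave, inner_sub_right]
    push_cast
    ring
  have t1 : ‖((A - A' : ℝ) : ℂ) * e‖ ≤ |A - A'| := by
    rw [norm_mul, hn, mul_one, Complex.norm_real, Real.norm_eq_abs]
  have t2 : ‖Complex.I * (inner ℝ x (v - v') : ℝ) * E * e‖ ≤ ‖x‖ * ‖v - v'‖ := by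
    rw [norm_mul, norm_mul, norm_mul, hn, Complex.norm_I, Complex.norm_real, Real.norm_eq_abs,
      mul_one, one_mul]
    exact (mul_le_of_le_one_right (abs_nonneg _) hE).trans (hin _)
  have t3 : ‖Complex.I * (inner ℝ x v' : ℝ) * (E - E') * e‖ ≤
      ‖x‖ * ‖v'‖ * (‖x‖ * ‖z - z'‖) := by
    rw [norm_mul, norm_mul, norm_mul, hn, Complex.norm_I, Complex.norm_real, Real.norm_eq_abs,
      mul_one, one_mul]
    exact mul_le_mul (hin _) hEE (norm_nonneg _) (by positivity)
  have t4 : ‖((A' : ℂ) + Complex.I * (inner ℝ x v' : ℝ) * E') * (e - e')‖ ≤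
      (|A'| + ‖x‖ * ‖v'‖) * (‖x‖ * ‖y - y'‖) := by
    rw [norm_mul]
    refine mul_le_mul ?_ hee (norm_nonneg _) (by positivity)
    refine (norm_add_le _ _).trans ?_
    rw [norm_mul, norm_mul, Complex.norm_I, Complex.norm_real, Complex.norm_real, Real.norm_eq_abs,
      Real.norm_eq_abs, one_mul]
    exact add_le_add le_rfl ((mul_le_of_le_one_right (abs_nonneg _) hE').trans (hin _))
  rw [hdec]
  refine (norm_add_le _ _).trans ((add_le_add ((norm_add_le _ _).trans (add_le_add
    ((norm_add_le _ _).trans (add_le_add t1 t2)) t3)) t4).trans (le_of_eq ?_))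
  ring

namespace DipoleFamily

variable {d : ℕ} {ε R : ℝ} {ι : Type}

/-- The vector parameters of the `i`-th dipole: its moment, displacement and base point, in units
of the kernel scale. -/
def vec (D : DipoleFamily d ε R ι) (lam : ℝ) (i : ι) : Fin 3 → Space d :=
  ![(D.a i * lam) • (D.p i - D.q i), lam • (D.p i - D.q i), lam • D.q i]

/-- All real parameters of a family of dipoles. -/
def param (D : DipoleFamily d ε R ι) (lam : ℝ) : ι × Option (Fin 3 × Fin d) → ℝ
  | (i, none) => D.a i - D.b i
  | (i, some (c, j)) => D.vec lam i c j

/-- A normalized dipole with nearby poles may have huge `a` and `b`; only `a - b` and the moment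
`a(p - q)` stay bounded. Writing `a e^{i⟨ω,p⟩} - b e^{i⟨ω,q⟩} = (a - b + a(e^{i⟨ω,p-q⟩} - 1))
e^{i⟨ω,q⟩}` uses these alone. -/
lemma feat_eq_dipoleWave [Fintype ι] (D : DipoleFamily d ε R ι) {lam : ℝ} (hl : 0 < lam)
    (ω : Space d) :
    D.feat lam ω = ((CΛ d / weight lam ω : ℝ) : ℂ) * ∑ i, dipoleWave (lam⁻¹ • ω) (D.a i - D.b i)
      (D.vec lam i 0) (D.vec lam i 1) (D.vec lam i 2) := by
  rw [feat, Finset.mul_sum]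
  refine Finset.sum_congr rfl fun i _ => ?_
  have hl' : lam ≠ 0 := hl.ne'
  simp only [vec, Matrix.cons_val_zero, Matrix.cons_val_one, Matrix.cons_val]
  rw [dipoleWave]
  have e1 : (inner ℝ (lam⁻¹ • ω) ((D.a i * lam) • (D.p i - D.q i)) : ℝ) =
      D.a i * inner ℝ ω (D.p i - D.q i) := by
    rw [inner_smul_left, inner_smul_right]
    simp only [map_inv₀, conj_trivial]
    field_simp
  have e2 : ∀ u : Space d, (inner ℝ (lam⁻¹ • ω) (lam • u) : ℝ) = inner ℝ ω u := by
    intro u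
    rw [inner_smul_left, inner_smul_right]
    simp only [map_inv₀, conj_trivial]
    field_simp
  rw [e1, e2, e2]
  have h := I_mul_expQuot (inner ℝ ω (D.p i - D.q i))
  have e3 : Complex.I * ((D.a i * inner ℝ ω (D.p i - D.q i) : ℝ) : ℂ) *
      expQuot (inner ℝ ω (D.p i - D.q i)) =
      D.a i * (Complex.exp (Complex.I * (inner ℝ ω (D.p i - D.q i) : ℝ)) - 1) := by
    rw [← h]; push_cast; ring
  have e4 : Complex.exp (Complex.I * (inner ℝ ω (D.p i) : ℝ)) =
      Complex.exp (Complex.I * (inner ℝ ω (D.p i - D.q i) : ℝ)) *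
        Complex.exp (Complex.I * (inner ℝ ω (D.q i) : ℝ)) := by
    rw [← Complex.exp_add, inner_sub_right]
    push_cast
    ring_nf
  rw [e3, feature, feature, e4]
  push_cast
  ring

lemma abs_sub_sq_le (D : DipoleFamily d ε R ι) (lam : ℝ) (i : ι) :
    (D.a i - D.b i) ^ 2 ≤ 2 * D.sq lam i := by
  have := sub_sq_le_dipoleSq (a := D.a i) (b := D.b i) (lam := lam) (p := D.p i) (q := D.q i)
    (u := 1) (v := 1) (L := 0) (by simp)
  simpa [one_add_one_eq_two, sq] using this

/-- Completing the square in `b` leaves `a²(1 - K²)`, and `K² = exp(-r²) ≤ 1/(1 + r²)`. -/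
lemma sq_mul_sq_le (D : DipoleFamily d ε R ι) (lam : ℝ) (i : ι) :
    D.a i ^ 2 * (lam * ‖D.p i - D.q i‖) ^ 2 ≤
      (1 + (lam * ‖D.p i - D.q i‖) ^ 2) * D.sq lam i := by
  set r := lam * ‖D.p i - D.q i‖ with hr
  set K := gaussKernel lam (D.p i) (D.q i) with hK
  have hK2 : (1 + r ^ 2) * K ^ 2 ≤ 1 := by
    have e : K ^ 2 = Real.exp (-(r ^ 2)) := by
      rw [hK, gaussKernel, ← Real.exp_nat_mul, hr]
      congr 1
      push_cast
      ring
    have h1 := Real.add_one_le_exp (r ^ 2)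
    have h2 : Real.exp (r ^ 2) * Real.exp (-(r ^ 2)) = 1 := by rw [← Real.exp_add]; simp
    rw [e]
    nlinarith [Real.exp_pos (-(r ^ 2))]
  have hsq : D.sq lam i = (D.b i - D.a i * K) ^ 2 + D.a i ^ 2 * (1 - K ^ 2) := by
    rw [sq, dipoleSq, ← hK]; ring
  rw [hsq]
  have h3 : D.a i ^ 2 * r ^ 2 ≤ D.a i ^ 2 * ((1 + r ^ 2) * (1 - K ^ 2)) :=
    mul_le_mul_of_nonneg_left (by linarith) (_root_.sq_nonneg _)
  have h4 : 0 ≤ (1 + r ^ 2) * (D.b i - D.a i * K) ^ 2 := by positivity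
  linarith

lemma norm_vec_zero_sq_le (D : DipoleFamily d ε R ι) {lam : ℝ} (hl : 0 < lam) (i : ι) :
    ‖D.vec lam i 0‖ ^ 2 ≤ (1 + (lam * ε) ^ 2) * D.sq lam i := by
  have e : ‖D.vec lam i 0‖ ^ 2 = D.a i ^ 2 * (lam * ‖D.p i - D.q i‖) ^ 2 := by
    simp only [vec, Matrix.cons_val_zero]
    rw [norm_smul, Real.norm_eq_abs, mul_pow, sq_abs]
    ring
  rw [e]
  refine (D.sq_mul_sq_le lam i).trans (mul_le_mul_of_nonneg_right ?_ (D.sq_nonneg lam i))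
  have := D.dist_le i
  gcongr

lemma norm_vec_one_le (D : DipoleFamily d ε R ι) {lam : ℝ} (hl : 0 < lam) (i : ι) :
    ‖D.vec lam i 1‖ ≤ lam * ε := by
  simp only [vec, Matrix.cons_val_one, Matrix.cons_val_zero]
  rw [norm_smul, Real.norm_of_nonneg hl.le]
  exact mul_le_mul_of_nonneg_left (D.dist_le i) hl.le

lemma norm_vec_two_le (D : DipoleFamily d ε R ι) {lam : ℝ} (hl : 0 < lam) (i : ι) :
    ‖D.vec lam i 2‖ ≤ lam * R := by
  simp only [vec, Matrix.cons_val]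
  rw [norm_smul, Real.norm_of_nonneg hl.le]
  exact mul_le_mul_of_nonneg_left (D.norm_q_le i) hl.le

variable [Fintype ι]

lemma sq_le_two (D : DipoleFamily d ε R ι) {lam : ℝ} (hl : 0 < lam) (hT : 1 ≤ lam * ε)
    (hM : 3 * tailBound (lam * ε) * Fintype.card ι ≤ 1 / 100) (hD : D.quad lam = 1) (i : ι) :
    D.sq lam i ≤ 2 := by
  have h1 := D.sum_sq_le_two_mul_quad hl hT hM
  have h2 := Finset.single_le_sum (fun i _ => D.sq_nonneg lam i) (Finset.mem_univ i)
  rw [hD] at h1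
  linarith

lemma abs_sub_le_two (D : DipoleFamily d ε R ι) {lam : ℝ} (hl : 0 < lam) (hT : 1 ≤ lam * ε)
    (hM : 3 * tailBound (lam * ε) * Fintype.card ι ≤ 1 / 100) (hD : D.quad lam = 1) (i : ι) :
    |D.a i - D.b i| ≤ 2 := by
  refine abs_le_of_sq_le_sq ?_ (by norm_num)
  have := D.abs_sub_sq_le lam i
  have := D.sq_le_two hl hT hM hD i
  linarith

lemma norm_vec_zero_le (D : DipoleFamily d ε R ι) {lam : ℝ} (hl : 0 < lam) (hT : 1 ≤ lam * ε)
    (hM : 3 * tailBound (lam * ε) * Fintype.card ι ≤ 1 / 100) (hD : D.quad lam = 1) (i : ι) :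
    ‖D.vec lam i 0‖ ≤ 2 * (lam * ε) := by
  refine le_of_sq_le_sq ?_ (by positivity)
  have h1 := D.norm_vec_zero_sq_le hl i
  have h2 := D.sq_le_two hl hT hM hD i
  have h3 : 1 ≤ (lam * ε) ^ 2 := one_le_pow₀ hT
  nlinarith [D.sq_nonneg lam i]

lemma abs_param_le (D : DipoleFamily d ε R ι) {lam : ℝ} (hl : 0 < lam) (hT : 1 ≤ lam * ε)
    (hM : 3 * tailBound (lam * ε) * Fintype.card ι ≤ 1 / 100) (hR : ε < R)
    (hD : D.quad lam = 1) (n : ι × Option (Fin 3 × Fin d)) :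
    |D.param lam n| ≤ 2 * (lam * R) := by
  have hTR : lam * ε ≤ lam * R := mul_le_mul_of_nonneg_left hR.le hl.le
  obtain ⟨i, _ | ⟨c, j⟩⟩ := n
  · have := D.abs_sub_le_two hl hT hM hD i
    change |D.a i - D.b i| ≤ _
    linarith
  · change |D.vec lam i c j| ≤ _
    rw [← Real.norm_eq_abs]
    refine (PiLp.norm_apply_le _ j).trans ?_
    fin_cases c
    · exact (D.norm_vec_zero_le hl hT hM hD i).trans (by linarith)
    · exact (D.norm_vec_one_le hl i).trans (by linarith)
    · exact (D.norm_vec_two_le hl i).trans (by linarith)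

end DipoleFamily

lemma norm_le_card_mul_of_coord_le {d : ℕ} {x : Space d} {η : ℝ} (hη : 0 ≤ η)
    (hx : ∀ j, |x j| ≤ η) : ‖x‖ ≤ d * η := by
  refine le_of_sq_le_sq ?_ (by positivity)
  rw [EuclideanSpace.norm_sq_eq, mul_pow]
  have h1 : ∑ j, ‖x j‖ ^ 2 ≤ ∑ _j : Fin d, η ^ 2 := Finset.sum_le_sum fun j _ => by
    rw [Real.norm_eq_abs]
    exact pow_le_pow_left₀ (abs_nonneg _) (hx j) 2
  rw [Finset.sum_const, Finset.card_univ, Fintype.card_fin, nsmul_eq_mul] at h1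
  refine h1.trans (mul_le_mul_of_nonneg_right ?_ (sq_nonneg η))
  have : (d : ℝ) ≤ (d : ℝ) ^ 2 := by exact_mod_cast Nat.le_self_pow two_ne_zero d
  exact this

/-- This is the purpose of the weight: `d w = d + ‖ω/λ‖²` dominates every power of `‖ω/λ‖` in the
Lipschitz bound of `dipoleWave`. -/
lemma norm_le_mul_weight {d : ℕ} (hd : 1 ≤ d) {lam : ℝ} (hl : 0 < lam) (ω : Space d) :
    1 ≤ d * weight lam ω ∧ ‖lam⁻¹ • ω‖ ≤ d * weight lam ω ∧ ‖lam⁻¹ • ω‖ ^ 2 ≤ d * weight lam ω := by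
  have hd' : (1 : ℝ) ≤ d := by exact_mod_cast hd
  have e : d * weight lam ω = d + ‖lam⁻¹ • ω‖ ^ 2 := by
    rw [weight, norm_smul, Real.norm_of_nonneg (by positivity)]
    field_simp
  rw [e]
  have := sq_nonneg (‖lam⁻¹ • ω‖)
  refine ⟨by linarith, by nlinarith [sq_nonneg (‖lam⁻¹ • ω‖ - 1)], by linarith⟩

lemma DipoleFamily.norm_feat_sub_le {d : ℕ} {ε R : ℝ} {ι : Type} [Fintype ι] (hd : 1 ≤ d)
    {lam : ℝ} (hl : 0 < lam) (hT : 1 ≤ lam * ε)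
    (hM : 3 * tailBound (lam * ε) * Fintype.card ι ≤ 1 / 100) {D D' : DipoleFamily d ε R ι}
    (hD' : D'.quad lam = 1) {η : ℝ} (hη : 0 ≤ η)
    (h : ∀ n, |D.param lam n - D'.param lam n| ≤ η) (ω : Space d) :
    ‖D.feat lam ω - D'.feat lam ω‖ ≤ 24 * Fintype.card ι * d ^ 2 * (lam * ε) * η := by
  have hd' : (1 : ℝ) ≤ d := by exact_mod_cast hd
  obtain ⟨w1, w2, w3⟩ := norm_le_mul_weight hd hl ω
  have hw := weight_pos lam ω
  have hvec : ∀ i c, ‖D.vec lam i c - D'.vec lam i c‖ ≤ d * η := fun i c =>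
    norm_le_card_mul_of_coord_le hη fun j => h (i, some (c, j))
  have hA : ∀ i, |(D.a i - D.b i) - (D'.a i - D'.b i)| ≤ d * η := fun i =>
    (h (i, none)).trans (le_mul_of_one_le_left hη hd')
  have hC : CΛ d ≤ 3 := by
    have := CΛ_sq_le hd
    nlinarith [CΛ_nonneg d]
  rw [D.feat_eq_dipoleWave hl, D'.feat_eq_dipoleWave hl, ← mul_sub, norm_mul, Complex.norm_real,
    Real.norm_of_nonneg (div_nonneg (CΛ_nonneg d) hw.le), ← Finset.sum_sub_distrib]
  have hdη : 0 ≤ d * η := by positivity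
  have hterm : ∀ i, ‖dipoleWave (lam⁻¹ • ω) (D.a i - D.b i)
      (D.vec lam i 0) (D.vec lam i 1) (D.vec lam i 2) - dipoleWave (lam⁻¹ • ω) (D'.a i - D'.b i)
      (D'.vec lam i 0) (D'.vec lam i 1) (D'.vec lam i 2)‖ ≤
      d * weight lam ω * (8 * (lam * ε) * (d * η)) := by
    intro i
    refine (norm_dipoleWave_sub_le ..).trans ?_
    have a1 := D'.abs_sub_le_two hl hT hM hD' i
    have a2 := D'.norm_vec_zero_le hl hT hM hD' i
    calc _ ≤ d * weight lam ω * (d * η) + d * weight lam ω * (d * η + 2 * (d * η)) +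
          d * weight lam ω * (2 * (lam * ε) * (d * η + d * η)) := by
          gcongr
          · exact (hA i).trans (le_mul_of_one_le_left hdη w1)
          · exact hvec i 0
          · exact hvec i 2
          · exact hvec i 1
          · exact hvec i 2
      _ = d * weight lam ω * ((4 + 4 * (lam * ε)) * (d * η)) := by ring
      _ ≤ _ := by
          gcongr
          linarith
  have hsum := (norm_sum_le Finset.univ fun i => dipoleWave (lam⁻¹ • ω) (D.a i - D.b i)
      (D.vec lam i 0) (D.vec lam i 1) (D.vec lam i 2) - dipoleWave (lam⁻¹ • ω) (D'.a i - D'.b i)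
      (D'.vec lam i 0) (D'.vec lam i 1) (D'.vec lam i 2)).trans
    (Finset.sum_le_card_nsmul _ _ _ fun i _ => hterm i)
  rw [Finset.card_univ, nsmul_eq_mul] at hsum
  calc _ ≤ 3 / weight lam ω * (Fintype.card ι *
        (d * weight lam ω * (8 * (lam * ε) * (d * η)))) := by gcongr
    _ = _ := by field_simp; ring

/-! ### Uniform lower restricted isometry -/

lemma separation_scale_sq_le {k : ℕ} (hk : 1 ≤ k) {lam ε : ℝ} (hl : 0 < lam)
    (hε : ε = 1 / (lam * sigma k)) : (lam * ε) ^ 2 ≤ 29 * k := by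
  have hk' : (1 : ℝ) ≤ k := by exact_mod_cast hk
  rw [(separation_scale hk hl hε).2.2]
  have := Real.log_le_sub_one_of_pos (x := 2 * (k : ℝ) - 1) (by linarith)
  linarith

/-- The grid ratio is `384 (λε)² k d² (R/ε)/δ` with `(λε)² ≤ 29k`, so `2⌈x⌉ + 1` is at most `22275 ≤
exp 15` times `(kd)² (R/ε)/δ`. There are at most `8kd` parameters, and `8 * 15 = 120`. -/
lemma net_card_le {d k : ℕ} (hd : 1 ≤ d) (hk : 1 ≤ k) {lam ε R δ : ℝ} (hl : 0 < lam)
    (hε : ε = 1 / (lam * sigma k)) (hR : ε < R) (hδ : 0 < δ) (hδ1 : δ < 1) :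
    (((2 * ⌈2 * (lam * R) / (δ / (192 * k * d ^ 2 * (lam * ε)))⌉₊ + 1) ^
      (2 * k * (3 * d + 1)) : ℕ) : ℝ) ≤
      Real.exp (120 * (k * d * (1 + Real.log (k * d) + Real.log (R / ε) + Real.log (1 / δ)))) := by
  obtain ⟨hε0, hT1, -⟩ := separation_scale hk hl hε
  have hT2 := separation_scale_sq_le hk hl hε
  have hk' : (1 : ℝ) ≤ k := by exact_mod_cast hk
  have hd' : (1 : ℝ) ≤ d := by exact_mod_cast hd
  have hkd : (1 : ℝ) ≤ k * d := by nlinarith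
  have hR0 : 0 < R := hε0.trans hR
  have hRε : 1 ≤ R / ε := (one_le_div hε0).2 hR.le
  have hδ' : 1 ≤ 1 / δ := (one_le_div hδ).2 hδ1.le
  set x := 2 * (lam * R) / (δ / (192 * k * d ^ 2 * (lam * ε))) with hx
  have hx0 : 0 ≤ x := by positivity
  have hxle : x ≤ 11136 * ((k * d) ^ 2 * (R / ε) * (1 / δ)) := by
    have e : x = 384 * (lam * ε) ^ 2 * (k * d ^ 2 * (R / ε) * (1 / δ)) := by
      rw [hx]; field_simp; ring
    rw [e]
    calc _ ≤ 384 * (29 * k) * (k * d ^ 2 * (R / ε) * (1 / δ)) := by gcongr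
      _ = _ := by ring
  have hY : 1 ≤ (k * d) ^ 2 * (R / ε) * (1 / δ) := by
    have h1 : 1 ≤ ((k : ℝ) * d) ^ 2 := one_le_pow₀ hkd
    have h2 : 1 ≤ ((k : ℝ) * d) ^ 2 * (R / ε) := by nlinarith
    nlinarith
  have hbase : ((2 * ⌈x⌉₊ + 1 : ℕ) : ℝ) ≤ Real.exp 15 * ((k * d) ^ 2 * (R / ε) * (1 / δ)) := by
    have h1 := Nat.ceil_lt_add_one hx0
    have h15 : (22275 : ℝ) ≤ Real.exp 15 := by
      have h2 : Real.exp 15 = Real.exp 1 ^ 15 := by rw [← Real.exp_nat_mul]; norm_num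
      rw [h2]
      have h3 : (2.5 : ℝ) ^ 15 ≤ Real.exp 1 ^ 15 :=
        pow_le_pow_left₀ (by norm_num) (by linarith [Real.exp_one_gt_d9]) 15
      refine le_trans ?_ h3
      norm_num
    push_cast
    nlinarith
  have hexp : Real.exp 15 * ((k * d) ^ 2 * (R / ε) * (1 / δ)) =
      Real.exp (15 + 2 * Real.log (k * d) + Real.log (R / ε) + Real.log (1 / δ)) := by
    rw [Real.exp_add, Real.exp_add, Real.exp_add, Real.exp_log (by positivity),
      Real.exp_log (by positivity), show (2 : ℝ) = (2 : ℕ) by norm_num, Real.exp_nat_mul,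
      Real.exp_log (by positivity)]
    ring
  rw [hexp] at hbase
  have l1 := Real.log_nonneg hkd
  have l2 := Real.log_nonneg hRε
  have l3 := Real.log_nonneg hδ'
  set Y := 15 + 2 * Real.log (k * d) + Real.log (R / ε) + Real.log (1 / δ)
  have hYle : Y ≤ 15 * (1 + Real.log (k * d) + Real.log (R / ε) + Real.log (1 / δ)) := by
    simp only [Y]; linarith
  have hcard : ((2 * k * (3 * d + 1) : ℕ) : ℝ) ≤ 8 * (k * d) := by
    push_cast
    nlinarith
  rw [Nat.cast_pow]
  calc _ ≤ Real.exp Y ^ (2 * k * (3 * d + 1)) := pow_le_pow_left₀ (Nat.cast_nonneg _) hbase _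
    _ = Real.exp ((2 * k * (3 * d + 1) : ℕ) * Y) := by rw [Real.exp_nat_mul]
    _ ≤ _ := by
      apply Real.exp_le_exp.2
      calc _ ≤ 8 * (k * d) * (15 * (1 + Real.log (k * d) + Real.log (R / ε) + Real.log (1 / δ))) :=
            mul_le_mul hcard hYle (by simp only [Y]; linarith) (by positivity)
        _ = _ := by ring

/-- Young's inequality. With `ρ = t = δ/4` it carries a lower bound from a net point to a nearby
family at a relative and an additive cost of `δ/4` each. -/
lemma sub_sq_div_le_sq {x y ρ t : ℝ} (hy : 0 ≤ y) (hxy : y ≤ x + ρ)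
    (ht : 0 < t) (ht1 : t ≤ 1) : (1 - t) * y ^ 2 - ρ ^ 2 / t ≤ x ^ 2 := by
  have h1 : y ^ 2 ≤ (x + ρ) ^ 2 := pow_le_pow_left₀ hy hxy 2
  have h2 : (1 - t) * y ^ 2 ≤ (1 - t) * (x + ρ) ^ 2 :=
    mul_le_mul_of_nonneg_left h1 (by linarith)
  have h3 : t * ((1 - t) * (x + ρ) ^ 2 - x ^ 2) ≤ t * (ρ ^ 2 / t) := by
    rw [mul_div_cancel₀ _ ht.ne']
    nlinarith [sq_nonneg (t * (x + ρ) - ρ)]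
  have h4 := le_of_mul_le_mul_left h3 ht
  linarith

/-- A union bound over the net at level `1 - δ/2`, followed by approximation: `(1 - δ/4)(1 - δ/2) -
δ/4 ≥ 1 - δ`. The event is the complement of finitely many measurable sets, yet serves all
normalized families at once. -/
lemma exists_measurableSet_lower_isometry {d k m : ℕ} (hd : 1 ≤ d) (hk : 1 ≤ k)
    {lam ε R δ ζ : ℝ} (hl : 0 < lam) (hε : ε = 1 / (lam * sigma k)) (hR : ε < R)
    (hδ : 0 < δ) (hδ1 : δ < 1) (hζ : 0 < ζ) (hζ1 : ζ < 1)
    (hm : 42336000 * sketchSize d k ε R δ ζ ≤ m) :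
    ∃ G : Set (Fin m → Space d), MeasurableSet G ∧
      ENNReal.ofReal (1 - ζ) ≤ (Measure.pi fun _ : Fin m => freqLaw d lam) G ∧
      ∀ ω ∈ G, ∀ D : DipoleFamily d ε R (Fin (2 * k)), D.quad lam = 1 →
        m * (1 - δ) ≤ ∑ j, ‖D.feat lam (ω j)‖ ^ 2 := by
  have := isProbabilityMeasure_freqLaw hd hl
  obtain ⟨hε0, hT1, hT2⟩ := separation_scale hk hl hε
  have hM : 3 * tailBound (lam * ε) * Fintype.card (Fin (2 * k)) ≤ 1 / 100 := by
    rw [Fintype.card_fin]; exact tailBound_mul_le hk hT2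
  have hk' : (1 : ℝ) ≤ k := by exact_mod_cast hk
  have hd' : (1 : ℝ) ≤ d := by exact_mod_cast hd
  have hR0 : 0 < R := hε0.trans hR
  obtain ⟨hℓ, -⟩ := one_le_log_mul_exp hk
  -- Chosen so that the Lipschitz bound `24 * 2k * d² * (λε) * η` equals `δ/4`.
  set η := δ / (192 * k * d ^ 2 * (lam * ε)) with hη
  have hη0 : 0 < η := by positivity
  obtain ⟨F, hFcard, hF⟩ := exists_finset_net
    (S := {D : DipoleFamily d ε R (Fin (2 * k)) // D.quad lam = 1})
    (fun D => D.1.param lam) (B := 2 * (lam * R)) hη0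
    (fun D n => D.1.abs_param_le hl hT1 hM hR D.2 n)
  have hindex : Fintype.card (Fin (2 * k) × Option (Fin 3 × Fin d)) = 2 * k * (3 * d + 1) := by
    simp
  rw [hindex] at hFcard
  have hFexp : (F.card : ℝ) ≤ _ := (Nat.cast_le.2 hFcard).trans (net_card_le hd hk hl hε hR hδ hδ1)
  set Λ := 1 + Real.log (k * d) + Real.log (R / ε) + Real.log (1 / δ) with hΛ
  set ℓ := Real.log (k * Real.exp 1) with hℓdef
  set V := 44100 * (k : ℝ) * ℓ with hV
  have hV0 : 0 < V := by positivity
  have hΛ0 : 0 ≤ Λ := by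
    have h1 : 0 ≤ Real.log ((k : ℝ) * d) := Real.log_nonneg (by nlinarith)
    have h2 : 0 ≤ Real.log (R / ε) := Real.log_nonneg ((one_le_div hε0).2 hR.le)
    have h3 : 0 ≤ Real.log (1 / δ) := Real.log_nonneg ((one_le_div hδ).2 hδ1.le)
    rw [hΛ]; linarith
  have hζlog : 0 ≤ Real.log (1 / ζ) := Real.log_nonneg ((one_le_div hζ).2 hζ1.le)
  let bad : {D : DipoleFamily d ε R (Fin (2 * k)) // D.quad lam = 1} → Set (Fin m → Space d) :=
    fun D => {ω | ∑ j, ‖D.1.feat lam (ω j)‖ ^ 2 ≤ m * (1 - δ / 2)}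
  have hbadm : ∀ D, MeasurableSet (bad D) := fun D => by
    refine measurableSet_le (Finset.measurable_sum _ fun j _ => ?_) measurable_const
    exact ((D.1.continuous_feat lam).measurable.comp (measurable_pi_apply j)).norm.pow_const 2
  have hbad : ∀ D, (Measure.pi fun _ : Fin m => freqLaw d lam) (bad D) ≤
      ENNReal.ofReal (Real.exp (-(m * (δ / 2) ^ 2 / (2 * V)))) := by
    intro D
    refine measure_pi_sum_le (freqLaw d lam) (X := fun ω => ‖D.1.feat lam ω‖ ^ 2)
      (Continuous.measurable (by fun_prop)) (fun ω => by positivity)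
      (D.1.integrable_norm_feat_pow hd hl 2) ?_ ?_ hV0 ?_ (by positivity) m
    · simp only [← pow_mul]
      exact D.1.integrable_norm_feat_pow hd hl _
    · rw [D.1.integral_norm_feat_sq hd hl, D.2]
    · have := D.1.integral_norm_feat_pow_four_le hd hk hl hε
      rwa [D.2, one_pow, mul_one] at this
  -- The constant is `42336000 = 120 * 2 * 44100 * 4`: net entropy, Chernoff denominator, second
  -- moment, and the square of `δ/2`. Of the factor `min(log(ek), d)` only the bound `≥ 1` is used.
  have hexponent : 120 * (k * d * Λ) - m * (δ / 2) ^ 2 / (2 * V) ≤ -Real.log (1 / ζ) := by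
    have h1 : 120 * (k * d * Λ + Real.log (1 / ζ)) ≤ m * (δ / 2) ^ 2 / (2 * V) := by
      rw [le_div_iff₀ (by positivity)]
      have hmin : 1 ≤ min ℓ (d : ℝ) := le_min hℓ hd'
      have h2 : 42336000 * (k * ℓ * (k * d * Λ + Real.log (1 / ζ))) ≤ m * δ ^ 2 := by
        have e : 42336000 * sketchSize d k ε R δ ζ * δ ^ 2 =
            42336000 * (k * ℓ * (k * d * Λ + Real.log (1 / ζ))) * min ℓ (d : ℝ) := by
          rw [sketchSize]; field_simp; ring
        have h3 := mul_le_mul_of_nonneg_right hm (sq_nonneg δ)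
        rw [e] at h3
        refine le_trans (le_mul_of_one_le_right ?_ hmin) h3
        positivity
      have e : 120 * (k * d * Λ + Real.log (1 / ζ)) * (2 * V) =
          42336000 * (k * ℓ * (k * d * Λ + Real.log (1 / ζ))) / 4 := by rw [hV]; ring
      rw [e]
      linarith
    linarith
  refine ⟨(⋃ D ∈ F, bad D)ᶜ, (F.measurableSet_biUnion fun D _ => hbadm D).compl, ?_, ?_⟩
  · rw [prob_compl_eq_one_sub (F.measurableSet_biUnion fun D _ => hbadm D),
      ENNReal.ofReal_sub _ hζ.le, ENNReal.ofReal_one]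
    refine tsub_le_tsub_left ?_ 1
    refine (measure_biUnion_finset_le F bad).trans ((Finset.sum_le_card_nsmul F _ _
      fun D _ => hbad D).trans ?_)
    rw [nsmul_eq_mul, ← ENNReal.ofReal_natCast, ← ENNReal.ofReal_mul (Nat.cast_nonneg _)]
    apply ENNReal.ofReal_le_ofReal
    calc _ ≤ Real.exp (120 * (k * d * Λ)) * Real.exp (-(m * (δ / 2) ^ 2 / (2 * V))) := by gcongr
      _ = Real.exp (120 * (k * d * Λ) - m * (δ / 2) ^ 2 / (2 * V)) := by
        rw [← Real.exp_add, sub_eq_add_neg]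
      _ ≤ Real.exp (-Real.log (1 / ζ)) := Real.exp_le_exp.2 hexponent
      _ = ζ := by rw [one_div, Real.log_inv, neg_neg, Real.exp_log hζ]
  · intro ω hω D hD
    obtain ⟨D', hD'F, hclose⟩ := hF ⟨D, hD⟩
    have hgood : m * (1 - δ / 2) < ∑ j, ‖D'.1.feat lam (ω j)‖ ^ 2 := by
      by_contra hcon
      exact hω (Set.mem_biUnion hD'F (not_lt.1 hcon))
    have hdist : ∀ j, ‖D'.1.feat lam (ω j)‖ ≤ ‖D.feat lam (ω j)‖ + δ / 4 := by
      intro j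
      have h1 := DipoleFamily.norm_feat_sub_le hd hl hT1 hM (D := D) D'.2 hη0.le hclose (ω j)
      have h2 : 24 * ((Fintype.card (Fin (2 * k)) : ℕ) : ℝ) * d ^ 2 * (lam * ε) * η = δ / 4 := by
        rw [Fintype.card_fin, hη]
        push_cast
        field_simp
        norm_num
      rw [h2] at h1
      have h3 := norm_sub_norm_le (D'.1.feat lam (ω j)) (D.feat lam (ω j))
      rw [norm_sub_rev] at h3
      linarith
    have hj : ∀ j, (1 - δ / 4) * ‖D'.1.feat lam (ω j)‖ ^ 2 - (δ / 4) ^ 2 / (δ / 4) ≤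
        ‖D.feat lam (ω j)‖ ^ 2 := fun j =>
      sub_sq_div_le_sq (norm_nonneg _) (hdist j) (by positivity) (by linarith)
    have hsum := Finset.sum_le_sum fun j (_ : j ∈ Finset.univ) => hj j
    rw [Finset.sum_sub_distrib, ← Finset.mul_sum, Finset.sum_const, Finset.card_univ,
      Fintype.card_fin, nsmul_eq_mul] at hsum
    have e : (δ / 4) ^ 2 / (δ / 4) = δ / 4 := by field_simp
    rw [e] at hsum
    have h4 : (1 - δ / 4) * (m * (1 - δ / 2)) ≤
        (1 - δ / 4) * ∑ j, ‖D'.1.feat lam (ω j)‖ ^ 2 :=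
      mul_le_mul_of_nonneg_left hgood.le (by linarith)
    have h5 : 0 ≤ (m : ℝ) * δ ^ 2 := by positivity
    nlinarith

/-- Multiplication of all the coefficients of a family of dipoles by a constant. -/
def DipoleFamily.scale {d : ℕ} {ε R : ℝ} {ι : Type} (D : DipoleFamily d ε R ι) (c : ℝ) :
    DipoleFamily d ε R ι where
  a i := c * D.a i
  b i := c * D.b i
  p := D.p
  q := D.q
  norm_p_le := D.norm_p_le
  norm_q_le := D.norm_q_le
  dist_le := D.dist_le
  sep i j hij hi hj := D.sep i j hij (hi.imp right_ne_zero_of_mul right_ne_zero_of_mul)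
    (hj.imp right_ne_zero_of_mul right_ne_zero_of_mul)

lemma DipoleFamily.quad_scale {d : ℕ} {ε R : ℝ} {ι : Type} [Fintype ι]
    (D : DipoleFamily d ε R ι) (c lam : ℝ) : (D.scale c).quad lam = c ^ 2 * D.quad lam := by
  simp only [quad, Finset.mul_sum]
  refine Finset.sum_congr rfl fun i _ => Finset.sum_congr rfl fun j _ => ?_
  simp only [ip, dipoleInner, scale]
  ring

lemma DipoleFamily.feat_scale {d : ℕ} {ε R : ℝ} {ι : Type} [Fintype ι]
    (D : DipoleFamily d ε R ι) (c lam : ℝ) (ω : Space d) :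
    (D.scale c).feat lam ω = c * D.feat lam ω := by
  simp only [feat, Finset.mul_sum, scale]
  refine Finset.sum_congr rfl fun i _ => ?_
  push_cast
  ring

/-- By homogeneity the dipole family of `P - Q` is divided by its kernel norm, which makes it
normalized. -/
lemma sqrt_mul_mmd_le_norm_sketch_sub {d k m : ℕ} (hd : 1 ≤ d) {lam ε R δ : ℝ} (hl : 0 < lam)
    (hε : 0 < ε) (hR : 0 ≤ R) (hm : 0 < m) {ω : Fin m → Space d}
    (hω : ∀ D : DipoleFamily d ε R (Fin (2 * k)), D.quad lam = 1 →
        m * (1 - δ) ≤ ∑ j, ‖D.feat lam (ω j)‖ ^ 2)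
    {H : Set (Finset (Space d))} (hH : H ⊆ separated d k (2 * ε) R) {P Q : Measure (Space d)}
    (hP : P ∈ model H) (hQ : Q ∈ model H) :
    √(1 - δ) * mmd lam P Q ≤ ‖sketch lam ω P - sketch lam ω Q‖ := by
  rcases (mmd_nonneg lam P Q).lt_or_eq with h0 | h0
  swap
  · rw [← h0, mul_zero]; exact norm_nonneg _
  obtain ⟨h₁, hh₁, α₁, hα₁, rfl⟩ := hP
  obtain ⟨h₂, hh₂, α₂, hα₂, rfl⟩ := hQ
  obtain ⟨D, hD⟩ := exists_dipoleFamily hε hR (hH hh₁) (hH hh₂) α₁ α₂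
  have hsq := mmd_mixture_sq hd hl hα₁ hα₂ hD
  set μ := mmd lam (mixture h₁ α₁) (mixture h₂ α₂)
  have hm' : (0 : ℝ) < m := by exact_mod_cast hm
  have h1 := hω (D.scale μ⁻¹) (by rw [D.quad_scale, ← hsq]; field_simp)
  have h2 : ∀ j, ‖(D.scale μ⁻¹).feat lam (ω j)‖ ^ 2 = (μ ^ 2)⁻¹ * ‖D.feat lam (ω j)‖ ^ 2 := by
    intro j
    rw [D.feat_scale, norm_mul, mul_pow, Complex.norm_real, Real.norm_eq_abs, sq_abs, inv_pow]
  simp only [h2, ← Finset.mul_sum] at h1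
  have h3 : ‖sketch lam ω (mixture h₁ α₁) - sketch lam ω (mixture h₂ α₂)‖ ^ 2 =
      (∑ j, ‖D.feat lam (ω j)‖ ^ 2) / m := by
    rw [norm_sketch_mixture_sub_sq lam ω hα₁ hα₂]
    simp only [hD, DipoleFamily.feat]
  have h4 : (1 - δ) * μ ^ 2 ≤
      ‖sketch lam ω (mixture h₁ α₁) - sketch lam ω (mixture h₂ α₂)‖ ^ 2 := by
    rw [h3, le_div_iff₀ hm']
    rw [inv_mul_eq_div, le_div_iff₀ (by positivity)] at h1
    linarith
  rw [← Real.sqrt_sq h0.le, ← Real.sqrt_mul' _ (sq_nonneg μ)]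
  exact Real.sqrt_le_iff.2 ⟨norm_nonneg _, h4⟩

/-- The constant `K` is left free: it is the compatibility constant for (a) and its explicit bound
for (b). -/
lemma riskDist_model_le_sketch {d k m p : ℕ} (hd : 1 ≤ d) {lam ε R δ : ℝ} (hl : 0 < lam)
    (hε : 0 < ε) (hR : 0 ≤ R) (hδ1 : δ < 1) (hm : 0 < m) {ω : Fin m → Space d}
    (hω : ∀ D : DipoleFamily d ε R (Fin (2 * k)), D.quad lam = 1 →
        m * (1 - δ) ≤ ∑ j, ‖D.feat lam (ω j)‖ ^ 2)
    {H : Set (Finset (Space d))} (hH : H ⊆ separated d k (2 * ε) R) {P Q : Measure (Space d)}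
    (hP : P ∈ model H) (hQ : Q ∈ model H) {K : ℝ≥0∞}
    (hK : riskDist p H P Q ≤ K * ENNReal.ofReal (mmd lam P Q)) :
    riskDist p H P Q ≤
      K / ENNReal.ofReal √(1 - δ) * ‖sketch lam ω P - sketch lam ω Q‖ₑ := by
  have hs : 0 < √(1 - δ) := Real.sqrt_pos.2 (by linarith)
  have h1 := sqrt_mul_mmd_le_norm_sketch_sub hd hl hε hR hm hω hH hP hQ
  have h2 : ENNReal.ofReal (mmd lam P Q) ≤
      ‖sketch lam ω P - sketch lam ω Q‖ₑ / ENNReal.ofReal √(1 - δ) := by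
    rw [← ofReal_norm, ← ENNReal.ofReal_div_of_pos hs]
    apply ENNReal.ofReal_le_ofReal
    rw [le_div_iff₀ hs]
    linarith
  calc _ ≤ K * (‖sketch lam ω P - sketch lam ω Q‖ₑ / ENNReal.ofReal √(1 - δ)) :=
        hK.trans (by gcongr)
    _ = _ := by simp only [div_eq_mul_inv]; ring

/-! ### From the lower isometry to the excess risk -/

lemma ofReal_abs_risk_sub_le {d p : ℕ} {H : Set (Finset (Space d))} {h : Finset (Space d)}
    (hh : h ∈ H) (P Q P' : Measure (Space d)) :
    ENNReal.ofReal |risk p P h - risk p P' h| ≤ riskDist p H P Q + riskDist p H Q P' := by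
  have h1 : |risk p P h - risk p P' h| ≤ |risk p P h - risk p Q h| + |risk p Q h - risk p P' h| :=
    abs_sub_le _ _ _
  refine (ENNReal.ofReal_le_ofReal h1).trans (ENNReal.ofReal_add_le.trans (add_le_add ?_ ?_))
  · exact le_iSup₂_of_le h hh le_rfl
  · exact le_iSup₂_of_le h hh le_rfl

/-- The fitted mixture `P'` has zero risk at its own centroids and nonnegative risk at `h_star`, so
the excess risk is at most two risk discrepancies between `P₀` and `P'`. Each passes through an
arbitrary `Q` in the model; from `Q` to `P'` it is a sketch distance, at most `2‖A(Q) - y‖` by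
optimality of the fit. -/
lemma excess_risk_le {d m p : ℕ} (hp : p ≠ 0) {lam : ℝ} {ω : Fin m → Space d}
    {H : Set (Finset (Space d))} {CA : ℝ≥0∞}
    (hCA : ∀ P ∈ model H, ∀ Q ∈ model H,
      riskDist p H P Q ≤ CA * ‖sketch lam ω P - sketch lam ω Q‖ₑ)
    (P₀ : Measure (Space d)) (y : EuclideanSpace ℂ (Fin m)) {h_est h_star : Finset (Space d)}
    (hest : IsSketchEstimate lam ω H y h_est) (hstar : h_star ∈ H) :
    ENNReal.ofReal (risk p P₀ h_est - risk p P₀ h_star) ≤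
      2 * bias lam p ω CA H P₀ + 4 * CA * ‖sketch lam ω P₀ - y‖ₑ := by
  obtain ⟨hestH, α, hα, hmin⟩ := hest
  set P' := mixture h_est α with hP'
  have hP'model : P' ∈ model H := ⟨h_est, hestH, α, hα, rfl⟩
  have hzero : risk p P' h_est = 0 := by
    rw [hP', risk_mixture hα]
    exact Finset.sum_eq_zero fun c _ => by rw [loss_eq_zero hp c.2, mul_zero]
  have hnn : 0 ≤ risk p P' h_star := integral_nonneg fun x => loss_nonneg p x h_star
  have hsplit : risk p P₀ h_est - risk p P₀ h_star ≤
      |risk p P₀ h_est - risk p P' h_est| + |risk p P₀ h_star - risk p P' h_star| := by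
    have h1 := le_abs_self (risk p P₀ h_est - risk p P' h_est)
    have h2 := neg_abs_le (risk p P₀ h_star - risk p P' h_star)
    linarith
  have hQ : ∀ Q ∈ model H, ENNReal.ofReal (risk p P₀ h_est - risk p P₀ h_star) ≤
      2 * (riskDist p H P₀ Q + 2 * CA * ‖sketch lam ω P₀ - sketch lam ω Q‖ₑ) +
        4 * CA * ‖sketch lam ω P₀ - y‖ₑ := by
    intro Q hQ
    have hopt : ‖y - sketch lam ω P'‖ₑ ≤ ‖sketch lam ω Q - y‖ₑ := by
      obtain ⟨h', hh', α', hα', rfl⟩ := hQ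
      have h1 := hmin h' hh' α' hα'
      rw [← sketch_mixture lam ω hα, ← sketch_mixture lam ω hα'] at h1
      have h2 := le_of_sq_le_sq h1 (norm_nonneg _)
      rw [← ofReal_norm, ← ofReal_norm, norm_sub_rev]
      exact ENNReal.ofReal_le_ofReal h2
    have htri : ‖sketch lam ω Q - sketch lam ω P'‖ₑ ≤
        2 * (‖sketch lam ω P₀ - sketch lam ω Q‖ₑ + ‖sketch lam ω P₀ - y‖ₑ) := by
      have e1 : sketch lam ω Q - sketch lam ω P' =
          (sketch lam ω Q - y) + (y - sketch lam ω P') := by abel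
      have e2 : sketch lam ω Q - y =
          (sketch lam ω P₀ - y) - (sketch lam ω P₀ - sketch lam ω Q) := by abel
      have h1 : ‖sketch lam ω Q - y‖ₑ ≤
          ‖sketch lam ω P₀ - y‖ₑ + ‖sketch lam ω P₀ - sketch lam ω Q‖ₑ := by
        rw [e2]; exact enorm_sub_le
      rw [e1]
      calc _ ≤ ‖sketch lam ω Q - y‖ₑ + ‖y - sketch lam ω P'‖ₑ := enorm_add_le _ _
        _ ≤ _ + _ := add_le_add h1 (hopt.trans h1)
        _ = _ := by ring
    calc _ ≤ ENNReal.ofReal |risk p P₀ h_est - risk p P' h_est| +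
          ENNReal.ofReal |risk p P₀ h_star - risk p P' h_star| :=
          (ENNReal.ofReal_le_ofReal hsplit).trans ENNReal.ofReal_add_le
      _ ≤ (riskDist p H P₀ Q + riskDist p H Q P') + (riskDist p H P₀ Q + riskDist p H Q P') :=
          add_le_add (ofReal_abs_risk_sub_le hestH _ _ _) (ofReal_abs_risk_sub_le hstar _ _ _)
      _ = 2 * (riskDist p H P₀ Q + riskDist p H Q P') := by ring
      _ ≤ 2 * (riskDist p H P₀ Q + CA *
          (2 * (‖sketch lam ω P₀ - sketch lam ω Q‖ₑ + ‖sketch lam ω P₀ - y‖ₑ))) := by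
          gcongr
          exact (hCA Q hQ P' hP'model).trans (by gcongr)
      _ = _ := by ring
  have h2 : (2 : ℝ≥0∞) ≠ 0 := two_ne_zero
  have h2' : (2 : ℝ≥0∞) ≠ ⊤ := ENNReal.ofNat_ne_top
  -- The bound is solved for the bracket in `Q`, so that the infimum can be taken without assuming
  -- that anything is finite or attained.
  have key : (ENNReal.ofReal (risk p P₀ h_est - risk p P₀ h_star) -
      4 * CA * ‖sketch lam ω P₀ - y‖ₑ) / 2 ≤ bias lam p ω CA H P₀ := by
    refine le_iInf₂ fun Q hQm => ?_
    exact ENNReal.div_le_of_le_mul' (tsub_le_iff_right.2 (hQ Q hQm))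
  rw [ENNReal.div_le_iff h2 h2', mul_comm (bias _ _ _ _ _ _)] at key
  exact tsub_le_iff_right.1 key

lemma bias_mono {d m p : ℕ} {lam : ℝ} {ω : Fin m → Space d} {CA CA' : ℝ≥0∞} (h : CA ≤ CA')
    (H : Set (Finset (Space d))) (P₀ : Measure (Space d)) :
    bias lam p ω CA H P₀ ≤ bias lam p ω CA' H P₀ :=
  iInf₂_mono fun Q _ => by gcongr

lemma sketchSize_pos {d k : ℕ} (hd : 1 ≤ d) (hk : 1 ≤ k) {ε R δ ζ : ℝ} (hε : 0 < ε) (hR : ε < R)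
    (hδ : 0 < δ) (hδ1 : δ < 1) (hζ : 0 < ζ) (hζ1 : ζ < 1) : 0 < sketchSize d k ε R δ ζ := by
  have hk' : (1 : ℝ) ≤ k := by exact_mod_cast hk
  have hd' : (1 : ℝ) ≤ d := by exact_mod_cast hd
  obtain ⟨hℓ, -⟩ := one_le_log_mul_exp hk
  have h1 : 0 ≤ Real.log ((k : ℝ) * d) := Real.log_nonneg (by nlinarith)
  have h2 : 0 ≤ Real.log (R / ε) := Real.log_nonneg ((one_le_div hε).2 hR.le)
  have h3 : 0 ≤ Real.log (1 / δ) := Real.log_nonneg ((one_le_div hδ).2 hδ1.le)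
  have h4 : 0 ≤ Real.log (1 / ζ) := Real.log_nonneg ((one_le_div hζ).2 hζ1.le)
  have h5 : 0 < min (Real.log (k * Real.exp 1)) (d : ℝ) := lt_min (by linarith) (by linarith)
  have h6 : 0 < Real.log (k * Real.exp 1) := by linarith
  rw [sketchSize]
  positivity

end CompressiveClustering

end

open CompressiveClustering in
theorem theorem3 :
    ∃ C : ℝ, 0 < C ∧
      ∀ p : ℕ, p = 1 ∨ p = 2 →
      ∀ d k m : ℕ, 1 ≤ d → 1 ≤ k →
      ∀ lam ε R δ ζ : ℝ, 0 < lam → ε = 1 / (lam * sigma k) → ε < R →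
        (separated d k (2 * ε) R).Nonempty →
        0 < δ → δ < 1 → 0 < ζ → ζ < 1 →
        C * sketchSize d k ε R δ ζ ≤ (m : ℝ) →
        (∀ H ⊆ separated d k (2 * ε) R,
          compat lam p H ≤ ENNReal.ofReal (8 * √6 * √(k : ℝ) * R ^ p)) ∧
        ∃ G : Set (Fin m → Space d), MeasurableSet G ∧
          ENNReal.ofReal (1 - ζ) ≤ (Measure.pi fun _ : Fin m => freqLaw d lam) G ∧
          ∀ ω ∈ G, ∀ H ⊆ separated d k (2 * ε) R,
            ∀ P₀ : Measure (Space d), IsProbabilityMeasure P₀ →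
              (∀ h ∈ H, Integrable (fun x => loss p x h) P₀) →
            ∀ n : ℕ, 1 ≤ n → ∀ x : Fin n → Space d,
            ∀ h_est h_star : Finset (Space d),
              IsSketchEstimate lam ω H (sketch lam ω (empirical x)) h_est →
              h_star ∈ H → (∀ h ∈ H, risk p P₀ h_star ≤ risk p P₀ h) →
              -- the bound with the compatibility constant itself
              (∀ CA : ℝ≥0∞, CA = compat lam p H / ENNReal.ofReal √(1 - δ) →
                ENNReal.ofReal (risk p P₀ h_est - risk p P₀ h_star) ≤
                  2 * bias lam p ω CA H P₀ +
                    4 * CA * ‖sketch lam ω P₀ - sketch lam ω (empirical x)‖ₑ) ∧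
              -- the bound with the explicit value of the constant
              (∀ CA : ℝ≥0∞,
                CA = ENNReal.ofReal (8 * √6 * √(k : ℝ) * R ^ p / √(1 - δ)) →
                ENNReal.ofReal (risk p P₀ h_est - risk p P₀ h_star) ≤
                  2 * bias lam p ω CA H P₀ +
                    CA * ‖sketch lam ω P₀ - sketch lam ω (empirical x)‖ₑ) := by
  refine ⟨42336000, by norm_num, ?_⟩
  intro p hp d k m hd hk lam ε R δ ζ hl hε hR _ hδ hδ1 hζ hζ1 hm
  have hε0 := (separation_scale hk hl hε).1
  have hR0 : 0 < R := hε0.trans hR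
  have hp0 : p ≠ 0 := by rcases hp with rfl | rfl <;> norm_num
  have hm0 : 0 < m := by
    have := sketchSize_pos hd hk hε0 hR hδ hδ1 hζ hζ1
    have : (0 : ℝ) < m := lt_of_lt_of_le (by positivity) hm
    exact_mod_cast this
  refine ⟨fun H hH => (compat_le hd hk hp hl hε hR hH).trans (ENNReal.ofReal_le_ofReal ?_), ?_⟩
  · gcongr
    norm_num
  obtain ⟨G, hGm, hGp, hG⟩ :=
    exists_measurableSet_lower_isometry hd hk hl hε hR hδ hδ1 hζ hζ1 hm
  refine ⟨G, hGm, hGp, fun ω hω H hH P₀ _ _ n _ x h_est h_star hest hstar _ => ⟨?_, ?_⟩⟩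
  · rintro CA rfl
    exact excess_risk_le hp0 (fun P hP Q hQ => riskDist_model_le_sketch hd hl hε0 hR0.le hδ1 hm0
      (hG ω hω) hH hP hQ (riskDist_model_le_compat hd hk hp hl hε hR hH hP hQ)) P₀ _ hest hstar
  · intro CA hCA
    have h1 := excess_risk_le hp0 (fun P hP Q hQ => riskDist_model_le_sketch hd hl hε0 hR0.le hδ1
      hm0 (hG ω hω) hH hP hQ (riskDist_model_le hd hk hp hl hε hR hH hP hQ)) P₀ _ hest hstar
    -- The slack between `2√6` and `8√6` absorbs the factor `4` in front of the noise term; in the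
    -- bias term the larger constant only increases the bound.
    have hfour : 4 * (ENNReal.ofReal (2 * √6 * √(k : ℝ) * R ^ p) / ENNReal.ofReal √(1 - δ)) =
        CA := by
      rw [hCA, ENNReal.ofReal_div_of_pos (Real.sqrt_pos.2 (by linarith)), ← mul_div_assoc,
        show (4 : ℝ≥0∞) = ENNReal.ofReal 4 by simp, ← ENNReal.ofReal_mul (by norm_num)]
      congr 2
      ring
    rw [hfour] at h1
    refine h1.trans (add_le_add (mul_le_mul_right (bias_mono ?_ H P₀) 2) le_rfl)
    rw [← hfour]
    exact le_mul_of_one_le_left zero_le (by norm_num)
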